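/- Let $E$ be a (Hausdorff) smooth manifold of dimension $n+m$ and let $\Gamma$ be a smooth torsion-free linear connection on $TE\to E$. Let $J^r(E,n)$ be the manifold of $r$-jets $[L]^r_p$ of $n$-dimensional embedded submanifolds $L\subset E$ at points $p \in L$, with its natural smooth structure given by divided charts $(u^\lambda,u^i)$ and the derivative coordinates, and with projections $\pi_{k,h}\colon J^k(E,n)\to J^h(E,n)$, $J^0(E,n)=E$. For $r=1,2$ let $H^{r,0}$ be the vector bundle over $J^r(E,n)$ with fibre $T_pL\subset T_pE$ at $[L]^r_p$, and $V^{r,0}=\pi_{r,0}^*TE/H^{r,0}$, with quotient projection $\omega^r$. For $\theta_2=[L]^2_p$ over $\theta_1=[L]^1_p$ let $R_{\theta_2}=T_{\theta_1}L^{(1)}\subset T_{\theta_1}J^1(E,n)$, where $L^{(1)}=\{[L]^1_q : q\in L\}$. (a) There is a unique smooth connection $\dot\Gamma$ on $\pi_{1,0}\colon J^1(E,n)\to E$ whose horizontal vectors $v$ satisfy $\omega^1\big(\nabla[\pi_{1,0}^*\Gamma]_v\, s\big)=0$ for all local sections $s$ of $H^{1,0}$ (this is the connection $\dot\Gamma$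 associated with $\Gamma$). (b) There is a unique section $\ddot\Gamma\colon J^1(E,n)\to J^2(E,n)$ of $\pi_{2,1}$ such that $D^2\circ\ddot\Gamma=D^1\lrcorner\,\dot\Gamma$, that is, such that for every $\theta_1\in J^1(E,n)$ the plane $R_{\ddot\Gamma(\theta_1)}$ is the $\dot\Gamma$-horizontal lift at $\theta_1$ of the fibre $H^{1,0}_{\theta_1}\subset T_pE$, $p=\pi_{1,0}(\theta_1)$. This section is smooth. (c) There is a unique map $\operatorname{II}$ assigning to each $\theta_2\in J^2(E,n)$ a bilinear map $H^{2,0}_{\theta_2}\times H^{2,0}_{\theta_2}\to V^{2,0}_{\theta_2}$ such that $\operatorname{II}(X,Y)=\omega^2\big(\nabla[\pi_{2,0}^*\Gamma]_{\widetilde X}Y\big)$ for all local sections $Y$ of $H^{2,0}$ and all vectors $\widetilde X$ in the Cartan distribution of $J^2(E,n)$ (the distribution spanned by the tangent spaces of the prolongations $L^{(2)}=\{[L]^2_q : q\in L\}$) which project onto $X$; it is symmetric. It is called the universal second fundamental form. (d) The image of $\ddot\Gamma$ is exactly the equation $\mathcal S=\{\theta_2\in J^2(E,n):\operatorname{II}(\theta_2)=0\}$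 of unparametrized $n$-dimensional totally geodesic submanifolds. -/

import Mathlib

open Set Filter Topology
open scoped Manifold ContDiff

namespace SubmanifoldJet

noncomputable section

section Calculus


variable {V W : Type*} [NormedAddCommGroup V] [NormedSpace ℝ V] [NormedAddCommGroup W]
  [NormedSpace ℝ W]

/-- The subspaces of a normed space. -/
abbrev NormedSubspace (X : Type*) [NormedAddCommGroup X] [NormedSpace ℝ X] := Submodule ℝ X

/-- The symmetric bilinear maps `V × V → W`. -/
def symBilin (V W : Type*) [NormedAddCommGroup V] [NormedSpace ℝ V] [NormedAddCommGroup W]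
    [NormedSpace ℝ W] : NormedSubspace (V →L[ℝ] V →L[ℝ] W) where
  carrier := {B | ∀ u v, B u v = B v u}
  add_mem' := fun ha hb u v => by simp [ha u v, hb u v]
  zero_mem' := fun u v => by simp
  smul_mem' := fun c a ha u v => by simp [ha u v]

/-- Symmetrization of bilinear maps. -/
def symmetrize : (V →L[ℝ] V →L[ℝ] W) →L[ℝ] symBilin V W :=
  ((1 / 2 : ℝ) • (ContinuousLinearMap.id ℝ (V →L[ℝ] V →L[ℝ] W) +
    ((ContinuousLinearMap.flipₗᵢ ℝ V V W).toContinuousLinearEquiv :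
      (V →L[ℝ] V →L[ℝ] W) →L[ℝ] (V →L[ℝ] V →L[ℝ] W)))).codRestrict (symBilin V W)
    (fun B u v => by simp [add_comm])

set_option synthInstance.maxHeartbeats 400000 in
lemma coe_symmetrize {B : V →L[ℝ] V →L[ℝ] W} (hB : B ∈ symBilin V W) :
    (symmetrize B : V →L[ℝ] V →L[ℝ] W) = B := by
  ext u v
  have := hB v u
  simp [symmetrize, this, ← two_smul ℝ]

lemma contDiff_coe_symBilin :
    ContDiff ℝ ∞ (fun B : symBilin V W => (B : V →L[ℝ] V →L[ℝ] W)) :=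
  ContinuousLinearMap.contDiff (𝕜 := ℝ) (E := symBilin V W) (F := V →L[ℝ] V →L[ℝ] W)
    (symBilin V W).subtypeL

lemma contDiff_symmetrize :
    ContDiff ℝ ∞ (fun B : V →L[ℝ] V →L[ℝ] W => symmetrize B) :=
  ContinuousLinearMap.contDiff (𝕜 := ℝ) (F := symBilin V W) (E := V →L[ℝ] V →L[ℝ] W)
    (symmetrize (V := V) (W := W))

/-- Derivative at `x` of the first component of `z ↦ τ (z, f z)`, in terms of
`b = ((x, f x), Df(x))`. -/
def baseDeriv (τ : V × W → V × W) (b : (V × W) × (V →L[ℝ] W)) : V →L[ℝ] V :=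
  (ContinuousLinearMap.fst ℝ V W ∘L fderiv ℝ τ b.1) ∘L (ContinuousLinearMap.id ℝ V).prod b.2

/-- Derivative at `x` of the second component of `z ↦ τ (z, f z)`. -/
def fibreDeriv (τ : V × W → V × W) (b : (V × W) × (V →L[ℝ] W)) : V →L[ℝ] W :=
  (ContinuousLinearMap.snd ℝ V W ∘L fderiv ℝ τ b.1) ∘L (ContinuousLinearMap.id ℝ V).prod b.2

/-- Transformation law of first derivatives. -/
def slopeMap (τ : V × W → V × W) (b : (V × W) × (V →L[ℝ] W)) : V →L[ℝ] W :=
  fibreDeriv τ b ∘L (baseDeriv τ b).inverse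

/-- Transformation law of first order jet coordinates. -/
def prolong₁ (τ : V × W → V × W) (b : (V × W) × (V →L[ℝ] W)) : (V × W) × (V →L[ℝ] W) :=
  (τ b.1, slopeMap τ b)

/-- Transformation law of second order jet coordinates. -/
def prolong₂ (τ : V × W → V × W) (c : ((V × W) × (V →L[ℝ] W)) × symBilin V W) :
    ((V × W) × (V →L[ℝ] W)) × symBilin V W :=
  (prolong₁ τ c.1, symmetrize ((fderiv ℝ (slopeMap τ) c.1 ∘L
    ((ContinuousLinearMap.id ℝ V).prod c.1.2).prod (c.2 : V →L[ℝ] V →L[ℝ] W)) ∘L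
      (baseDeriv τ c.1).inverse))

/-- The domain on which the first order transformation law applies. -/
def prolongDomain (τ : V × W → V × W) (U : Set (V × W)) : Set ((V × W) × (V →L[ℝ] W)) :=
  {b | b.1 ∈ U ∧ (baseDeriv τ b).IsInvertible}

lemma contDiffOn_derivParts {τ : V × W → V × W} {U : Set (V × W)} (hU : IsOpen U)
    (hτ : ContDiffOn ℝ ∞ τ U) :
    ContDiffOn ℝ ∞ (baseDeriv τ) (Prod.fst ⁻¹' U) ∧
      ContDiffOn ℝ ∞ (fibreDeriv τ) (Prod.fst ⁻¹' U) := by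
  have h1 : ContDiffOn ℝ ∞ (fderiv ℝ τ) U := hτ.fderiv_of_isOpen hU (by simp)
  have h2 : ContDiffOn ℝ ∞ (fun b : (V × W) × (V →L[ℝ] W) => fderiv ℝ τ b.1) (Prod.fst ⁻¹' U) :=
    h1.comp contDiff_fst.contDiffOn (fun _ h => h)
  have h3 : ContDiff ℝ ∞ (fun b : (V × W) × (V →L[ℝ] W) =>
      (ContinuousLinearMap.id ℝ V).prod b.2) := by
    have : ContDiff ℝ ∞ (fun b : (V × W) × (V →L[ℝ] W) =>
      (ContinuousLinearMap.inl ℝ V W) + (ContinuousLinearMap.inr ℝ V W) ∘L b.2) := by fun_prop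
    convert this using 1
    ext b v <;> simp
  constructor
  · exact (contDiffOn_const.clm_comp h2).clm_comp h3.contDiffOn
  · exact (contDiffOn_const.clm_comp h2).clm_comp h3.contDiffOn

lemma isOpen_setOf_isInvertible [CompleteSpace V] :
    IsOpen {P : V →L[ℝ] V | P.IsInvertible} := by
  have := ContinuousLinearEquiv.isOpen (𝕜 := ℝ) (E := V) (F := V)
  exact this

lemma isOpen_prolongDomain [CompleteSpace V] {τ : V × W → V × W} {U : Set (V × W)} (hU : IsOpen U)
    (hτ : ContDiffOn ℝ ∞ τ U) : IsOpen (prolongDomain τ U) :=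
  (contDiffOn_derivParts hU hτ).1.continuousOn.isOpen_inter_preimage
    (hU.preimage continuous_fst) isOpen_setOf_isInvertible

lemma contDiffOn_inverse [CompleteSpace V] {τ : V × W → V × W} {U : Set (V × W)} (hU : IsOpen U)
    (hτ : ContDiffOn ℝ ∞ τ U) :
    ContDiffOn ℝ ∞ (fun b => (baseDeriv τ b).inverse) (prolongDomain τ U) := by
  intro b hb
  have h1 : ContDiffAt ℝ ∞ (baseDeriv τ) b := (contDiffOn_derivParts hU hτ).1.contDiffAt
    ((hU.preimage continuous_fst).mem_nhds hb.1)
  exact (ContDiffAt.comp b hb.2.contDiffAt_map_inverse h1).contDiffWithinAt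

lemma contDiffOn_slopeMap [CompleteSpace V] {τ : V × W → V × W} {U : Set (V × W)} (hU : IsOpen U)
    (hτ : ContDiffOn ℝ ∞ τ U) : ContDiffOn ℝ ∞ (slopeMap τ) (prolongDomain τ U) :=
  ((contDiffOn_derivParts hU hτ).2.mono (fun _ h => h.1)).clm_comp (contDiffOn_inverse hU hτ)

lemma contDiffOn_prolong₁ [CompleteSpace V] {τ : V × W → V × W} {U : Set (V × W)} (hU : IsOpen U)
    (hτ : ContDiffOn ℝ ∞ τ U) : ContDiffOn ℝ ∞ (prolong₁ τ) (prolongDomain τ U) :=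
  (hτ.comp contDiff_fst.contDiffOn (fun _ h => h.1)).prodMk (contDiffOn_slopeMap hU hτ)

lemma contDiffOn_prolong₂ [CompleteSpace V] {τ : V × W → V × W} {U : Set (V × W)} (hU : IsOpen U)
    (hτ : ContDiffOn ℝ ∞ τ U) :
    ContDiffOn ℝ ∞ (prolong₂ τ) (Prod.fst ⁻¹' prolongDomain τ U) := by
  have hfst : ContDiffOn ℝ ∞ (Prod.fst : ((V × W) × (V →L[ℝ] W)) × symBilin V W → _)
    (Prod.fst ⁻¹' prolongDomain τ U) := contDiff_fst.contDiffOn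
  have h1 := (contDiffOn_prolong₁ hU hτ).comp hfst (fun _ h => h)
  have h2 := (((contDiffOn_slopeMap hU hτ).fderiv_of_isOpen (m := ∞)
    (isOpen_prolongDomain hU hτ) (by simp)).comp hfst (fun _ h => h))
  have h3 := (contDiffOn_inverse hU hτ).comp hfst (fun _ h => h)
  have h4 : ContDiff ℝ ∞ (fun c : ((V × W) × (V →L[ℝ] W)) × symBilin V W =>
      ((ContinuousLinearMap.id ℝ V).prod c.1.2).prod (c.2 : V →L[ℝ] V →L[ℝ] W)) := by
    have hc : ContDiff ℝ ∞ (fun c : ((V × W) × (V →L[ℝ] W)) × symBilin V W =>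
      (c.2 : V →L[ℝ] V →L[ℝ] W)) := contDiff_coe_symBilin.comp contDiff_snd
    have : ContDiff ℝ ∞ (fun c : ((V × W) × (V →L[ℝ] W)) × symBilin V W =>
      ContinuousLinearMap.inl ℝ (V × W) (V →L[ℝ] W) ∘L ((ContinuousLinearMap.inl ℝ V W) +
        (ContinuousLinearMap.inr ℝ V W) ∘L c.1.2) +
        (ContinuousLinearMap.inr ℝ (V × W) (V →L[ℝ] W)) ∘L (c.2 : V →L[ℝ] V →L[ℝ] W)) := by
      fun_prop
    convert this using 1
    ext c v <;> simp
  exact h1.prodMk (contDiff_symmetrize.comp_contDiffOn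
    ((h2.clm_comp h4.contDiffOn).clm_comp h3))

lemma hasFDerivAt_parts {τ : V × W → V × W} {f : V → W} {x : V}
    (hτ : DifferentiableAt ℝ τ (x, f x)) (hf : DifferentiableAt ℝ f x) :
    HasFDerivAt (fun z => (τ (z, f z)).1) (baseDeriv τ ((x, f x), fderiv ℝ f x)) x ∧
    HasFDerivAt (fun z => (τ (z, f z)).2) (fibreDeriv τ ((x, f x), fderiv ℝ f x)) x := by
  have h1 : HasFDerivAt (fun z => (z, f z)) ((ContinuousLinearMap.id ℝ V).prod (fderiv ℝ f x)) x :=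
    (hasFDerivAt_id x).prodMk hf.hasFDerivAt
  have h2 : HasFDerivAt (fun z => τ (z, f z)) _ x := HasFDerivAt.comp x hτ.hasFDerivAt h1
  exact ⟨h2.fst, h2.snd⟩

lemma fderiv_eq_slopeMap {τ : V × W → V × W} {f f' : V → W} {x : V}
    (hτ : DifferentiableAt ℝ τ (x, f x)) (hf : DifferentiableAt ℝ f x)
    (hf' : DifferentiableAt ℝ f' (τ (x, f x)).1)
    (hP : (baseDeriv τ ((x, f x), fderiv ℝ f x)).IsInvertible)
    (h : ∀ᶠ z in 𝓝 x, f' (τ (z, f z)).1 = (τ (z, f z)).2) :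
    fderiv ℝ f' (τ (x, f x)).1 = slopeMap τ ((x, f x), fderiv ℝ f x) := by
  obtain ⟨h1, h2⟩ := hasFDerivAt_parts hτ hf
  have h3 : HasFDerivAt (fun z => f' (τ (z, f z)).1) _ x := HasFDerivAt.comp x hf'.hasFDerivAt h1
  have h4 := h3.unique (h2.congr_of_eventuallyEq h)
  obtain ⟨M, hM⟩ := hP
  rw [slopeMap, ← h4, ← hM]
  ext v; simp

lemma fderiv_fderiv_eq {τ : V × W → V × W} {f f' : V → W} {x : V}
    (hτ : DifferentiableAt ℝ τ (x, f x)) (hf : DifferentiableAt ℝ f x)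
    (hf2 : DifferentiableAt ℝ (fderiv ℝ f) x)
    (hf' : DifferentiableAt ℝ (fderiv ℝ f') (τ (x, f x)).1)
    (hP : (baseDeriv τ ((x, f x), fderiv ℝ f x)).IsInvertible)
    (hs : DifferentiableAt ℝ (slopeMap τ) ((x, f x), fderiv ℝ f x))
    (h : ∀ᶠ z in 𝓝 x, fderiv ℝ f' (τ (z, f z)).1 = slopeMap τ ((z, f z), fderiv ℝ f z)) :
    fderiv ℝ (fderiv ℝ f') (τ (x, f x)).1 =
      (fderiv ℝ (slopeMap τ) ((x, f x), fderiv ℝ f x) ∘L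
        ((ContinuousLinearMap.id ℝ V).prod (fderiv ℝ f x)).prod (fderiv ℝ (fderiv ℝ f) x)) ∘L
      (baseDeriv τ ((x, f x), fderiv ℝ f x)).inverse := by
  obtain ⟨h1, -⟩ := hasFDerivAt_parts hτ hf
  have h3 : HasFDerivAt (fun z => fderiv ℝ f' (τ (z, f z)).1) _ x :=
    HasFDerivAt.comp x hf'.hasFDerivAt h1
  have h5 : HasFDerivAt (fun z => ((z, f z), fderiv ℝ f z)) _ x :=
    ((hasFDerivAt_id x).prodMk hf.hasFDerivAt).prodMk hf2.hasFDerivAt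
  have h6 : HasFDerivAt (fun z => slopeMap τ ((z, f z), fderiv ℝ f z)) _ x :=
    HasFDerivAt.comp (g := slopeMap τ) (f := fun z => ((z, f z), fderiv ℝ f z)) x hs.hasFDerivAt h5
  have h4 := h3.unique (h6.congr_of_eventuallyEq h)
  obtain ⟨M, hM⟩ := hP
  rw [← hM] at h4 ⊢
  ext v w
  have := congrArg (fun T => T (M.symm v) w) h4
  simpa using this

lemma symmetric_snd {f : V → W} {x : V} (hf : ContDiffAt ℝ ∞ f x) :
    fderiv ℝ (fderiv ℝ f) x ∈ symBilin V W := by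
  intro u v
  exact (hf.isSymmSndFDerivAt (by simp; exact WithTop.coe_le_coe.2 le_top)).eq u v

end Calculus

section Jets

/-- `ℝᵏ`. -/
abbrev Euc (k : ℕ) := EuclideanSpace ℝ (Fin k)

variable (n m : ℕ) (E : Type*) [TopologicalSpace E] [ChartedSpace (Euc (n + m)) E]

/-- A divided chart `(u^λ, u^i)` of `E`: a smooth chart whose coordinates are divided into
`n` independent and `m` dependent ones. -/
structure DividedChart where
  chart : OpenPartialHomeomorph E (Euc n × Euc m)
  contMDiffOn_chart : ContMDiffOn (𝓡 (n + m)) 𝓘(ℝ, Euc n × Euc m) ∞ chart chart.source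
  contMDiffOn_symm : ContMDiffOn 𝓘(ℝ, Euc n × Euc m) (𝓡 (n + m)) ∞ chart.symm chart.target

variable {n m E}

/-- Near its point `p`, the set `L` is described by `u^i = f^i(u^1, …, u^n)`, with `f` smooth, in
the divided chart `e`. -/
def IsGraphAt (e : DividedChart n m E) (L : Set E) (p : E) (f : Euc n → Euc m) : Prop :=
  p ∈ L ∧ p ∈ e.chart.source ∧ (∀ᶠ x in 𝓝 (e.chart p).1, ContDiffAt ℝ ∞ f x) ∧
    ∀ᶠ q in 𝓝 p, (q ∈ L ↔ (e.chart q).2 = f (e.chart q).1)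

variable (n m E)

/-- `n`-dimensional embedded submanifolds of the `(n + m)`-dimensional manifold `E`. -/
structure EmbeddedSubmanifold where
  carrier : Set E
  isGraphAt : ∀ p ∈ carrier, ∃ (e : DividedChart n m E) (f : Euc n → Euc m),
    IsGraphAt e carrier p f

/-- An `n`-dimensional embedded submanifold `L` of `E` together with a point `p ∈ L`. -/
structure PointedSubmanifold where
  L : EmbeddedSubmanifold n m E
  pt : E
  mem : pt ∈ L.carrier

variable {n m E}

/-- Contact of order `r` at a point: in a divided chart concordant to both submanifolds, the
Taylor expansions of order `r` of the functions describing them coincide. -/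
def Contact (r : ℕ) (s t : PointedSubmanifold n m E) : Prop :=
  s.pt = t.pt ∧ ∃ (e : DividedChart n m E) (f g : Euc n → Euc m),
    IsGraphAt e s.L.carrier s.pt f ∧ IsGraphAt e t.L.carrier t.pt g ∧
    ∀ k ≤ r, iteratedFDeriv ℝ k f (e.chart s.pt).1 = iteratedFDeriv ℝ k g (e.chart s.pt).1

variable (n m E)

/-- The space `J^r(E, n)` of `r`-jets of `n`-dimensional submanifolds of `E`. -/
def Jet (r : ℕ) := Quot (Contact (n := n) (m := m) (E := E) r)

variable {n m E}

/-- The jet `[L]^r_p`. -/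
def jet (r : ℕ) (s : PointedSubmanifold n m E) : Jet n m E r := Quot.mk _ s

/-- The projection `π_{r,0} : J^r(E, n) → E`. -/
def Jet.point {r : ℕ} : Jet n m E r → E := Quot.lift PointedSubmanifold.pt fun _ _ h => h.1

/-- The projection `π_{r,k} : J^r(E, n) → J^k(E, n)`, for `k ≤ r`. -/
def Jet.proj {k r : ℕ} (hkr : k ≤ r) : Jet n m E r → Jet n m E k :=
  Quot.lift (jet k) fun _ _ ⟨h, e, f, g, hf, hg, hfg⟩ =>
    Quot.sound ⟨h, e, f, g, hf, hg, fun j hj => hfg j (hj.trans hkr)⟩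

/-- The change of coordinates between two divided charts. -/
def changeMap (e e' : DividedChart n m E) (a : Euc n × Euc m) : Euc n × Euc m :=
  e'.chart (e.chart.symm a)

/-- The domain of the change of coordinates between two divided charts. -/
def changeDomain (e e' : DividedChart n m E) : Set (Euc n × Euc m) :=
  e.chart.target ∩ e.chart.symm ⁻¹' e'.chart.source

lemma isOpen_changeDomain (e e' : DividedChart n m E) : IsOpen (changeDomain e e') :=
  e.chart.symm.isOpen_inter_preimage e'.chart.open_source

lemma contDiffOn_changeMap (e e' : DividedChart n m E) :
    ContDiffOn ℝ ∞ (changeMap e e') (changeDomain e e') := by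
  rw [← contMDiffOn_iff_contDiffOn]
  exact e'.contMDiffOn_chart.comp (e.contMDiffOn_symm.mono inter_subset_left) (fun _ h => h.2)

lemma mem_changeDomain {e e' : DividedChart n m E} {p : E} (h : p ∈ e.chart.source)
    (h' : p ∈ e'.chart.source) : e.chart p ∈ changeDomain e e' :=
  ⟨e.chart.map_source h, by simpa [e.chart.left_inv h] using h'⟩

lemma changeMap_chart {e e' : DividedChart n m E} {p : E} (h : p ∈ e.chart.source) :
    changeMap e e' (e.chart p) = e'.chart p := by
  simp [changeMap, e.chart.left_inv h]

namespace IsGraphAt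

variable {e e' : DividedChart n m E} {L : Set E} {p : E} {f f' : Euc n → Euc m}

lemma chart_eq (h : IsGraphAt e L p f) : e.chart p = ((e.chart p).1, f (e.chart p).1) :=
  Prod.ext rfl (h.2.2.2.self_of_nhds.1 h.1)

lemma contDiffAt (h : IsGraphAt e L p f) : ContDiffAt ℝ ∞ f (e.chart p).1 :=
  h.2.2.1.self_of_nhds

lemma nearby (h : IsGraphAt e L p f) : ∀ᶠ q in 𝓝 p, q ∈ L → IsGraphAt e L q f := by
  have hc : Tendsto (fun q => (e.chart q).1) (𝓝 p) (𝓝 (e.chart p).1) :=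
    continuous_fst.continuousAt.comp (e.chart.continuousAt h.2.1)
  filter_upwards [e.chart.open_source.mem_nhds h.2.1,
    hc.eventually h.2.2.1.eventually_nhds, h.2.2.2.eventually_nhds] with q h1 h2 h3 h4
  exact ⟨h4, h1, h2, h3⟩

lemma tendsto_param (h : IsGraphAt e L p f) :
    Tendsto (fun z => e.chart.symm (z, f z)) (𝓝 (e.chart p).1) (𝓝 p) := by
  have h1 : ContinuousAt (fun z => (z, f z)) (e.chart p).1 :=
    continuousAt_id.prodMk h.contDiffAt.continuousAt
  have h2 : ContinuousAt e.chart.symm ((e.chart p).1, f (e.chart p).1) :=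
    e.chart.continuousAt_symm (h.chart_eq ▸ e.chart.map_source h.2.1)
  have h3 := ContinuousAt.comp (f := fun z => (z, f z)) (g := e.chart.symm) h2 h1
  have h4 : e.chart.symm ((e.chart p).1, f (e.chart p).1) = p := by
    rw [← h.chart_eq, e.chart.left_inv h.2.1]
  simpa [ContinuousAt, h4, Function.comp_def] using h3

lemma eventually_target (h : IsGraphAt e L p f) :
    ∀ᶠ z in 𝓝 (e.chart p).1, (z, f z) ∈ e.chart.target := by
  have h1 : ContinuousAt (fun z => (z, f z)) (e.chart p).1 :=
    continuousAt_id.prodMk h.contDiffAt.continuousAt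
  exact h1.eventually (e.chart.open_target.mem_nhds (h.chart_eq ▸ e.chart.map_source h.2.1))

lemma eventually_param (h : IsGraphAt e L p f) :
    ∀ᶠ z in 𝓝 (e.chart p).1, (z, f z) ∈ e.chart.target ∧ e.chart.symm (z, f z) ∈ L := by
  filter_upwards [h.eventually_target, h.tendsto_param.eventually h.2.2.2] with z h1 h2
  exact ⟨h1, h2.2 (by simp [e.chart.right_inv h1])⟩

lemma eventually_both (h : IsGraphAt e L p f) (h' : IsGraphAt e' L p f') :
    ∀ᶠ z in 𝓝 (e.chart p).1, (z, f z) ∈ e.chart.target ∧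
      IsGraphAt e L (e.chart.symm (z, f z)) f ∧ IsGraphAt e' L (e.chart.symm (z, f z)) f' := by
  filter_upwards [h.eventually_param, h.tendsto_param.eventually h.nearby,
    h.tendsto_param.eventually h'.nearby] with z h1 h2 h3
  exact ⟨h1.1, h2 h1.2, h3 h1.2⟩

lemma eventually_change (h : IsGraphAt e L p f) (h' : IsGraphAt e' L p f') :
    ∀ᶠ z in 𝓝 (e.chart p).1,
      f' (changeMap e e' (z, f z)).1 = (changeMap e e' (z, f z)).2 ∧
      changeMap e' e (changeMap e e' (z, f z)) = (z, f z) := by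
  filter_upwards [h.eventually_both h'] with z hz
  refine ⟨congrArg Prod.snd hz.2.2.chart_eq.symm, ?_⟩
  simp [changeMap, e'.chart.left_inv hz.2.2.2.1, e.chart.right_inv hz.1]

lemma differentiableAt_change (h : IsGraphAt e L p f) (h' : p ∈ e'.chart.source) :
    ContDiffAt ℝ ∞ (changeMap e e') ((e.chart p).1, f (e.chart p).1) := by
  rw [← h.chart_eq]
  exact (contDiffOn_changeMap e e').contDiffAt
    ((isOpen_changeDomain e e').mem_nhds (mem_changeDomain h.2.1 h'))

lemma isInvertible (h : IsGraphAt e L p f) (h' : IsGraphAt e' L p f') :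
    (baseDeriv (changeMap e e') (e.chart p, fderiv ℝ f (e.chart p).1)).IsInvertible := by
  have h0 : (changeMap e e' ((e.chart p).1, f (e.chart p).1)) = e'.chart p := by
    rw [← h.chart_eq, changeMap_chart h.2.1]
  have h1 := (hasFDerivAt_parts ((h.differentiableAt_change h'.2.1).differentiableAt (by simp))
    (h.contDiffAt.differentiableAt (by simp))).1
  have h2 := (hasFDerivAt_parts ((h'.differentiableAt_change h.2.1).differentiableAt (by simp))
    (h'.contDiffAt.differentiableAt (by simp))).1
  have h3 := HasFDerivAt.comp (f := fun z => (changeMap e e' (z, f z)).1)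
    (g := fun z => (changeMap e' e (z, f' z)).1) (e.chart p).1 (by rw [h0]; exact h2) h1
  have h4 : HasFDerivAt (fun z : Euc n => z) _ (e.chart p).1 :=
    h3.congr_of_eventuallyEq (by
      filter_upwards [h.eventually_change h'] with z hz
      simp [hz.1, hz.2])
  have h5 := h4.unique (hasFDerivAt_id (𝕜 := ℝ) (e.chart p).1)
  rw [← h.chart_eq] at h5
  set P := baseDeriv (changeMap e e') (e.chart p, fderiv ℝ f (e.chart p).1)
  have h6 : Function.Injective (P : Euc n →ₗ[ℝ] Euc n) := by
    intro u v huv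
    have hu := DFunLike.congr_fun h5 u
    have hv := DFunLike.congr_fun h5 v
    simp only [ContinuousLinearMap.comp_apply] at hu hv
    have : P u = P v := huv
    rw [this, hv] at hu
    simpa using hu.symm
  refine ⟨(LinearEquiv.ofInjectiveEndo _ h6).toContinuousLinearEquiv, ?_⟩
  ext v; rfl

lemma fderiv_change (h : IsGraphAt e L p f) (h' : IsGraphAt e' L p f') :
    fderiv ℝ f' (e'.chart p).1 =
      slopeMap (changeMap e e') (e.chart p, fderiv ℝ f (e.chart p).1) := by
  have h0 : (changeMap e e' ((e.chart p).1, f (e.chart p).1)) = e'.chart p := by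
    rw [← h.chart_eq, changeMap_chart h.2.1]
  have hi := h.isInvertible h'
  rw [h.chart_eq] at hi
  have := fderiv_eq_slopeMap ((h.differentiableAt_change h'.2.1).differentiableAt (by simp))
    (h.contDiffAt.differentiableAt (by simp))
    (by rw [h0]; exact h'.contDiffAt.differentiableAt (by simp)) hi
    ((h.eventually_change h').mono fun z hz => hz.1)
  rwa [h0, ← h.chart_eq] at this

lemma fderiv_fderiv_change (h : IsGraphAt e L p f) (h' : IsGraphAt e' L p f') :
    fderiv ℝ (fderiv ℝ f') (e'.chart p).1 =
      (fderiv ℝ (slopeMap (changeMap e e')) (e.chart p, fderiv ℝ f (e.chart p).1) ∘L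
        ((ContinuousLinearMap.id ℝ (Euc n)).prod (fderiv ℝ f (e.chart p).1)).prod
          (fderiv ℝ (fderiv ℝ f) (e.chart p).1)) ∘L
      (baseDeriv (changeMap e e') (e.chart p, fderiv ℝ f (e.chart p).1)).inverse := by
  have h0 : (changeMap e e' ((e.chart p).1, f (e.chart p).1)) = e'.chart p := by
    rw [← h.chart_eq, changeMap_chart h.2.1]
  have hi := h.isInvertible h'
  have hs : DifferentiableAt ℝ (slopeMap (changeMap e e'))
      (e.chart p, fderiv ℝ f (e.chart p).1) :=
    ((contDiffOn_slopeMap (isOpen_changeDomain e e') (contDiffOn_changeMap e e')).contDiffAt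
      ((isOpen_prolongDomain (isOpen_changeDomain e e') (contDiffOn_changeMap e e')).mem_nhds
        ⟨mem_changeDomain h.2.1 h'.2.1, hi⟩)).differentiableAt (by simp)
  have hd : ∀ {g : Euc n → Euc m} {x : Euc n}, ContDiffAt ℝ ∞ g x →
      DifferentiableAt ℝ (fderiv ℝ g) x := fun hg =>
    (hg.fderiv_right (m := 1) (n := ∞) (WithTop.coe_le_coe.2 le_top)).differentiableAt
      (by simp)
  rw [h.chart_eq] at hi hs
  have := fderiv_fderiv_eq ((h.differentiableAt_change h'.2.1).differentiableAt (by simp))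
    (h.contDiffAt.differentiableAt (by simp)) (hd h.contDiffAt)
    (by rw [h0]; exact hd h'.contDiffAt) hi hs (by
      filter_upwards [h.eventually_both h'] with z hz
      have := hz.2.1.fderiv_change hz.2.2
      rw [e.chart.right_inv hz.1] at this
      exact this)
  rwa [h0, ← h.chart_eq] at this

/-- If the tangent plane is transversal, the submanifold is also a graph in another chart. -/
lemma exists_graph (h : IsGraphAt e L p f) (hp : p ∈ e'.chart.source)
    (hi : (baseDeriv (changeMap e e') (e.chart p, fderiv ℝ f (e.chart p).1)).IsInvertible) :
    ∃ f', IsGraphAt e' L p f' := by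
  obtain ⟨M, hM⟩ := hi
  set x := (e.chart p).1 with hx
  have hτ := h.differentiableAt_change hp
  have hD : HasFDerivAt (fun z => (changeMap e e' (z, f z)).1) (M : Euc n →L[ℝ] Euc n) x := by
    rw [hM, h.chart_eq]
    exact (hasFDerivAt_parts (hτ.differentiableAt (by simp))
      (h.contDiffAt.differentiableAt (by simp))).1
  have hgraph : ∀ᶠ z in 𝓝 x, ContDiffAt ℝ ∞ (fun z => changeMap e e' (z, f z)) z := by
    filter_upwards [h.2.2.1, h.eventually_param.and (h.tendsto_param.eventually
      (h.nearby.and (e'.chart.open_source.mem_nhds hp)))] with z hz hz'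
    have h1 := (hz'.2.1 hz'.1.2).differentiableAt_change hz'.2.2
    rw [e.chart.right_inv hz'.1.1] at h1
    exact ContDiffAt.comp (f := fun z => (z, f z)) (g := changeMap e e') z h1
      (contDiffAt_id.prodMk hz)
  have hC : ContDiffAt ℝ ∞ (fun z => (changeMap e e' (z, f z)).1) x := hgraph.self_of_nhds.fst
  set H := hC.toOpenPartialHomeomorph _ hD (by simp) with hH
  have hHc : (H : Euc n → Euc n) = fun z => (changeMap e e' (z, f z)).1 := rfl
  have hxs : x ∈ H.source := hC.mem_toOpenPartialHomeomorph_source hD (by simp)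
  have hHx : H x = (e'.chart p).1 := by
    change (changeMap e e' (x, f x)).1 = _; rw [hx, ← h.chart_eq, changeMap_chart h.2.1]
  have hxt : (e'.chart p).1 ∈ H.target := hHx ▸ H.map_source hxs
  have hsx : H.symm (e'.chart p).1 = x := by rw [← hHx, H.left_inv hxs]
  have hcs : Tendsto H.symm (𝓝 (e'.chart p).1) (𝓝 x) := by
    have := H.continuousAt_symm hxt
    rwa [ContinuousAt, hsx] at this
  -- points near `x` at which the derivative is still invertible
  have hinv : ∀ᶠ z in 𝓝 x, (fderiv ℝ (fun z => (changeMap e e' (z, f z)).1) z).IsInvertible := by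
    have hcont : ContinuousAt (fderiv ℝ (fun z => (changeMap e e' (z, f z)).1)) x :=
      (hC.fderiv_right (m := 0) (by simp)).continuousAt
    refine hcont.eventually (isOpen_setOf_isInvertible.mem_nhds ?_)
    rw [hD.fderiv]; exact ⟨M, rfl⟩
  have hsymm : ∀ᶠ w in 𝓝 (e'.chart p).1, ContDiffAt ℝ ∞ H.symm w := by
    filter_upwards [H.open_target.mem_nhds hxt, hcs.eventually hinv, hcs.eventually hgraph]
      with w h1 h2 h3
    obtain ⟨N, hN⟩ := h2
    refine H.contDiffAt_symm (f₀' := N) h1 ?_ h3.fst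
    rw [hN]
    exact (h3.fst.differentiableAt (by simp)).hasFDerivAt
  refine ⟨fun w => (changeMap e e' (H.symm w, f (H.symm w))).2, h.1, hp, ?_, ?_⟩
  · filter_upwards [hsymm, hcs.eventually hgraph] with w h1 h2
    exact ContDiffAt.comp (f := H.symm) (g := fun z => (changeMap e e' (z, f z)).2) w h2.snd h1
  · have hq : Tendsto (fun q => (e'.chart q).1) (𝓝 p) (𝓝 (e'.chart p).1) :=
      continuous_fst.continuousAt.comp (e'.chart.continuousAt hp)
    have hq0 : Tendsto (fun q => (e.chart q).1) (𝓝 p) (𝓝 x) :=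
      continuous_fst.continuousAt.comp (e.chart.continuousAt h.2.1)
    filter_upwards [h.2.2.2, e.chart.open_source.mem_nhds h.2.1,
      e'.chart.open_source.mem_nhds hp, hq (H.open_target.mem_nhds hxt),
      hq0 (H.open_source.mem_nhds hxs),
      (hcs.comp hq).eventually (h.eventually_target.and
        (h.tendsto_param.eventually (e'.chart.open_source.mem_nhds hp)))]
      with q h1 h2 h3 h4 h5 h6
    have hright : (changeMap e e' (H.symm (e'.chart q).1, f (H.symm (e'.chart q).1))).1 =
        (e'.chart q).1 := H.right_inv h4
    constructor
    · intro hqL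
      have h7 : e.chart q = ((e.chart q).1, f (e.chart q).1) := Prod.ext rfl (h1.1 hqL)
      have h8 : changeMap e e' ((e.chart q).1, f (e.chart q).1) = e'.chart q := by
        rw [← h7, changeMap_chart h2]
      have h9 : H.symm (e'.chart q).1 = (e.chart q).1 := by
        have : H (e.chart q).1 = (e'.chart q).1 := congrArg Prod.fst h8
        rw [← this, H.left_inv h5]
      rw [h9, h8]
    · intro hqe
      have h7 : changeMap e e' (H.symm (e'.chart q).1, f (H.symm (e'.chart q).1)) = e'.chart q :=
        Prod.ext hright hqe.symm
      have h8 : e.chart.symm (H.symm (e'.chart q).1, f (H.symm (e'.chart q).1)) = q :=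
        e'.chart.injOn h6.2 h3 h7
      have h9 := e.chart.right_inv h6.1
      simp only [Function.comp_apply] at h9
      rw [h8] at h9
      rw [h1, h9]

end IsGraphAt
end Jets

section JetManifold

variable {n m : ℕ} {E : Type*} [TopologicalSpace E] [ChartedSpace (Euc (n + m)) E]

/-- The submanifold `u^i = f^i(u^1, …, u^n)` of the domain of a divided chart. -/
def graphSubmanifold (e : DividedChart n m E) (f : Euc n → Euc m) (hf : ContDiff ℝ ∞ f) :
    EmbeddedSubmanifold n m E where
  carrier := {q ∈ e.chart.source | (e.chart q).2 = f (e.chart q).1}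
  isGraphAt p hp := ⟨e, f, hp, hp.1, .of_forall fun _ => hf.contDiffAt, by
    filter_upwards [e.chart.open_source.mem_nhds hp.1] with q hq
    exact ⟨fun h => h.2, fun h => ⟨hq, h⟩⟩⟩

/-- The polynomial map with given `2`-jet at `a.1`. -/
def polyMap (a : Euc n × Euc m) (A : Euc n →L[ℝ] Euc m) (B : Euc n →L[ℝ] Euc n →L[ℝ] Euc m)
    (z : Euc n) : Euc m :=
  a.2 + A (z - a.1) + (1 / 2 : ℝ) • B (z - a.1) (z - a.1)

lemma contDiff_polyMap (a : Euc n × Euc m) (A : Euc n →L[ℝ] Euc m)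
    (B : Euc n →L[ℝ] Euc n →L[ℝ] Euc m) : ContDiff ℝ ∞ (polyMap a A B) := by
  unfold polyMap; fun_prop

lemma fderiv_polyMap (a : Euc n × Euc m) (A : Euc n →L[ℝ] Euc m)
    {B : Euc n →L[ℝ] Euc n →L[ℝ] Euc m} (hB : B ∈ symBilin (Euc n) (Euc m)) (z : Euc n) :
    fderiv ℝ (polyMap a A B) z = A + B (z - a.1) := by
  have h1 : HasFDerivAt (fun z : Euc n => z - a.1) (ContinuousLinearMap.id ℝ (Euc n)) z :=
    (hasFDerivAt_id z).sub_const a.1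
  have h2 := (A.hasFDerivAt (x := z - a.1)).comp z h1
  have h3 := ((B.hasFDerivAt (x := z - a.1)).comp z h1).clm_apply h1
  have h4 := (h2.const_add a.2).add (h3.const_smul (1 / 2 : ℝ))
  have h5 : HasFDerivAt (polyMap a A B) _ z := h4
  rw [h5.fderiv]
  ext v
  have h6 := hB v (z - a.1)
  have h7 : B (z - a.1) v + B v (z - a.1) = (2 : ℝ) • B (z - a.1) v := by rw [h6, two_smul]
  simp only [Function.comp_apply, ContinuousLinearMap.comp_id, add_apply,
    smul_apply, ContinuousLinearMap.flip_apply, h7, smul_smul]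
  norm_num

lemma fderiv_fderiv_polyMap (a : Euc n × Euc m) (A : Euc n →L[ℝ] Euc m)
    {B : Euc n →L[ℝ] Euc n →L[ℝ] Euc m} (hB : B ∈ symBilin (Euc n) (Euc m)) (z : Euc n) :
    fderiv ℝ (fderiv ℝ (polyMap a A B)) z = B := by
  have h0 : fderiv ℝ (polyMap a A B) = fun z => A + B (z - a.1) :=
    funext fun z => fderiv_polyMap a A hB z
  have h1 : HasFDerivAt (fun z : Euc n => z - a.1) (ContinuousLinearMap.id ℝ (Euc n)) z :=
    (hasFDerivAt_id z).sub_const a.1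
  rw [h0]
  exact (((B.hasFDerivAt (x := z - a.1)).comp z h1).const_add A).fderiv

lemma exists_graph_of_mem_target (e : DividedChart n m E) {a : Euc n × Euc m}
    (ha : a ∈ e.chart.target) (A : Euc n →L[ℝ] Euc m) (B : symBilin (Euc n) (Euc m)) :
    ∃ (s : PointedSubmanifold n m E) (f : Euc n → Euc m),
      IsGraphAt e s.L.carrier s.pt f ∧ e.chart s.pt = a ∧ fderiv ℝ f a.1 = A ∧
        fderiv ℝ (fderiv ℝ f) a.1 = B := by
  have hmem : e.chart.symm a ∈ (graphSubmanifold e (polyMap a A B)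
      (contDiff_polyMap a A B)).carrier := by
    refine ⟨e.chart.map_target ha, ?_⟩
    rw [e.chart.right_inv ha]; simp [polyMap]
  refine ⟨⟨graphSubmanifold e (polyMap a A B) (contDiff_polyMap a A B), e.chart.symm a, hmem⟩,
    polyMap a A B, ⟨hmem, hmem.1, .of_forall fun _ => (contDiff_polyMap a A B).contDiffAt, ?_⟩,
    e.chart.right_inv ha, ?_, fderiv_fderiv_polyMap a A B.2 _⟩
  · filter_upwards [e.chart.open_source.mem_nhds hmem.1] with q hq
    exact ⟨fun h => h.2, fun h => ⟨hq, h⟩⟩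
  · rw [fderiv_polyMap a A B.2]; simp

variable (n m E) in
/-- Coordinates on `J^r(E, n)` induced by divided charts, with values in `M`: `coord e s f` is the
coordinate expression in the chart `e` of the jet of the pointed submanifold `s`, which is the
graph of `f` in `e`. -/
structure JetCoordinates (r : ℕ) (M : Type) [NormedAddCommGroup M] [NormedSpace ℝ M] where
  coord : DividedChart n m E → PointedSubmanifold n m E → (Euc n → Euc m) → M
  range : DividedChart n m E → Set M
  coord_mem : ∀ e s f, IsGraphAt e s.L.carrier s.pt f → coord e s f ∈ range e
  exists_coord : ∀ e, ∀ b ∈ range e, ∃ s f, IsGraphAt e s.L.carrier s.pt f ∧ coord e s f = b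
  coord_eq_iff : ∀ e s t f g, IsGraphAt e s.L.carrier s.pt f → IsGraphAt e t.L.carrier t.pt g →
    (coord e s f = coord e t g ↔ s.pt = t.pt ∧ ∀ k ≤ r,
      iteratedFDeriv ℝ k f (e.chart s.pt).1 = iteratedFDeriv ℝ k g (e.chart s.pt).1)
  change : DividedChart n m E → DividedChart n m E → M → M
  domain : DividedChart n m E → DividedChart n m E → Set M
  isOpen_domain : ∀ e e', IsOpen (domain e e')
  domain_subset : ∀ e e', domain e e' ⊆ range e
  contDiffOn_change : ∀ e e', ContDiffOn ℝ ∞ (change e e') (domain e e')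
  coord_mem_domain : ∀ e e' s f f', IsGraphAt e s.L.carrier s.pt f →
    IsGraphAt e' s.L.carrier s.pt f' → coord e s f ∈ domain e e'
  coord_change : ∀ e e' s f f', IsGraphAt e s.L.carrier s.pt f →
    IsGraphAt e' s.L.carrier s.pt f' → coord e' s f' = change e e' (coord e s f)
  exists_graph : ∀ e e' s f, IsGraphAt e s.L.carrier s.pt f → coord e s f ∈ domain e e' →
    ∃ f', IsGraphAt e' s.L.carrier s.pt f'

namespace JetCoordinates

variable {r : ℕ} {M : Type} [NormedAddCommGroup M] [NormedSpace ℝ M] (c : JetCoordinates n m E r M)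

lemma coord_eq_of_contact {s t : PointedSubmanifold n m E} (h : Contact r s t)
    (e : DividedChart n m E) (f : Euc n → Euc m) (hf : IsGraphAt e s.L.carrier s.pt f) :
    ∃ g, IsGraphAt e t.L.carrier t.pt g ∧ c.coord e s f = c.coord e t g := by
  obtain ⟨hp, e₀, f₀, g₀, hf₀, hg₀, h₀⟩ := h
  have h1 : c.coord e₀ s f₀ = c.coord e₀ t g₀ := (c.coord_eq_iff e₀ s t f₀ g₀ hf₀ hg₀).2 ⟨hp, h₀⟩
  have h2 := c.coord_mem_domain e₀ e s f₀ f hf₀ hf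
  obtain ⟨g, hg⟩ := c.exists_graph e₀ e t g₀ hg₀ (h1 ▸ h2)
  exact ⟨g, hg, by rw [c.coord_change e₀ e s f₀ f hf₀ hf, c.coord_change e₀ e t g₀ g hg₀ hg, h1]⟩

lemma contact_symm {s t : PointedSubmanifold n m E} (h : Contact r s t) : Contact r t s := by
  obtain ⟨hp, e₀, f₀, g₀, hf₀, hg₀, h₀⟩ := h
  exact ⟨hp.symm, e₀, g₀, f₀, hg₀, hf₀, fun k hk => by rw [← hp]; exact (h₀ k hk).symm⟩

lemma exists_of_jet_eq {s t : PointedSubmanifold n m E} (h : jet r s = jet r t)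
    (e : DividedChart n m E) {f : Euc n → Euc m} (hf : IsGraphAt e s.L.carrier s.pt f) :
    ∃ g, IsGraphAt e t.L.carrier t.pt g ∧ c.coord e s f = c.coord e t g := by
  have key : ∀ s t : PointedSubmanifold n m E, Relation.EqvGen (Contact r) s t →
      (∀ f, IsGraphAt e s.L.carrier s.pt f →
        ∃ g, IsGraphAt e t.L.carrier t.pt g ∧ c.coord e s f = c.coord e t g) ∧
      (∀ f, IsGraphAt e t.L.carrier t.pt f →
        ∃ g, IsGraphAt e s.L.carrier s.pt g ∧ c.coord e t f = c.coord e s g) := by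
    intro s t h
    induction h with
    | rel s t h => exact ⟨c.coord_eq_of_contact h e, c.coord_eq_of_contact (contact_symm h) e⟩
    | refl s => exact ⟨fun f hf => ⟨f, hf, rfl⟩, fun f hf => ⟨f, hf, rfl⟩⟩
    | symm s t _ ih => exact ⟨ih.2, ih.1⟩
    | trans s t u _ _ ih₁ ih₂ =>
      constructor
      · intro f hf
        obtain ⟨g, hg, h⟩ := ih₁.1 f hf
        obtain ⟨g', hg', h'⟩ := ih₂.1 g hg
        exact ⟨g', hg', h.trans h'⟩
      · intro f hf
        obtain ⟨g, hg, h⟩ := ih₂.2 f hf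
        obtain ⟨g', hg', h'⟩ := ih₁.2 g hg
        exact ⟨g', hg', h.trans h'⟩
  exact (key s t (Quot.eqvGen_exact h)).1 f hf

lemma coord_eq {s t : PointedSubmanifold n m E} (h : jet r s = jet r t)
    (e : DividedChart n m E) {f g : Euc n → Euc m} (hf : IsGraphAt e s.L.carrier s.pt f)
    (hg : IsGraphAt e t.L.carrier t.pt g) : c.coord e s f = c.coord e t g := by
  obtain ⟨g', hg', h'⟩ := c.exists_of_jet_eq h e hf
  rw [h', c.coord_change e e t g' g hg' hg, ← c.coord_change e e t g' g' hg' hg']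

lemma jet_eq {s t : PointedSubmanifold n m E} (e : DividedChart n m E) {f g : Euc n → Euc m}
    (hf : IsGraphAt e s.L.carrier s.pt f) (hg : IsGraphAt e t.L.carrier t.pt g)
    (h : c.coord e s f = c.coord e t g) : jet r s = jet r t := by
  have := (c.coord_eq_iff e s t f g hf hg).1 h
  exact Quot.sound ⟨this.1, e, f, g, hf, hg, this.2⟩

open Classical in
/-- The coordinates of a jet in the chart of `J^r(E, n)` induced by the divided chart `e`. -/
def jetCoord (e : DividedChart n m E) (θ : Jet n m E r) : M :=
  if h : ∃ b s f, jet r s = θ ∧ IsGraphAt e s.L.carrier s.pt f ∧ c.coord e s f = b then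
    h.choose else 0

lemma jetCoord_jet {e : DividedChart n m E} {s : PointedSubmanifold n m E}
    {f : Euc n → Euc m} (hf : IsGraphAt e s.L.carrier s.pt f) :
    c.jetCoord e (jet r s) = c.coord e s f := by
  have h : ∃ b s' f', jet r s' = jet r s ∧ IsGraphAt e s'.L.carrier s'.pt f' ∧
    c.coord e s' f' = b := ⟨_, s, f, rfl, hf, rfl⟩
  rw [jetCoord, dif_pos h]
  obtain ⟨s', f', h1, h2, h3⟩ := h.choose_spec
  rw [← h3]
  exact c.coord_eq h1 e h2 hf

open Classical in
/-- The chart of `J^r(E, n)` induced by a divided chart `x.1` (`x.2` is an arbitrary value used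
outside the target). -/
def chart (x : DividedChart n m E × Jet n m E r) : PartialEquiv (Jet n m E r) M where
  source := {θ | ∃ s f, jet r s = θ ∧ IsGraphAt x.1 s.L.carrier s.pt f}
  target := c.range x.1
  toFun := c.jetCoord x.1
  invFun b := if h : b ∈ c.range x.1 then jet r (c.exists_coord x.1 b h).choose else x.2
  map_source' := by
    rintro _ ⟨s, f, rfl, hf⟩
    rw [c.jetCoord_jet hf]
    exact c.coord_mem _ _ _ hf
  map_target' b hb := by
    rw [dif_pos hb]
    exact ⟨_, _, rfl, (c.exists_coord x.1 b hb).choose_spec.choose_spec.1⟩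
  left_inv' := by
    rintro _ ⟨s, f, rfl, hf⟩
    have hr := c.coord_mem _ _ _ hf
    rw [c.jetCoord_jet hf, dif_pos hr]
    have h2 := (c.exists_coord x.1 _ hr).choose_spec.choose_spec
    exact c.jet_eq x.1 h2.1 hf h2.2
  right_inv' b hb := by
    have h2 := (c.exists_coord x.1 b hb).choose_spec.choose_spec
    rw [dif_pos hb, c.jetCoord_jet h2.1, h2.2]

lemma chart_jet (x : DividedChart n m E × Jet n m E r) {s : PointedSubmanifold n m E}
    {f : Euc n → Euc m} (hf : IsGraphAt x.1 s.L.carrier s.pt f) :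
    c.chart x (jet r s) = c.coord x.1 s f := c.jetCoord_jet hf

lemma mem_chart_source (x : DividedChart n m E × Jet n m E r) {s : PointedSubmanifold n m E}
    {f : Euc n → Euc m} (hf : IsGraphAt x.1 s.L.carrier s.pt f) :
    jet r s ∈ (c.chart x).source := ⟨s, f, rfl, hf⟩

lemma chart_symm (x : DividedChart n m E × Jet n m E r) {s : PointedSubmanifold n m E}
    {f : Euc n → Euc m} (hf : IsGraphAt x.1 s.L.carrier s.pt f) :
    (c.chart x).symm (c.coord x.1 s f) = jet r s := by
  rw [← c.chart_jet x hf, (c.chart x).left_inv (c.mem_chart_source x hf)]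

lemma trans_source (x y : DividedChart n m E × Jet n m E r) :
    ((c.chart x).symm.trans (c.chart y)).source = c.domain x.1 y.1 := by
  ext b
  constructor
  · rintro ⟨hb, s, f', hs, hf'⟩
    obtain ⟨t, f, hf, rfl⟩ := c.exists_coord x.1 b hb
    have h1 : jet r s = jet r t := hs.trans (c.chart_symm x hf)
    have h2 : (c.chart x).symm (c.coord x.1 t f) ∈ (c.chart y).source := ⟨s, f', hs, hf'⟩
    rw [c.chart_symm x hf] at h2
    obtain ⟨g, hg, h3⟩ := c.exists_of_jet_eq h1.symm x.1 hf
    rw [h3]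
    exact c.coord_mem_domain _ _ _ _ _ hg hf'
  · intro hb
    obtain ⟨t, f, hf, rfl⟩ := c.exists_coord x.1 b (c.domain_subset _ _ hb)
    refine ⟨c.coord_mem _ _ _ hf, ?_⟩
    obtain ⟨f', hf'⟩ := c.exists_graph _ _ _ _ hf hb
    change (c.chart x).symm (c.coord x.1 t f) ∈ (c.chart y).source
    rw [c.chart_symm x hf]
    exact c.mem_chart_source y hf'

lemma trans_eq (x y : DividedChart n m E × Jet n m E r) :
    EqOn ((c.chart x).symm.trans (c.chart y)) (c.change x.1 y.1) (c.domain x.1 y.1) := by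
  intro b hb
  obtain ⟨t, f, hf, rfl⟩ := c.exists_coord x.1 b (c.domain_subset _ _ hb)
  obtain ⟨f', hf'⟩ := c.exists_graph _ _ _ _ hf hb
  change c.chart y ((c.chart x).symm _) = _
  rw [c.chart_symm x hf, c.chart_jet y hf', c.coord_change _ _ _ _ _ hf hf']

/-- The smooth atlas of `J^r(E, n)`. -/
def core : ChartedSpaceCore M (Jet n m E r) where
  atlas := Set.range c.chart
  chartAt θ := c.chart ((θ.out.L.isGraphAt θ.out.pt θ.out.mem).choose, θ)
  mem_chart_source θ := by
    refine ⟨θ.out, _, Quot.out_eq θ, (θ.out.L.isGraphAt θ.out.pt θ.out.mem).choose_spec.choose_spec⟩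
  chart_mem_atlas θ := ⟨_, rfl⟩
  open_source := by
    rintro _ _ ⟨x, rfl⟩ ⟨y, rfl⟩
    rw [c.trans_source]; exact c.isOpen_domain _ _
  continuousOn_toFun := by
    rintro _ _ ⟨x, rfl⟩ ⟨y, rfl⟩
    rw [c.trans_source]
    exact (c.contDiffOn_change _ _).continuousOn.congr (c.trans_eq x y)

lemma isManifold :
    letI := c.core.toTopologicalSpace
    letI := c.core.toChartedSpace
    IsManifold 𝓘(ℝ, M) ∞ (Jet n m E r) := by
  let _ := c.core.toTopologicalSpace
  let _ := c.core.toChartedSpace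
  apply isManifold_of_contDiffOn
  intro e e' he he'
  have key : ∀ e : OpenPartialHomeomorph (Jet n m E r) M, e ∈ c.core.toChartedSpace.atlas →
      ∃ x, e.toPartialEquiv = c.chart x := by
    intro e he
    change e ∈ ⋃ (x : PartialEquiv (Jet n m E r) M) (hx : x ∈ c.core.atlas),
      {c.core.openPartialHomeomorph x hx} at he
    simp only [mem_iUnion, mem_singleton_iff] at he
    obtain ⟨_, ⟨x, rfl⟩, rfl⟩ := he
    exact ⟨x, rfl⟩
  obtain ⟨x, hx⟩ := key e he
  obtain ⟨y, hy⟩ := key e' he'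
  have := (c.contDiffOn_change x.1 y.1).congr (c.trans_eq x y)
  rw [← c.trans_source, ← hx, ← hy] at this
  simpa using this

end JetCoordinates
end JetManifold

section FirstSecond

/-- Model space of `J¹(E, n)`: coordinates `(u^λ, u^i, u^i_λ)`. -/
abbrev Model₁ (n m : ℕ) := (Euc n × Euc m) × (Euc n →L[ℝ] Euc m)

/-- Model space of `J²(E, n)`: coordinates `(u^λ, u^i, u^i_λ, u^i_{λξ})`. -/
abbrev Model₂ (n m : ℕ) := Model₁ n m × symBilin (Euc n) (Euc m)

variable (n m : ℕ) (E : Type*) [TopologicalSpace E] [ChartedSpace (Euc (n + m)) E]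

/-- Jet coordinates `(u^λ, u^i, u^i_λ)` of order one. -/
def jetCoordinates₁ : JetCoordinates n m E 1 (Model₁ n m) where
  coord e s f := (e.chart s.pt, fderiv ℝ f (e.chart s.pt).1)
  range e := {b | b.1 ∈ e.chart.target}
  coord_mem e s f h := e.chart.map_source h.2.1
  exists_coord e b hb := by
    obtain ⟨s, f, h1, h2, h3, -⟩ := exists_graph_of_mem_target e hb b.2 0
    exact ⟨s, f, h1, by rw [h2, h3]⟩
  coord_eq_iff e s t f g hf hg := by
    constructor
    · intro h
      obtain ⟨h1, h2⟩ := Prod.ext_iff.1 h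
      simp only at h1 h2
      have hp : s.pt = t.pt := e.chart.injOn hf.2.1 hg.2.1 h1
      refine ⟨hp, fun k hk => ?_⟩
      have h0 : f (e.chart s.pt).1 = g (e.chart s.pt).1 := by
        have := hf.chart_eq
        rw [h1, hg.chart_eq] at this
        rw [h1]; exact (congrArg Prod.snd this).symm
      interval_cases k
      · ext v; simp [h0]
      · ext v; simp only [iteratedFDeriv_one_apply]
        rw [h2, h1]
    · rintro ⟨hp, h⟩
      refine Prod.ext (congrArg e.chart hp) ?_
      ext v
      have := DFunLike.congr_fun (h 1 le_rfl) (fun _ => v)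
      simp only [iteratedFDeriv_one_apply] at this
      simp only; rw [this, hp]
  change e e' := prolong₁ (changeMap e e')
  domain e e' := prolongDomain (changeMap e e') (changeDomain e e')
  isOpen_domain e e' := isOpen_prolongDomain (isOpen_changeDomain e e') (contDiffOn_changeMap e e')
  domain_subset e e' := fun _ h => h.1.1
  contDiffOn_change e e' :=
    contDiffOn_prolong₁ (isOpen_changeDomain e e') (contDiffOn_changeMap e e')
  coord_mem_domain e e' s f f' h h' := ⟨mem_changeDomain h.2.1 h'.2.1, h.isInvertible h'⟩
  coord_change e e' s f f' h h' :=
    Prod.ext (changeMap_chart h.2.1).symm (h.fderiv_change h')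
  exists_graph e e' s f h hd := by
    refine h.exists_graph ?_ hd.2
    have := hd.1.2
    rwa [mem_preimage, e.chart.left_inv h.2.1] at this

/-- Jet coordinates `(u^λ, u^i, u^i_λ, u^i_{λξ})` of order two. -/
def jetCoordinates₂ : JetCoordinates n m E 2 (Model₂ n m) where
  coord e s f := ((e.chart s.pt, fderiv ℝ f (e.chart s.pt).1),
    symmetrize (fderiv ℝ (fderiv ℝ f) (e.chart s.pt).1))
  range e := {b | b.1.1 ∈ e.chart.target}
  coord_mem e s f h := e.chart.map_source h.2.1
  exists_coord e b hb := by
    obtain ⟨s, f, h1, h2, h3, h4⟩ := exists_graph_of_mem_target e hb b.1.2 b.2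
    refine ⟨s, f, h1, ?_⟩
    rw [h2, h3, h4]
    exact Prod.ext rfl (Subtype.ext (coe_symmetrize b.2.2))
  coord_eq_iff e s t f g hf hg := by
    have hsf := coe_symmetrize (symmetric_snd hf.contDiffAt)
    have hsg := coe_symmetrize (symmetric_snd hg.contDiffAt)
    constructor
    · intro h
      obtain ⟨h1, h2⟩ := Prod.ext_iff.1 h
      have h3 := congrArg (Subtype.val) h2
      simp only at h3
      rw [hsf, hsg] at h3
      obtain ⟨hp, hk⟩ := ((jetCoordinates₁ n m E).coord_eq_iff e s t f g hf hg).1 h1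
      refine ⟨hp, fun k hk2 => ?_⟩
      rcases Nat.lt_or_ge k 2 with hlt | hge
      · exact hk k (by omega)
      · obtain rfl : k = 2 := le_antisymm hk2 hge
        ext v
        simp only [iteratedFDeriv_two_apply]
        rw [h3, hp]
    · rintro ⟨hp, h⟩
      refine Prod.ext (((jetCoordinates₁ n m E).coord_eq_iff e s t f g hf hg).2
        ⟨hp, fun k hk => h k (by omega)⟩) (Subtype.ext ?_)
      simp only
      rw [hsf, hsg, ← hp]
      ext u v i
      have := DFunLike.congr_fun (h 2 le_rfl) ![u, v]
      simp only [iteratedFDeriv_two_apply] at this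
      simpa using congrArg (fun w => w.ofLp i) this
  change e e' := prolong₂ (changeMap e e')
  domain e e' := Prod.fst ⁻¹' prolongDomain (changeMap e e') (changeDomain e e')
  isOpen_domain e e' := (isOpen_prolongDomain (isOpen_changeDomain e e')
    (contDiffOn_changeMap e e')).preimage continuous_fst
  domain_subset e e' := fun _ h => h.1.1
  contDiffOn_change e e' :=
    contDiffOn_prolong₂ (isOpen_changeDomain e e') (contDiffOn_changeMap e e')
  coord_mem_domain e e' s f f' h h' := ⟨mem_changeDomain h.2.1 h'.2.1, h.isInvertible h'⟩
  coord_change e e' s f f' h h' := by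
    refine Prod.ext (Prod.ext (changeMap_chart h.2.1).symm (h.fderiv_change h')) ?_
    simp only [prolong₂]
    rw [h.fderiv_fderiv_change h', coe_symmetrize (symmetric_snd h.contDiffAt)]
  exists_graph e e' s f h hd := (jetCoordinates₁ n m E).exists_graph e e' s f h hd

instance : TopologicalSpace (Jet n m E 1) := (jetCoordinates₁ n m E).core.toTopologicalSpace
instance : TopologicalSpace (Jet n m E 2) := (jetCoordinates₂ n m E).core.toTopologicalSpace
instance : ChartedSpace (Model₁ n m) (Jet n m E 1) := (jetCoordinates₁ n m E).core.toChartedSpace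
instance : ChartedSpace (Model₂ n m) (Jet n m E 2) := (jetCoordinates₂ n m E).core.toChartedSpace
instance : IsManifold 𝓘(ℝ, Model₁ n m) ∞ (Jet n m E 1) := (jetCoordinates₁ n m E).isManifold
instance : IsManifold 𝓘(ℝ, Model₂ n m) ∞ (Jet n m E 2) := (jetCoordinates₂ n m E).isManifold

end FirstSecond

section Geometry

variable {n m : ℕ} {E : Type*} [TopologicalSpace E] [ChartedSpace (Euc (n + m)) E]

/-- Given a map `j` which assigns to a pointed submanifold a point of a manifold `M`, this is the
subspace of `T_x M` spanned by the velocities at time `0` of the curves `t ↦ j (L, c t)` through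
`x`, where `c` is a smooth curve in an embedded submanifold `L` such that `(L, c 0)` satisfies
`P`. -/
def velocityPlane {F M : Type*} [NormedAddCommGroup F] [NormedSpace ℝ F] [TopologicalSpace M]
    [ChartedSpace F M] (j : PointedSubmanifold n m E → M) (P : PointedSubmanifold n m E → Prop)
    (x : M) : Submodule ℝ (TangentSpace 𝓘(ℝ, F) x) :=
  Submodule.span ℝ {v | ∃ (L : EmbeddedSubmanifold n m E) (c : ℝ → L.carrier),
    ContMDiffAt 𝓘(ℝ, ℝ) (𝓡 (n + m)) ∞ (fun t => (c t : E)) 0 ∧ P ⟨L, c 0, (c 0).2⟩ ∧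
    tangentMap 𝓘(ℝ, ℝ) 𝓘(ℝ, F) (fun t => j ⟨L, c t, (c t).2⟩) ⟨0, (1 : ℝ)⟩ =
      (⟨x, v⟩ : TangentBundle 𝓘(ℝ, F) M)}

/-- The fibre at `θ = [L]^r_p` (`r ≥ 1`) of the bundle `H^{r,0} = π_{r,1}^* H^{1,0}`: the tangent
space `T_p L`, as a subspace of `T_p E`. -/
def Jet.plane {r : ℕ} (θ : Jet n m E r) : Submodule ℝ (TangentSpace (𝓡 (n + m)) θ.point) :=
  velocityPlane PointedSubmanifold.pt (fun s => jet r s = θ) θ.point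

/-- The `R`-plane `R_{θ₂} = T_{θ₁} L^{(1)} ⊂ T_{θ₁} J¹(E, n)` of `θ₂ = [L]²_p`, where
`θ₁ = [L]¹_p` and `L^{(1)}` is the image of `j₁L`. -/
def Jet.rPlane (θ₂ : Jet n m E 2) :
    Submodule ℝ (TangentSpace 𝓘(ℝ, Model₁ n m) (Jet.proj one_le_two θ₂)) :=
  velocityPlane (jet 1) (fun s => jet 2 s = θ₂) (Jet.proj one_le_two θ₂)

/-- The Cartan plane at `θ₂`: the span in `T_{θ₂} J²(E, n)` of the planes `T_{θ₂} L^{(2)}`. -/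
def Jet.cartanPlane (θ₂ : Jet n m E 2) : Submodule ℝ (TangentSpace 𝓘(ℝ, Model₂ n m) θ₂) :=
  velocityPlane (jet 2) (fun s => jet 2 s = θ₂) θ₂

variable [IsManifold (𝓡 (n + m)) ∞ E]

variable (n m E) in
/-- Linear connections on `TE → E`. -/
abbrev LinearConnection :=
  CovariantDerivative (𝓡 (n + m)) (Euc (n + m)) (TangentSpace (𝓡 (n + m)) : E → Type _)

/-- The covariant derivative `∇[f^*Γ]_v s` at `x` of the pull-back connection `f^*Γ`, for `s` a
section of `f^*TE`. In coordinates `u^A` of `E` around `f x`, with `s = s^A ∂_{u^A}`, it is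
`(v(s^C) + v(f^A) Γ_A^C_B s^B) ∂_{u^C}`: the first summand below is `v(s^C) ∂_{u^C}` and the second
is `∇[Γ]_{Tf(v)}` applied to the vector field on `E` whose components are the constants `s^B(x)`. -/
def pullbackDeriv (Γ : LinearConnection n m E) {F N : Type*} [NormedAddCommGroup F]
    [NormedSpace ℝ F] [TopologicalSpace N] [ChartedSpace F N] (f : N → E)
    (s : ∀ y : N, TangentSpace (𝓡 (n + m)) (f y)) (x : N) (v : TangentSpace 𝓘(ℝ, F) x) :
    TangentSpace (𝓡 (n + m)) (f x) :=
  (trivializationAt (Euc (n + m)) (TangentSpace (𝓡 (n + m)) : E → Type _) (f x)).symm (f x)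
    (mfderiv 𝓘(ℝ, F) 𝓘(ℝ, Euc (n + m)) (fun y =>
      (trivializationAt (Euc (n + m)) (TangentSpace (𝓡 (n + m)) : E → Type _) (f x)
        ⟨f y, s y⟩).2) x v) +
  Γ (FiberBundle.extend (Euc (n + m)) (s x)) (f x) (mfderiv 𝓘(ℝ, F) (𝓡 (n + m)) f x v)

section Order

variable {r : ℕ} {F : Type*} [NormedAddCommGroup F] [NormedSpace ℝ F]
  [TopologicalSpace (Jet n m E r)] [ChartedSpace F (Jet n m E r)]

variable (F) in
/-- `s` is a section of the bundle `H^{r,0} → J^r(E, n)` which is differentiable at `θ` (`F` is the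
model space of `J^r(E, n)`). -/
def IsHorizontalSectionAt (s : ∀ θ : Jet n m E r, TangentSpace (𝓡 (n + m)) θ.point)
    (θ : Jet n m E r) : Prop :=
  (∀ θ', s θ' ∈ θ'.plane) ∧
    MDifferentiableAt 𝓘(ℝ, F) (𝓡 (n + m)).tangent
      (fun θ' => (⟨θ'.point, s θ'⟩ : TangentBundle (𝓡 (n + m)) E)) θ

/-- `ω^r (∇[π_{r,0}^*Γ]_v s)`, where `ω^r : T^{r,0} → V^{r,0} = T^{r,0} / H^{r,0}` is the quotient
projection. -/
def normalDeriv (Γ : LinearConnection n m E) (θ : Jet n m E r) (v : TangentSpace 𝓘(ℝ, F) θ)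
    (s : ∀ θ : Jet n m E r, TangentSpace (𝓡 (n + m)) θ.point) :
    TangentSpace (𝓡 (n + m)) θ.point ⧸ θ.plane :=
  θ.plane.mkQ (pullbackDeriv Γ Jet.point s θ v)

end Order

variable (n m E) in
/-- A (smooth) connection on `π_{1,0} : J¹(E, n) → E`, as a tangent valued form: `lift θ X` is the
horizontal lift of `X` at `θ`. -/
@[ext]
structure JetConnection where
  lift : ∀ θ : Jet n m E 1,
    TangentSpace (𝓡 (n + m)) θ.point →L[ℝ] TangentSpace 𝓘(ℝ, Model₁ n m) θ
  mfderiv_lift : ∀ θ X,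
    mfderiv 𝓘(ℝ, Model₁ n m) (𝓡 (n + m)) (Jet.point : Jet n m E 1 → E) θ (lift θ X) = X
  contMDiff_lift : ∀ X : ∀ p : E, TangentSpace (𝓡 (n + m)) p,
    ContMDiff (𝓡 (n + m)) (𝓡 (n + m)).tangent ∞
      (fun p => (⟨p, X p⟩ : TangentBundle (𝓡 (n + m)) E)) →
    ContMDiff 𝓘(ℝ, Model₁ n m) 𝓘(ℝ, Model₁ n m).tangent ∞
      (fun θ : Jet n m E 1 =>
        (⟨θ, lift θ (X θ.point)⟩ : TangentBundle 𝓘(ℝ, Model₁ n m) (Jet n m E 1)))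

/-- `D` is the connection `Γ̇` on `π_{1,0}` associated with `Γ`. Its horizontal vectors are those
on which the vertical projection
`υ_Γ̇ = (id ⊗ ω¹) ∘ υ_Ω ∘ TD¹ : TJ¹(E, n) → H^{1,0*} ⊗ V^{1,0}`, `Ω = Ξ ⊗ π_{1,0}^*Γ`, vanishes.
Here `υ_Ω ∘ TD¹ ∘ v` is the covariant derivative `∇[Ω]_v D¹` of the inclusion `D¹ : H^{1,0} → T^{1,0}`,
so that on a section `s` of `H^{1,0}` one has
`υ_Γ̇(v)(s) = ω¹(∇[π_{1,0}^*Γ]_v (D¹ s) - D¹(∇[Ξ^*]_v s)) = ω¹(∇[π_{1,0}^*Γ]_v s)`: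
the auxiliary connection `Ξ` on `H^{1,0*}` drops out since `ω¹ ∘ D¹ = 0`. -/
def IsAssociatedConnection (Γ : LinearConnection n m E) (D : JetConnection n m E) : Prop :=
  ∀ (θ : Jet n m E 1) (X : TangentSpace (𝓡 (n + m)) θ.point)
    (s : ∀ θ : Jet n m E 1, TangentSpace (𝓡 (n + m)) θ.point),
    IsHorizontalSectionAt (Model₁ n m) s θ → normalDeriv Γ θ (D.lift θ X) s = 0

/-- `G : J¹(E, n) → J²(E, n)` is a section of `π_{2,1}`. -/
def IsJetSection (G : Jet n m E 1 → Jet n m E 2) : Prop :=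
  ∀ θ, Jet.proj one_le_two (G θ) = θ

/-- `D² ∘ G = D¹ ⌟ D`. At `θ ∈ J¹(E, n)`, `D²(G θ)` is the inclusion of `R_{G θ}` into
`T_θ J¹(E, n)`, and `D¹ ⌟ D` is the restriction of the horizontal lift of `D` to the plane
`D¹ : H^{1,0}_θ → T^{1,0}_θ`. Both are injective and lie over the identity of
`H^{1,0}_θ ≃ R_{G θ}` with respect to `Tπ_{1,0}`, hence are equal if and only if they have the same
image. -/
def IsContraction (D : JetConnection n m E) (G : Jet n m E 1 → Jet n m E 2) : Prop :=
  ∀ θ : Jet n m E 1,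
    (fun w => (⟨Jet.proj one_le_two (G θ), w⟩ : TangentBundle 𝓘(ℝ, Model₁ n m) (Jet n m E 1))) ''
        ((G θ).rPlane : Set (TangentSpace 𝓘(ℝ, Model₁ n m) (Jet.proj one_le_two (G θ)))) =
      (fun X => (⟨θ, D.lift θ X⟩ : TangentBundle 𝓘(ℝ, Model₁ n m) (Jet n m E 1))) ''
        (θ.plane : Set (TangentSpace (𝓡 (n + m)) θ.point))

variable (n m E) in
/-- Maps assigning to `θ ∈ J²(E, n)` a bilinear map `H^{2,0}_θ × H^{2,0}_θ → V^{2,0}_θ`. -/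
abbrev JetBilinearForm := ∀ θ : Jet n m E 2,
  θ.plane →ₗ[ℝ] θ.plane →ₗ[ℝ] (TangentSpace (𝓡 (n + m)) θ.point ⧸ θ.plane)

/-- `II` is the universal second fundamental form associated with `Γ`:
`II(X, Y) = ω²(∇[π_{2,0}^*Γ]_{X̃} Y)`, for every section `Y` of `H^{2,0}` and every Cartan vector
`X̃` on `J²(E, n)` projecting on `X`. -/
def IsUniversalSecondFundamentalForm (Γ : LinearConnection n m E) (II : JetBilinearForm n m E) :
    Prop :=
  ∀ (θ : Jet n m E 2) (X : θ.plane) (X' : TangentSpace 𝓘(ℝ, Model₂ n m) θ)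
    (Y : ∀ θ : Jet n m E 2, TangentSpace (𝓡 (n + m)) θ.point)
    (hY : IsHorizontalSectionAt (Model₂ n m) Y θ),
    X' ∈ θ.cartanPlane →
    mfderiv 𝓘(ℝ, Model₂ n m) (𝓡 (n + m)) (Jet.point : Jet n m E 2 → E) θ X' = X →
    II θ X ⟨Y θ, hY.1 θ⟩ = normalDeriv Γ θ X' Y

/-- The equation `𝒮 ⊂ J²(E, n)` of unparametrized totally geodesic submanifolds: `II = 0`. -/
def totallyGeodesicEquation (II : JetBilinearForm n m E) : Set (Jet n m E 2) := {θ | II θ = 0}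

end Geometry

end

end SubmanifoldJet

open SubmanifoldJet

/-! Everything is read in a divided chart, with V = ℝⁿ and W = ℝᵐ. A 1-jet has coordinates b = (a,
A), where a is the point and A : V → W the slope. Its plane H is the graph of A, and T/H is
identified with W by (x, y) ↦ y - A x. A section of H has components (h, A h). Differentiate it
along v = (w, A') with Christoffel symbols C and project to W: the contribution (dh, A dh) lies on
the graph and dies, leaving A' h + N_b(w) h, where N_b(w) h is the normal part of C(w)(h, A h). No
derivative of the section survives (`normalDeriv_eq`), and this one formula gives all the claims.

Horizontality of v means A' = -N_b(w). Hence the horizontal lift exists, is unique, and is smooth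
because C is (`horizontal_iff`). The R-plane of a 2-jet (b, B) consists of the vectors ((u, A u), B
u), so it is the lift of H exactly when B u = -N_b(u, A u) for all u (`isGeodesicJet_iff`).
Vanishing torsion makes C symmetric, so (u, v) ↦ -N_b(u, A u) v is symmetric and is an admissible B;
exactly one such 2-jet lies over each 1-jet (`existsUnique_isGeodesicJet`).

A Cartan vector over (u, A u) has slope part B u, whatever its second-order part. The same formula
therefore gives II(u, v) = B u v + N_b(u, A u) v (`normalDeriv_jet₂`). This is bilinear, symmetric
when the torsion vanishes, and zero precisely when B is the value found above
(`secondForm_eq_zero_iff`).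

The remaining work is the coordinate dictionary: Christoffel symbols extracted from an abstract
covariant derivative (`exists_christoffel`, `contDiffOn_christoffel`, `christoffel_symm`,
`deriv_pullbackDeriv`), and planes spanned by velocities of curves computed as images of derivatives
(`deriv_mem_of_mem_velocityPlane`, `exists_mem_velocityPlane`). -/

namespace SubmanifoldJet

noncomputable section

open Bundle

/-! ### Charts with values in an arbitrary normed space, and components of tangent vectors. -/

section Charts

/-- A chart of a manifold `M` modelled on `F`, with values in a normed space `F'`. -/
structure SmoothChart (F F' M : Type*) [NormedAddCommGroup F] [NormedSpace ℝ F]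
    [NormedAddCommGroup F'] [NormedSpace ℝ F'] [TopologicalSpace M] [ChartedSpace F M] where
  chart : OpenPartialHomeomorph M F'
  contMDiffOn_chart : ContMDiffOn 𝓘(ℝ, F) 𝓘(ℝ, F') ∞ chart chart.source
  contMDiffOn_symm : ContMDiffOn 𝓘(ℝ, F') 𝓘(ℝ, F) ∞ chart.symm chart.target

namespace SmoothChart

variable {F F' M : Type*} [NormedAddCommGroup F] [NormedSpace ℝ F]
    [NormedAddCommGroup F'] [NormedSpace ℝ F'] [TopologicalSpace M] [ChartedSpace F M]
    (c : SmoothChart F F' M)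

/-- The components of tangent vectors. -/
def deriv (x : M) : TangentSpace 𝓘(ℝ, F) x →L[ℝ] F' := mfderiv 𝓘(ℝ, F) 𝓘(ℝ, F') c.chart x

/-- The tangent vector with given components. -/
def vector (x : M) : F' →L[ℝ] TangentSpace 𝓘(ℝ, F) x :=
  (mfderiv 𝓘(ℝ, F') 𝓘(ℝ, F) c.chart.symm (c.chart x) : F' →L[ℝ] F)

variable {c} {x : M}

lemma contMDiffAt (hx : x ∈ c.chart.source) : ContMDiffAt 𝓘(ℝ, F) 𝓘(ℝ, F') ∞ c.chart x :=
  c.contMDiffOn_chart.contMDiffAt (c.chart.open_source.mem_nhds hx)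

lemma contMDiffAt_symm {y : F'} (hy : y ∈ c.chart.target) :
    ContMDiffAt 𝓘(ℝ, F') 𝓘(ℝ, F) ∞ c.chart.symm y :=
  c.contMDiffOn_symm.contMDiffAt (c.chart.open_target.mem_nhds hy)

lemma mdifferentiableAt (hx : x ∈ c.chart.source) :
    MDifferentiableAt 𝓘(ℝ, F) 𝓘(ℝ, F') c.chart x :=
  (contMDiffAt hx).mdifferentiableAt (by simp)

lemma mdifferentiableAt_symm {y : F'} (hy : y ∈ c.chart.target) :
    MDifferentiableAt 𝓘(ℝ, F') 𝓘(ℝ, F) c.chart.symm y :=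
  (contMDiffAt_symm hy).mdifferentiableAt (by simp)

lemma vector_deriv (hx : x ∈ c.chart.source) (v : TangentSpace 𝓘(ℝ, F) x) :
    c.vector x (c.deriv x v) = v := by
  have h1 := mfderiv_comp (I := 𝓘(ℝ, F)) (I' := 𝓘(ℝ, F')) (I'' := 𝓘(ℝ, F)) x
    (mdifferentiableAt_symm (c.chart.map_source hx)) (mdifferentiableAt hx)
  have h2 : c.chart.symm ∘ c.chart =ᶠ[𝓝 x] id := c.chart.eventually_left_inverse hx
  rw [h2.mfderiv_eq, mfderiv_id] at h1
  exact (DFunLike.congr_fun h1 v).symm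

lemma deriv_vector (hx : x ∈ c.chart.source) (w : F') :
    c.deriv x (c.vector x w) = w := by
  have hy := c.chart.map_source hx
  have h0 := c.chart.left_inv hx
  have h1 := mfderiv_comp (I := 𝓘(ℝ, F')) (I' := 𝓘(ℝ, F)) (I'' := 𝓘(ℝ, F')) (c.chart x)
    (by rw [h0]; exact mdifferentiableAt hx) (mdifferentiableAt_symm hy)
  have h2 : c.chart ∘ c.chart.symm =ᶠ[𝓝 (c.chart x)] id := c.chart.eventually_right_inverse hy
  rw [h2.mfderiv_eq, mfderiv_id, h0] at h1
  exact (DFunLike.congr_fun h1 w).symm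

lemma isInvertible_deriv (hx : x ∈ c.chart.source) : (c.deriv x).IsInvertible :=
  ⟨ContinuousLinearEquiv.equivOfInverse (c.deriv x) (c.vector x) (vector_deriv hx)
    (deriv_vector hx), rfl⟩

lemma deriv_injective (hx : x ∈ c.chart.source) : Function.Injective (c.deriv x) :=
  Function.LeftInverse.injective (vector_deriv hx)

section Transition

variable [IsManifold 𝓘(ℝ, F) ∞ M]

variable (c) in
/-- The change of components of tangent vectors at `x`, from the trivialization at `x₀`. -/
def transition (x₀ x : M) : F →L[ℝ] F' :=
  c.deriv x ∘L (trivializationAt F (TangentSpace 𝓘(ℝ, F) : M → Type _) x₀).symmL ℝ x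

/-- The derivative of a smooth map is smooth when read in tangent coordinates. On the target, a
normed space, those coordinates are the identity, so what remains is the derivative of the chart
composed with the inverse trivialization at `x`. -/
lemma contMDiffAt_transition (hx : x ∈ c.chart.source) :
    ContMDiffAt 𝓘(ℝ, F) 𝓘(ℝ, F →L[ℝ] F') ∞ (c.transition x) x := by
  have h := (contMDiffAt hx).mfderiv_const (m := ∞) (by simp)
  refine h.congr_of_eventuallyEq ?_
  filter_upwards [(chartAt F x).open_source.mem_nhds (mem_chart_source F x)] with y hy
  have h2 : (extChartAt 𝓘(ℝ, F') (c.chart x) : F' → F') = id := by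
    ext z; simp [mfld_simps, chartAt_self_eq]
  have h1 : mfderiv 𝓘(ℝ, F') 𝓘(ℝ, F') (extChartAt 𝓘(ℝ, F') (c.chart x)) (c.chart y) =
      ContinuousLinearMap.id ℝ F' := by
    rw [h2]; exact mfderiv_id
  rw [inTangentCoordinates_eq_mfderiv_comp (by exact hy)
    (by rw [chartAt_self_eq]; trivial), h1, transition,
    TangentBundle.symmL_trivializationAt hy]
  rfl

lemma transition_apply {x₀ : M} (hx : x ∈ (chartAt F x₀).source) (v : TangentSpace 𝓘(ℝ, F) x) :
    c.transition x₀ x (trivializationAt F (TangentSpace 𝓘(ℝ, F) : M → Type _) x₀ ⟨x, v⟩).2 =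
      c.deriv x v := by
  have hb : x ∈ (trivializationAt F (TangentSpace 𝓘(ℝ, F) : M → Type _) x₀).baseSet := by
    simpa using hx
  have h := Trivialization.symmL_continuousLinearMapAt (R := ℝ) _ hb v
  rw [Trivialization.continuousLinearMapAt_apply, Trivialization.coe_linearMapAt_of_mem _ hb] at h
  exact congrArg (c.deriv x) h

lemma isInvertible_transition {x₀ : M} (hx : x ∈ c.chart.source) (hx' : x ∈ (chartAt F x₀).source) :
    (c.transition x₀ x).IsInvertible := by
  have hb : x ∈ (trivializationAt F (TangentSpace 𝓘(ℝ, F) : M → Type _) x₀).baseSet := by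
    simpa using hx'
  exact (isInvertible_deriv hx).comp ⟨_, Trivialization.symm_continuousLinearEquivAt_eq' _ hb⟩

variable {G N : Type*} [NormedAddCommGroup G] [NormedSpace ℝ G] [TopologicalSpace N]
  [ChartedSpace G N] {Z : N → TangentBundle 𝓘(ℝ, F) M} {y : N}

/-- Mathlib's criterion uses components in the preferred trivialization. They differ from the
components in `c` by the transition operator, which is smooth and invertible, and operator inversion
is smooth at invertible operators. This allows every regularity question below to be tested in a
divided chart. -/
lemma mdifferentiableAt_iff [CompleteSpace F] (hy : (Z y).1 ∈ c.chart.source) :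
    MDifferentiableAt 𝓘(ℝ, G) 𝓘(ℝ, F).tangent Z y ↔
      MDifferentiableAt 𝓘(ℝ, G) 𝓘(ℝ, F) (fun z => (Z z).1) y ∧
      MDifferentiableAt 𝓘(ℝ, G) 𝓘(ℝ, F') (fun z => c.deriv (Z z).1 (Z z).2) y := by
  rw [mdifferentiableAt_totalSpace]
  refine and_congr_right fun h1 => ?_
  have hM : MDifferentiableAt 𝓘(ℝ, G) 𝓘(ℝ, F →L[ℝ] F') (fun z => c.transition (Z y).1 (Z z).1) y :=
    ((contMDiffAt_transition hy).mdifferentiableAt (by simp)).comp y h1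
  have hev : ∀ᶠ z in 𝓝 y, (Z z).1 ∈ c.chart.source ∧ (Z z).1 ∈ (chartAt F (Z y).1).source :=
    h1.continuousAt.eventually (inter_mem (c.chart.open_source.mem_nhds hy)
      ((chartAt F (Z y).1).open_source.mem_nhds (mem_chart_source F _)))
  constructor
  · intro h2
    refine (hM.clm_apply h2).congr_of_eventuallyEq ?_
    filter_upwards [hev] with z hz
    exact (transition_apply hz.2 _).symm
  · intro h2
    have hi : MDifferentiableAt 𝓘(ℝ, G) 𝓘(ℝ, F' →L[ℝ] F)
        (fun z => (c.transition (Z y).1 (Z z).1).inverse) y := by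
      have h3 := ((isInvertible_transition hy (mem_chart_source F (Z y).1)).contDiffAt_map_inverse
        (n := 1)).contMDiffAt.mdifferentiableAt (by simp)
      exact h3.comp y hM
    refine (hi.clm_apply h2).congr_of_eventuallyEq ?_
    filter_upwards [hev] with z hz
    rw [← transition_apply hz.2]
    exact ((isInvertible_transition hz.1 hz.2).inverse_apply_eq.2 rfl).symm

lemma contMDiffAt_iff [CompleteSpace F] (hy : (Z y).1 ∈ c.chart.source) :
    ContMDiffAt 𝓘(ℝ, G) 𝓘(ℝ, F).tangent ∞ Z y ↔
      ContMDiffAt 𝓘(ℝ, G) 𝓘(ℝ, F) ∞ (fun z => (Z z).1) y ∧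
      ContMDiffAt 𝓘(ℝ, G) 𝓘(ℝ, F') ∞ (fun z => c.deriv (Z z).1 (Z z).2) y := by
  rw [contMDiffAt_totalSpace]
  refine and_congr_right fun h1 => ?_
  have hM : ContMDiffAt 𝓘(ℝ, G) 𝓘(ℝ, F →L[ℝ] F') ∞ (fun z => c.transition (Z y).1 (Z z).1) y :=
    (contMDiffAt_transition hy).comp y h1
  have hev : ∀ᶠ z in 𝓝 y, (Z z).1 ∈ c.chart.source ∧ (Z z).1 ∈ (chartAt F (Z y).1).source :=
    h1.continuousAt.eventually (inter_mem (c.chart.open_source.mem_nhds hy)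
      ((chartAt F (Z y).1).open_source.mem_nhds (mem_chart_source F _)))
  constructor
  · intro h2
    refine (hM.clm_apply h2).congr_of_eventuallyEq ?_
    filter_upwards [hev] with z hz
    exact (transition_apply hz.2 _).symm
  · intro h2
    have hi : ContMDiffAt 𝓘(ℝ, G) 𝓘(ℝ, F' →L[ℝ] F) ∞
        (fun z => (c.transition (Z y).1 (Z z).1).inverse) y := by
      have h3 := ((isInvertible_transition hy (mem_chart_source F (Z y).1)).contDiffAt_map_inverse
        (n := ∞)).contMDiffAt
      exact h3.comp y hM
    refine (hi.clm_apply h2).congr_of_eventuallyEq ?_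
    filter_upwards [hev] with z hz
    rw [← transition_apply hz.2]
    exact ((isInvertible_transition hz.1 hz.2).inverse_apply_eq.2 rfl).symm

end Transition
end SmoothChart

end Charts

/-! ### Christoffel symbols and the coordinate formula for pull-back connections. -/

section CovariantDerivatives

section Apply

variable {G N G₁ G₂ : Type*} [NormedAddCommGroup G] [NormedSpace ℝ G] [TopologicalSpace N]
  [ChartedSpace G N] [NormedAddCommGroup G₁] [NormedSpace ℝ G₁] [NormedAddCommGroup G₂]
  [NormedSpace ℝ G₂]

lemma mvfderiv_clm_apply {A : N → G₁ →L[ℝ] G₂} {u : N → G₁} {x : N}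
    (hA : MDifferentiableAt 𝓘(ℝ, G) 𝓘(ℝ, G₁ →L[ℝ] G₂) A x)
    (hu : MDifferentiableAt 𝓘(ℝ, G) 𝓘(ℝ, G₁) u x) (v : TangentSpace 𝓘(ℝ, G) x) :
    mvfderiv 𝓘(ℝ, G) (fun y => A y (u y)) x v =
      mvfderiv 𝓘(ℝ, G) A x v (u x) + A x (mvfderiv 𝓘(ℝ, G) u x v) := by
  have h2 := hA.hasMFDerivAt.2.clm_apply hu.hasMFDerivAt.2
  have h3 : HasMFDerivAt 𝓘(ℝ, G) 𝓘(ℝ, G₂) (fun y => A y (u y)) x _ := 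
    ⟨hA.continuousAt.clm_apply hu.continuousAt, h2⟩
  have h4 := DFunLike.congr_fun h3.mfderiv v
  refine (h4.trans ?_).trans (add_comm _ _)
  have h5 : (extChartAt 𝓘(ℝ, G) x).symm (extChartAt 𝓘(ℝ, G) x x) = x := by simp
  -- The product rule was applied to the local expressions of `A` and `u`; at the image of `x` they
  -- take the values `A x` and `u x`.
  have h6 : writtenInExtChartAt 𝓘(ℝ, G) 𝓘(ℝ, G₁ →L[ℝ] G₂) x A (extChartAt 𝓘(ℝ, G) x x) = A x := by
    simp [chartAt_self_eq]
  have h7 : writtenInExtChartAt 𝓘(ℝ, G) 𝓘(ℝ, G₁) x u (extChartAt 𝓘(ℝ, G) x x) = u x := by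
    simp [chartAt_self_eq]
  rw [h6, h7]
  rfl

lemma mvfderiv_congr {u u' : N → G₁} {x : N} (h : u =ᶠ[𝓝 x] u') :
    mvfderiv 𝓘(ℝ, G) u x = mvfderiv 𝓘(ℝ, G) u' x := by
  ext v
  exact DFunLike.congr_fun (h.mfderiv_eq (I := 𝓘(ℝ, G)) (I' := 𝓘(ℝ, G₁))) v

lemma mvfderiv_clm_comp (L : G₁ →L[ℝ] G₂) {u : N → G₁} {x : N}
    (hu : MDifferentiableAt 𝓘(ℝ, G) 𝓘(ℝ, G₁) u x) (v : TangentSpace 𝓘(ℝ, G) x) :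
    mvfderiv 𝓘(ℝ, G) (fun y => L (u y)) x v = L (mvfderiv 𝓘(ℝ, G) u x v) := by
  rw [mvfderiv_clm_apply mdifferentiableAt_const hu, mvfderiv_const]
  simp

end Apply

namespace SmoothChart

variable {F F' M : Type*} [NormedAddCommGroup F] [NormedSpace ℝ F]
    [NormedAddCommGroup F'] [NormedSpace ℝ F'] [TopologicalSpace M] [ChartedSpace F M]
    (c : SmoothChart F F' M)
    [FiniteDimensional ℝ F] [IsManifold 𝓘(ℝ, F) ∞ M] {x : M}

variable {c} in
lemma mdifferentiableAt_section_iff {σ : ∀ x : M, TangentSpace 𝓘(ℝ, F) x}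
    (hx : x ∈ c.chart.source) :
    MDifferentiableAt 𝓘(ℝ, F) 𝓘(ℝ, F).tangent (fun y => (⟨y, σ y⟩ : TangentBundle 𝓘(ℝ, F) M)) x ↔
      MDifferentiableAt 𝓘(ℝ, F) 𝓘(ℝ, F') (fun y => c.deriv y (σ y)) x := by
  have : CompleteSpace F := FiniteDimensional.complete ℝ F
  rw [mdifferentiableAt_iff (c := c) (by exact hx)]
  exact and_iff_right mdifferentiableAt_id

variable {c} in
lemma contMDiffAt_section_iff {σ : ∀ x : M, TangentSpace 𝓘(ℝ, F) x}
    (hx : x ∈ c.chart.source) :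
    ContMDiffAt 𝓘(ℝ, F) 𝓘(ℝ, F).tangent ∞ (fun y => (⟨y, σ y⟩ : TangentBundle 𝓘(ℝ, F) M)) x ↔
      ContMDiffAt 𝓘(ℝ, F) 𝓘(ℝ, F') ∞ (fun y => c.deriv y (σ y)) x := by
  have : CompleteSpace F := FiniteDimensional.complete ℝ F
  rw [contMDiffAt_iff (c := c) (by exact hx)]
  exact and_iff_right contMDiffAt_id

variable {c} in
lemma contMDiffAt_vector (hx : x ∈ c.chart.source) (w : F') :
    ContMDiffAt 𝓘(ℝ, F) 𝓘(ℝ, F).tangent ∞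
      (fun y => (⟨y, c.vector y w⟩ : TangentBundle 𝓘(ℝ, F) M)) x := by
  rw [contMDiffAt_section_iff hx]
  refine (contMDiffAt_const (c := w)).congr_of_eventuallyEq ?_
  filter_upwards [c.chart.open_source.mem_nhds hx] with y hy
  exact deriv_vector hy w

variable (Γ : CovariantDerivative 𝓘(ℝ, F) F (TangentSpace 𝓘(ℝ, F) : M → Type _))

variable {c} in
-- The covariant derivative and the plain derivative of components obey the same Leibniz rule, so
-- their difference is linear over functions. A tensorial operator depends only on the value of the
-- section at `x`, and this dependence is the bilinear map `C`.
lemma exists_christoffel (hx : x ∈ c.chart.source) :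
    ∃ C : F' →L[ℝ] F' →L[ℝ] F', ∀ σ : ∀ x : M, TangentSpace 𝓘(ℝ, F) x,
      MDifferentiableAt 𝓘(ℝ, F) 𝓘(ℝ, F).tangent
        (fun y => (⟨y, σ y⟩ : TangentBundle 𝓘(ℝ, F) M)) x → ∀ v,
      c.deriv x (Γ σ x v) = mvfderiv 𝓘(ℝ, F) (fun y => c.deriv y (σ y)) x v +
        C (c.deriv x v) (c.deriv x (σ x)) := by
  set Φ : (∀ x : M, TangentSpace 𝓘(ℝ, F) x) → (F →L[ℝ] F') :=
    fun σ => c.deriv x ∘L Γ σ x - mvfderiv 𝓘(ℝ, F) (fun y => c.deriv y (σ y)) x with hΦ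
  have hT : TensorialAt 𝓘(ℝ, F) F Φ x := by
    constructor
    · intro f σ hf hσ
      have h1 := (mdifferentiableAt_section_iff hx).1 hσ
      have h2 := mvfderiv_smul (I := 𝓘(ℝ, F)) hf h1
      have h3 : (fun y => c.deriv y ((f • σ) y)) = f • fun y => c.deriv y (σ y) := by
        ext y; simp
      have h4 := Γ.isCovariantDerivativeOn.leibniz hσ hf (mem_univ x)
      have key : ∀ v : TangentSpace 𝓘(ℝ, F) x, Φ (f • σ) v = (f x • Φ σ) v := by
        intro v
        change c.deriv x (Γ (f • σ) x v) - mvfderiv 𝓘(ℝ, F) (fun y => c.deriv y ((f • σ) y)) x v =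
          f x • (c.deriv x (Γ σ x v) - mvfderiv 𝓘(ℝ, F) (fun y => c.deriv y (σ y)) x v)
        rw [h4, h3, h2]
        simp
        module
      exact ContinuousLinearMap.ext key
    · intro σ σ' hσ hσ'
      have h2 := mvfderiv_add (I := 𝓘(ℝ, F)) ((mdifferentiableAt_section_iff hx).1 hσ)
        ((mdifferentiableAt_section_iff hx).1 hσ')
      have h3 : (fun y => c.deriv y ((σ + σ') y)) =
        (fun y => c.deriv y (σ y)) + fun y => c.deriv y (σ' y) := by
        ext y; simp
      have h4 := Γ.isCovariantDerivativeOn.add hσ hσ' (mem_univ x)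
      have key : ∀ v : TangentSpace 𝓘(ℝ, F) x, Φ (σ + σ') v = (Φ σ + Φ σ') v := by
        intro v
        change c.deriv x (Γ (σ + σ') x v) - mvfderiv 𝓘(ℝ, F) (fun y => c.deriv y ((σ + σ') y)) x v =
          (c.deriv x (Γ σ x v) - mvfderiv 𝓘(ℝ, F) (fun y => c.deriv y (σ y)) x v) +
          (c.deriv x (Γ σ' x v) - mvfderiv 𝓘(ℝ, F) (fun y => c.deriv y (σ' y)) x v)
        rw [h4, h3, h2]
        simp
        module
      exact ContinuousLinearMap.ext key
  let T : F →L[ℝ] F →L[ℝ] F' := TensorialAt.mkHom Φ x hT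
  let U : F' →L[ℝ] F := c.vector x
  -- `T` takes the value of the section first and the direction second, whereas `C` takes the
  -- direction first.
  refine ⟨(T.bilinearComp U U).flip, fun σ hσ v => ?_⟩
  have h1 : TensorialAt.mkHom Φ x hT (σ x) = Φ σ := TensorialAt.mkHom_apply hT hσ
  have h2 : (T.bilinearComp U U).flip (c.deriv x v) (c.deriv x (σ x)) =
      TensorialAt.mkHom Φ x hT (c.vector x (c.deriv x (σ x))) (c.vector x (c.deriv x v)) := rfl
  rw [h2, vector_deriv hx, vector_deriv hx, h1]
  exact (add_sub_cancel _ _).symm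

open Classical in
/-- The Christoffel symbols of a linear connection. -/
def christoffel (y : F') : F' →L[ℝ] F' →L[ℝ] F' :=
  if hx : c.chart.symm y ∈ c.chart.source then (exists_christoffel Γ hx).choose else 0

variable {c Γ}

lemma deriv_covariantDerivative (hx : x ∈ c.chart.source)
    {σ : ∀ x : M, TangentSpace 𝓘(ℝ, F) x} (hσ : MDifferentiableAt 𝓘(ℝ, F) 𝓘(ℝ, F).tangent
        (fun y => (⟨y, σ y⟩ : TangentBundle 𝓘(ℝ, F) M)) x) (v : TangentSpace 𝓘(ℝ, F) x) :
    c.deriv x (Γ σ x v) = mvfderiv 𝓘(ℝ, F) (fun y => c.deriv y (σ y)) x v +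
        c.christoffel Γ (c.chart x) (c.deriv x v) (c.deriv x (σ x)) := by
  have h : c.chart.symm (c.chart x) = x := c.chart.left_inv hx
  have hx' : c.chart.symm (c.chart x) ∈ c.chart.source := h.symm ▸ hx
  have key := (exists_christoffel Γ hx').choose_spec
  rw [christoffel, dif_pos hx']
  -- The symbol was chosen at `c.chart.symm (c.chart x)`, equal to `x` only propositionally.
  -- Forgetting how it was chosen lets the base point be rewritten.
  generalize (exists_christoffel Γ hx').choose = C at key ⊢
  rw [h] at key
  exact key σ hσ v

/-- A field with constant components has zero plain derivative, so only the symbol is left.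
Smoothness and symmetry of the symbols are both derived from this expression. -/
lemma christoffel_eq (hx : x ∈ c.chart.source) (v s : F') :
    c.christoffel Γ (c.chart x) v s = c.deriv x (Γ (fun y => c.vector y s) x (c.vector x v)) := by
  rw [deriv_covariantDerivative hx ((contMDiffAt_vector hx s).mdifferentiableAt (by simp)),
    deriv_vector hx, deriv_vector hx]
  have h : (fun y => c.deriv y (c.vector y s)) =ᶠ[𝓝 x] fun _ => s := by
    filter_upwards [c.chart.open_source.mem_nhds hx] with y hy
    exact deriv_vector hy s
  rw [mvfderiv_congr h, mvfderiv_const]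
  simp

/-- Smoothness of `Γ` is a statement about globally smooth sections, while a coordinate field is
smooth only on the chart. It is multiplied by a bump function supported in the chart, which is
smooth on all of a Hausdorff manifold, and locality of `Γ` recovers the symbol near the point. -/
lemma contDiffOn_christoffel [T2Space M] [FiniteDimensional ℝ F']
    [hΓ : CovariantDerivative.ContMDiffCovariantDerivative Γ ∞] :
    ContDiffOn ℝ ∞ (c.christoffel Γ) c.chart.target := by
  rw [contDiffOn_clm_apply]
  intro v
  rw [contDiffOn_clm_apply]
  intro s y hy
  refine ContDiffAt.contDiffWithinAt ?_
  have hx := c.chart.map_target hy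
  set x := c.chart.symm y with hxy
  suffices h : ContMDiffAt 𝓘(ℝ, F) 𝓘(ℝ, F') ∞ (fun z => c.christoffel Γ (c.chart z) v s) x by
    have h1 := ContMDiffAt.comp y h (contMDiffAt_symm hy)
    refine h1.contDiffAt.congr_of_eventuallyEq ?_
    filter_upwards [c.chart.open_target.mem_nhds hy] with z hz
    simp [c.chart.right_inv hz]
  obtain ⟨f, -, hf⟩ := (SmoothBumpFunction.nhds_basis_tsupport (I := 𝓘(ℝ, F)) x).mem_iff.1
    (c.chart.open_source.mem_nhds hx)
  have h1 : ContMDiffOn 𝓘(ℝ, F) 𝓘(ℝ, F).tangent ∞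
      (fun z => (⟨z, f z • c.vector z s⟩ : TangentBundle 𝓘(ℝ, F) M)) univ := by
    have := ContMDiffOn.smul_section_of_tsupport (n := ∞) (f.contMDiff.contMDiffOn)
      c.chart.open_source hf
      (fun z hz => (contMDiffAt_vector (c := c) hz s).contMDiffWithinAt)
    exact this.contMDiffOn
  have h2 := (hΓ.contMDiff.contMDiff (σ := fun z => f z • c.vector z s)
    (by simpa using h1)).contMDiffAt (x := x) univ_mem
  have h3 := h2.clm_bundle_apply (contMDiffAt_vector hx v)
  rw [contMDiffAt_section_iff hx] at h3
  refine h3.congr_of_eventuallyEq ?_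
  filter_upwards [c.chart.open_source.mem_nhds hx, f.eventuallyEq_one.eventually_nhds] with z hz hz'
  rw [christoffel_eq hz]
  have h4 := (contMDiffAt_vector (c := c) hz s).mdifferentiableAt (by simp)
  -- Locality requires agreement on a neighbourhood of `z`, which is why `eventually_nhds` was
  -- applied to the set where `f = 1`.
  have h5 : Γ (fun z => c.vector z s) z = Γ (fun z => f z • c.vector z s) z := by
    refine Γ.isCovariantDerivativeOn.congr_of_eventuallyEq h4 ?_ univ_mem ?_
    · exact (h1.contMDiffAt univ_mem).mdifferentiableAt (by simp)
    · filter_upwards [hz'] with w hw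
      simp [hw]
  rw [h5]

/-- Without torsion, the antisymmetric part of ∇ on two fields is their Lie bracket. Coordinate
fields are pull-backs of constant fields by the chart, and brackets commute with pull-back, so they
commute. -/
lemma christoffel_symm [FiniteDimensional ℝ F'] (hΓ : Γ.torsion = 0) {y : F'}
    (hy : y ∈ c.chart.target) (v s : F') :
    c.christoffel Γ y v s = c.christoffel Γ y s v := by
  have : CompleteSpace F := FiniteDimensional.complete ℝ F
  have : CompleteSpace F' := FiniteDimensional.complete ℝ F'
  have hx := c.chart.map_target hy
  set x := c.chart.symm y with hxy
  have hyx : c.chart x = y := c.chart.right_inv hy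
  rw [← hyx, christoffel_eq hx, christoffel_eq hx, ← sub_eq_zero, ← map_sub]
  have h1 := fun w => (contMDiffAt_vector (c := c) hx w).mdifferentiableAt (by simp)
  rw [(Γ.torsion_eq_zero_iff).1 hΓ (h1 v) (h1 s)]
  have h2 : ∀ w : F', (fun z => c.vector z w) =ᶠ[𝓝 x] VectorField.mpullback 𝓘(ℝ, F) 𝓘(ℝ, F')
      c.chart (fun _ => w) := by
    intro w
    filter_upwards [c.chart.open_source.mem_nhds hx] with z hz
    exact ((isInvertible_deriv hz).inverse_apply_eq.2 (deriv_vector hz w).symm).symm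
  have h3 : ∀ w : F', MDifferentiableAt 𝓘(ℝ, F') 𝓘(ℝ, F').tangent
      (fun z => (⟨z, w⟩ : TangentBundle 𝓘(ℝ, F') F')) (c.chart x) := fun w =>
    (contMDiffAt_vectorSpace_iff_contDiffAt.2 (contDiffAt_const (n := 1) (c := w))).mdifferentiableAt
      (by simp)
  have h5 : minSmoothness ℝ 2 ≤ ∞ := by
    simp only [minSmoothness_of_isRCLikeNormedField]
    exact WithTop.coe_le_coe.2 le_top
  have : IsManifold 𝓘(ℝ, F) (minSmoothness ℝ 2) M := .of_le h5
  rw [(h2 v).mlieBracket_vectorField_eq (h2 s), ← VectorField.mpullback_mlieBracket (n := ∞)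
    (h3 v) (h3 s) (contMDiffAt hx) h5]
  have h4 : VectorField.mlieBracket 𝓘(ℝ, F') (fun _ : F' => v) (fun _ : F' => s) = 0 := by
    ext z : 1
    refine (congrFun (VectorField.mlieBracketWithin_univ (I := 𝓘(ℝ, F'))) z).symm.trans ?_
    refine (congrFun VectorField.mlieBracketWithin_eq_lieBracketWithin z).trans ?_
    simp [VectorField.lieBracket_eq]
    rfl
  have h6 := congrArg (fun V => VectorField.mpullback 𝓘(ℝ, F) 𝓘(ℝ, F') c.chart V x) h4
  refine (congrArg (c.deriv x) h6).trans ?_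
  rw [VectorField.mpullback_zero]
  exact map_zero _

end SmoothChart

section Pullback

variable {n m : ℕ} {E : Type*} [TopologicalSpace E] [ChartedSpace (Euc (n + m)) E]
  [IsManifold (𝓡 (n + m)) ∞ E] {Γ : LinearConnection n m E} {F' : Type*} [NormedAddCommGroup F']
  [NormedSpace ℝ F'] {c : SmoothChart (Euc (n + m)) F' E}
  {G N : Type*} [NormedAddCommGroup G] [NormedSpace ℝ G] [TopologicalSpace N] [ChartedSpace G N]

/-- `pullbackDeriv` is defined through the trivialization at `f x`; let M be the transition from it
to `c`. Differentiating the components of `s` in `c` produces a term in dM that the first summand of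
the definition lacks. The second summand supplies it: the extended field is constant in the
trivialization, so the derivative of its components in `c` is exactly that term. -/
lemma deriv_pullbackDeriv {f : N → E} {s : ∀ y : N, TangentSpace (𝓡 (n + m)) (f y)} {x : N}
    (hx : f x ∈ c.chart.source)
    (hs : MDifferentiableAt 𝓘(ℝ, G) (𝓡 (n + m)).tangent
      (fun y => (⟨f y, s y⟩ : TangentBundle (𝓡 (n + m)) E)) x)
    (v : TangentSpace 𝓘(ℝ, G) x) :
    c.deriv (f x) (pullbackDeriv Γ f s x v) =
      mvfderiv 𝓘(ℝ, G) (fun y => c.deriv (f y) (s y)) x v +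
      c.christoffel Γ (c.chart (f x)) (c.deriv (f x) (mfderiv 𝓘(ℝ, G) (𝓡 (n + m)) f x v))
        (c.deriv (f x) (s x)) := by
  obtain ⟨hf, hs'⟩ := (mdifferentiableAt_totalSpace _ _).1 hs
  change MDifferentiableAt 𝓘(ℝ, G) (𝓡 (n + m)) f x at hf
  set T := trivializationAt (Euc (n + m)) (TangentSpace (𝓡 (n + m)) : E → Type _) (f x) with hT
  have hb : f x ∈ T.baseSet := FiberBundle.mem_baseSet_trivializationAt' (f x)
  set M := c.transition (f x) with hM
  have hMd : MDifferentiableAt (𝓡 (n + m)) 𝓘(ℝ, Euc (n + m) →L[ℝ] F') M (f x) :=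
    (SmoothChart.contMDiffAt_transition hx).mdifferentiableAt (by simp)
  set σ : ∀ q : E, TangentSpace (𝓡 (n + m)) q := FiberBundle.extend (Euc (n + m)) (s x) with hσ
  have hσd := FiberBundle.mdifferentiableAt_extend (𝓡 (n + m)) (Euc (n + m)) (s x)
  have hch := (chartAt (Euc (n + m)) (f x)).open_source.mem_nhds (mem_chart_source _ (f x))
  have h1 : mvfderiv 𝓘(ℝ, G) (fun y => c.deriv (f y) (s y)) x v =
      mvfderiv (𝓡 (n + m)) M (f x) (mfderiv 𝓘(ℝ, G) (𝓡 (n + m)) f x v) ((T ⟨f x, s x⟩).2) +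
        M (f x) (mvfderiv 𝓘(ℝ, G) (fun y => (T ⟨f y, s y⟩).2) x v) := by
    have e : (fun y => c.deriv (f y) (s y)) =ᶠ[𝓝 x] fun y => M (f y) ((T ⟨f y, s y⟩).2) := by
      filter_upwards [hf.continuousAt.eventually hch] with y hy
      exact (SmoothChart.transition_apply hy _).symm
    have hMf : MDifferentiableAt 𝓘(ℝ, G) 𝓘(ℝ, Euc (n + m) →L[ℝ] F') (fun y => M (f y)) x :=
      hMd.comp x hf
    rw [mvfderiv_congr e, mvfderiv_clm_apply hMf hs']
    congr 2
    exact mfderiv_comp_apply x hMd hf v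
  have h2 : ∀ w, mvfderiv (𝓡 (n + m)) (fun q => c.deriv q (σ q)) (f x) w =
      mvfderiv (𝓡 (n + m)) M (f x) w ((T ⟨f x, s x⟩).2) := by
    intro w
    have e : (fun q => c.deriv q (σ q)) =ᶠ[𝓝 (f x)] fun q => M q ((T ⟨f x, s x⟩).2) := by
      filter_upwards [hch] with q hq
      rw [← SmoothChart.transition_apply hq]
      congr 1
      have hq' : q ∈ T.baseSet := by simpa [hT] using hq
      exact (congrArg Prod.snd (T.apply_mk_symm hq' (T ⟨f x, s x⟩).2) :)
    rw [mvfderiv_congr e, mvfderiv_clm_apply hMd mdifferentiableAt_const, mvfderiv_const]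
    simp
  have h3 : ∀ u : Euc (n + m), c.deriv (f x) (T.symm (f x) u) = M (f x) u := by
    intro u
    rw [hM, SmoothChart.transition]
    exact congrArg (c.deriv (f x)) (T.symmL_apply (R := ℝ) hb u).symm
  have h4 : σ (f x) = s x := FiberBundle.extend_apply_self _ _
  rw [pullbackDeriv, map_add, SmoothChart.deriv_covariantDerivative hx hσd, h2, h1]
  refine (congrArg (· + _) (h3 (mvfderiv 𝓘(ℝ, G) (fun y => (T ⟨f y, s y⟩).2) x v))).trans ?_
  change _ + (_ + c.christoffel Γ _ _ (c.deriv (f x) (σ (f x)))) = _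
  rw [h4]
  abel

end Pullback

end CovariantDerivatives

/-! ### Velocity planes in coordinates, and the plane of a jet as the graph of its slope. -/

section Velocities

variable {n m : ℕ} {E : Type*} [TopologicalSpace E] [ChartedSpace (Euc (n + m)) E]

/-- A divided chart as a smooth chart. -/
def DividedChart.smoothChart (e : DividedChart n m E) :
    SmoothChart (Euc (n + m)) (Euc n × Euc m) E where
  chart := e.chart
  contMDiffOn_chart := e.contMDiffOn_chart
  contMDiffOn_symm := e.contMDiffOn_symm

section Velocity

variable {F F' M : Type*} [NormedAddCommGroup F] [NormedSpace ℝ F] [NormedAddCommGroup F']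
  [NormedSpace ℝ F'] [TopologicalSpace M] [ChartedSpace F M]

/-- On the submanifold `s.L`, which is the graph of `f` in the chart `e`, the map
`q ↦ j (s.L, q)` is given by `κ` in the charts `e` and `φ`. -/
structure IsLocalExpr (e : DividedChart n m E) (φ : SmoothChart F F' M)
    (j : PointedSubmanifold n m E → M) (s : PointedSubmanifold n m E) (f : Euc n → Euc m)
    (κ : Euc n → F') : Prop where
  isGraphAt : IsGraphAt e s.L.carrier s.pt f
  differentiableAt : DifferentiableAt ℝ κ (e.chart s.pt).1
  eventually : ∀ᶠ q in 𝓝 s.pt, ∀ hq : q ∈ s.L.carrier,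
    j ⟨s.L, q, hq⟩ ∈ φ.chart.source ∧ φ.chart (j ⟨s.L, q, hq⟩) = κ (e.chart q).1

namespace IsLocalExpr

variable {e : DividedChart n m E} {φ : SmoothChart F F' M} {j : PointedSubmanifold n m E → M}
  {s : PointedSubmanifold n m E} {f : Euc n → Euc m} {κ : Euc n → F'}

/-- By the chain rule, the lifted curve sees the curve in the submanifold only through the velocity
of its independent coordinates. -/
lemma deriv_velocity (h : IsLocalExpr e φ j s f κ) {c : ℝ → s.L.carrier}
    (hc : ContMDiffAt 𝓘(ℝ, ℝ) (𝓡 (n + m)) ∞ (fun t => (c t : E)) 0) (h0 : (c 0 : E) = s.pt) :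
    φ.deriv (j ⟨s.L, c 0, (c 0).2⟩)
      (mfderiv 𝓘(ℝ, ℝ) 𝓘(ℝ, F) (fun t => j ⟨s.L, c t, (c t).2⟩) 0 (1 : ℝ)) =
    fderiv ℝ κ (e.chart s.pt).1 (fderiv ℝ (fun t => (e.chart (c t)).1) 0 1) := by
  set γ : ℝ → M := fun t => j ⟨s.L, c t, (c t).2⟩ with hγ
  set g : ℝ → F' := fun t => κ (e.chart (c t)).1 with hg
  have hct : Tendsto (fun t => (c t : E)) (𝓝 0) (𝓝 s.pt) := h0 ▸ hc.continuousAt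
  have hev : ∀ᶠ t in 𝓝 (0 : ℝ), γ t ∈ φ.chart.source ∧ φ.chart (γ t) = g t :=
    (hct.eventually h.eventually).mono fun t ht => ht (c t).2
  have hx : DifferentiableAt ℝ (fun t => (e.chart (c t)).1) 0 := by
    have h1 : ContMDiffAt (𝓡 (n + m)) 𝓘(ℝ, Euc n × Euc m) ∞ e.chart (c 0) :=
      SmoothChart.contMDiffAt (c := e.smoothChart) (by rw [h0]; exact h.isGraphAt.2.1)
    have h2 : ContMDiffAt 𝓘(ℝ, ℝ) 𝓘(ℝ, Euc n × Euc m) ∞ (fun t => e.chart (c t)) 0 :=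
      ContMDiffAt.comp (0 : ℝ) h1 hc
    exact (h2.contDiffAt.differentiableAt (by simp)).fst
  have hκ : DifferentiableAt ℝ κ (e.chart (c 0)).1 := h0.symm ▸ h.differentiableAt
  have hgd : DifferentiableAt ℝ g 0 := DifferentiableAt.comp (0 : ℝ) hκ hx
  have h0s := hev.self_of_nhds
  -- No regularity of `j` is assumed: near time 0 the lifted curve is `φ.chart.symm ∘ g`, which is
  -- differentiable.
  have hγd : MDifferentiableAt 𝓘(ℝ, ℝ) 𝓘(ℝ, F) γ 0 := by
    have h1 : MDifferentiableAt 𝓘(ℝ, F') 𝓘(ℝ, F) φ.chart.symm (g 0) :=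
      SmoothChart.mdifferentiableAt_symm (h0s.2 ▸ φ.chart.map_source h0s.1)
    refine (h1.comp (0 : ℝ) hgd.mdifferentiableAt).congr_of_eventuallyEq ?_
    filter_upwards [hev] with t ht
    exact ((congrArg φ.chart.symm ht.2).symm.trans (φ.chart.left_inv ht.1)).symm
  have h1 := mfderiv_comp_apply (I := 𝓘(ℝ, ℝ)) (I' := 𝓘(ℝ, F)) (I'' := 𝓘(ℝ, F')) (0 : ℝ)
    (SmoothChart.mdifferentiableAt h0s.1) hγd (1 : ℝ)
  have h2 : φ.chart ∘ γ =ᶠ[𝓝 (0 : ℝ)] g := hev.mono fun t ht => ht.2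
  have h3 : fderiv ℝ g 0 (1 : ℝ) = _ := DFunLike.congr_fun (fderiv_comp (0 : ℝ) hκ hx) 1
  rw [h2.mfderiv_eq, mfderiv_eq_fderiv] at h1
  refine h1.symm.trans (h3.trans ?_)
  simp [h0]

/-- The curve in the graph of `f` whose first coordinate is affine. -/
lemma exists_curve (h : IsGraphAt e s.L.carrier s.pt f) (v : Euc n) :
    ∃ c : ℝ → s.L.carrier, ContMDiffAt 𝓘(ℝ, ℝ) (𝓡 (n + m)) ∞ (fun t => (c t : E)) 0 ∧
      (c 0 : E) = s.pt ∧ fderiv ℝ (fun t => (e.chart (c t)).1) 0 1 = v := by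
  classical
  set x := (e.chart s.pt).1 with hx
  set l : ℝ → Euc n := fun t => x + t • v with hl
  have hl0 : l 0 = x := by simp [hl]
  have hlc : ContDiff ℝ ∞ l := by fun_prop
  have hlt : Tendsto l (𝓝 0) (𝓝 x) := hl0 ▸ hlc.continuous.continuousAt
  set a : ℝ → E := fun t => e.chart.symm (l t, f (l t)) with ha
  have hp := hlt.eventually h.eventually_param
  -- The curve must stay in the submanifold for all times, but only its germ at 0 matters; where the
  -- graph point leaves the submanifold the value `s.pt` is a filler.
  set c : ℝ → s.L.carrier := fun t => if ht : a t ∈ s.L.carrier then ⟨a t, ht⟩ else ⟨s.pt, s.mem⟩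
    with hc
  have hca : ∀ᶠ t in 𝓝 (0 : ℝ), (c t : E) = a t := by
    filter_upwards [hp] with t ht
    have ht2 : a t ∈ s.L.carrier := ht.2
    simp [hc, ht2]
  have ha0 : a 0 = s.pt := by
    simp only [ha, hl0]
    rw [hx, ← h.chart_eq, e.chart.left_inv h.2.1]
  refine ⟨c, ?_, hca.self_of_nhds.trans ha0, ?_⟩
  · refine ContMDiffAt.congr_of_eventuallyEq ?_ hca
    have h1 : ContDiffAt ℝ ∞ (fun t => (l t, f (l t))) 0 :=
      hlc.contDiffAt.prodMk ((hl0 ▸ h.contDiffAt : ContDiffAt ℝ ∞ f (l 0)).comp 0 hlc.contDiffAt)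
    exact ContMDiffAt.comp (0 : ℝ)
      (SmoothChart.contMDiffAt_symm (c := e.smoothChart) hp.self_of_nhds.1) h1.contMDiffAt
  · have h1 : (fun t => (e.chart (c t)).1) =ᶠ[𝓝 0] l := by
      filter_upwards [hp, hca] with t ht ht'
      rw [ht', ha]
      simp only [e.chart.right_inv ht.1]
    rw [h1.fderiv_eq]
    have h2 : HasDerivAt l v 0 := by
      change HasDerivAt (fun t => x + t • v) v 0
      simpa using ((hasDerivAt_id (0 : ℝ)).smul_const v).const_add x
    exact h2.hasFDerivAt.fderiv ▸ by simp

end IsLocalExpr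

variable {e : DividedChart n m E} {φ : SmoothChart F F' M} {j : PointedSubmanifold n m E → M}
  {P : PointedSubmanifold n m E → Prop} {x : M}

/-- Upper bound for a velocity plane. The plane is a span, so one generating curve at a time
suffices, and `deriv_velocity` places its components in the image of the derivative of κ. Different
representatives may have different κ; only the common subspace `S` matters. -/
lemma deriv_mem_of_mem_velocityPlane (S : Submodule ℝ F')
    (h : ∀ s, P s → j s = x → ∃ f κ, IsLocalExpr e φ j s f κ ∧
      ∀ u, fderiv ℝ κ (e.chart s.pt).1 u ∈ S)
    {v : TangentSpace 𝓘(ℝ, F) x} (hv : v ∈ velocityPlane j P x) : φ.deriv x v ∈ S := by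
  suffices hle : velocityPlane j P x ≤ S.comap (φ.deriv x : TangentSpace 𝓘(ℝ, F) x →ₗ[ℝ] F') from
    hle hv
  refine Submodule.span_le.2 ?_
  rintro v ⟨L, c, hc, hP, hv⟩
  have hx : j ⟨L, c 0, (c 0).2⟩ = x := congrArg TotalSpace.proj hv
  obtain ⟨f, κ, hs, hS⟩ := h _ hP hx
  have h1 := hs.deriv_velocity hc rfl
  have h2 := congrArg (fun Z : TangentBundle 𝓘(ℝ, F) M => φ.deriv Z.1 Z.2) hv
  change φ.deriv x v ∈ S
  rw [← show _ = φ.deriv x v from h2]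
  exact h1.symm ▸ hS _

/-- Lower bound matching `deriv_mem_of_mem_velocityPlane`: a single representative, with the curve
whose independent coordinates move at velocity `u`, already realizes the vector. -/
lemma exists_mem_velocityPlane {s : PointedSubmanifold n m E} {f : Euc n → Euc m} {κ : Euc n → F'}
    (hs : IsLocalExpr e φ j s f κ) (hP : P s) (u : Euc n) :
    ∃ v ∈ velocityPlane j P (j s), φ.deriv (j s) v = fderiv ℝ κ (e.chart s.pt).1 u := by
  obtain ⟨c, hc, h0, hu⟩ := IsLocalExpr.exists_curve hs.isGraphAt u
  have h1 := hs.deriv_velocity hc h0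
  rw [hu] at h1
  have h2 : (⟨s.L, c 0, (c 0).2⟩ : PointedSubmanifold n m E) = s := by
    have key : ∀ q (hq : q ∈ s.L.carrier), q = s.pt →
        (⟨s.L, q, hq⟩ : PointedSubmanifold n m E) = s := by
      rintro _ _ rfl
      rfl
    exact key _ _ h0
  -- The velocity lives over `j` of the curve at time 0. Equality in the total space moves it to the
  -- fibre over `j s` without a cast.
  have h3 : ∃ v : TangentSpace 𝓘(ℝ, F) (j s),
      tangentMap 𝓘(ℝ, ℝ) 𝓘(ℝ, F) (fun t => j ⟨s.L, c t, (c t).2⟩) ⟨0, (1 : ℝ)⟩ =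
        (⟨j s, v⟩ : TangentBundle 𝓘(ℝ, F) M) := by
    rw [← congrArg j h2]
    exact ⟨_, rfl⟩
  obtain ⟨v, hv⟩ := h3
  refine ⟨v, Submodule.subset_span ⟨s.L, c, hc, h2.symm ▸ hP, hv⟩, ?_⟩
  have h4 := congrArg (fun Z : TangentBundle 𝓘(ℝ, F) M => φ.deriv Z.1 Z.2) hv
  exact (show _ = φ.deriv (j s) v from h4) ▸ h1

end Velocity

section SlopeChart

/-- A chart of `J^r(E, n)` over the divided chart `e`, with the linear maps extracting from the
coordinates of a jet its point and its slope. -/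
structure SlopeChart (r : ℕ) (F : Type*) [NormedAddCommGroup F] [NormedSpace ℝ F]
    [TopologicalSpace (Jet n m E r)] [ChartedSpace F (Jet n m E r)] (e : DividedChart n m E) extends
    SmoothChart F F (Jet n m E r) where
  base : F →L[ℝ] Euc n × Euc m
  slope : F →L[ℝ] Euc n →L[ℝ] Euc m
  exists_graph : ∀ s, jet r s ∈ chart.source → ∃ f, IsGraphAt e s.L.carrier s.pt f
  mem_source : ∀ {s f}, IsGraphAt e s.L.carrier s.pt f → jet r s ∈ chart.source
  base_jet : ∀ {s f}, IsGraphAt e s.L.carrier s.pt f → base (chart (jet r s)) = e.chart s.pt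
  slope_jet : ∀ {s f}, IsGraphAt e s.L.carrier s.pt f →
    slope (chart (jet r s)) = fderiv ℝ f (e.chart s.pt).1

namespace SlopeChart

variable {r : ℕ} {F : Type*} [NormedAddCommGroup F] [NormedSpace ℝ F]
  [TopologicalSpace (Jet n m E r)] [ChartedSpace F (Jet n m E r)] {e : DividedChart n m E}
  {Φ : SlopeChart r F e} {θ : Jet n m E r}

lemma exists_rep (hθ : θ ∈ Φ.chart.source) :
    ∃ s f, jet r s = θ ∧ IsGraphAt e s.L.carrier s.pt f := by
  obtain ⟨s, rfl⟩ := Quot.exists_rep θ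
  obtain ⟨f, hf⟩ := Φ.exists_graph s hθ
  exact ⟨s, f, rfl, hf⟩

lemma point_mem_source (hθ : θ ∈ Φ.chart.source) : θ.point ∈ e.smoothChart.chart.source := by
  obtain ⟨s, f, rfl, hf⟩ := Φ.exists_rep hθ
  exact hf.2.1

lemma chart_point (hθ : θ ∈ Φ.chart.source) : e.chart θ.point = Φ.base (Φ.chart θ) := by
  obtain ⟨s, f, rfl, hf⟩ := Φ.exists_rep hθ
  exact (Φ.base_jet hf).symm

lemma contMDiffAt_point (hθ : θ ∈ Φ.chart.source) :
    ContMDiffAt 𝓘(ℝ, F) (𝓡 (n + m)) ∞ (Jet.point : Jet n m E r → E) θ := by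
  have h1 : ContMDiffAt 𝓘(ℝ, F) 𝓘(ℝ, Euc n × Euc m) ∞ (fun θ' => Φ.base (Φ.chart θ')) θ :=
    ContMDiffAt.comp θ Φ.base.contDiff.contMDiff.contMDiffAt
      (SmoothChart.contMDiffAt (c := Φ.toSmoothChart) hθ)
  have h2 : Φ.base (Φ.chart θ) ∈ e.smoothChart.chart.target := by
    rw [← chart_point hθ]
    exact e.chart.map_source (point_mem_source hθ)
  have h3 := ContMDiffAt.comp θ (SmoothChart.contMDiffAt_symm h2) h1
  refine h3.congr_of_eventuallyEq ?_
  filter_upwards [Φ.chart.open_source.mem_nhds hθ] with θ' hθ'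
  change _ = e.chart.symm (Φ.base (Φ.chart θ'))
  rw [← chart_point hθ', e.chart.left_inv (point_mem_source hθ')]

lemma mvfderiv_clm_chart {G : Type*} [NormedAddCommGroup G] [NormedSpace ℝ G] (L : F →L[ℝ] G)
    (hθ : θ ∈ Φ.chart.source) (v : TangentSpace 𝓘(ℝ, F) θ) :
    mvfderiv 𝓘(ℝ, F) (fun θ' => L (Φ.chart θ')) θ v = L (Φ.deriv θ v) :=
  mvfderiv_clm_comp L (SmoothChart.mdifferentiableAt (c := Φ.toSmoothChart) hθ) v

lemma deriv_mfderiv_point (hθ : θ ∈ Φ.chart.source) (v : TangentSpace 𝓘(ℝ, F) θ) :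
    e.smoothChart.deriv θ.point (mfderiv 𝓘(ℝ, F) (𝓡 (n + m)) (Jet.point : Jet n m E r → E) θ v) =
      Φ.base (Φ.deriv θ v) := by
  have h1 := mfderiv_comp_apply (I := 𝓘(ℝ, F)) (I' := 𝓡 (n + m)) (I'' := 𝓘(ℝ, Euc n × Euc m)) θ
    (SmoothChart.mdifferentiableAt (point_mem_source hθ))
    ((contMDiffAt_point hθ).mdifferentiableAt (by simp)) v
  have h2 : e.smoothChart.chart ∘ (Jet.point : Jet n m E r → E) =ᶠ[𝓝 θ]
      fun θ' => Φ.base (Φ.chart θ') := by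
    filter_upwards [Φ.chart.open_source.mem_nhds hθ] with θ' hθ'
    exact chart_point hθ'
  rw [h2.mfderiv_eq] at h1
  exact h1.symm.trans (mvfderiv_clm_chart Φ.base hθ v)

lemma isLocalExpr_pt {s : PointedSubmanifold n m E} {f : Euc n → Euc m}
    (hf : IsGraphAt e s.L.carrier s.pt f) :
    IsLocalExpr e e.smoothChart PointedSubmanifold.pt s f (fun z => (z, f z)) where
  isGraphAt := hf
  differentiableAt := differentiableAt_id.prodMk (hf.contDiffAt.differentiableAt (by simp))
  eventually := by
    filter_upwards [hf.nearby] with q hq hq'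
    exact ⟨(hq hq').2.1, (hq hq').chart_eq⟩

lemma fderiv_graph {f : Euc n → Euc m} {x : Euc n} (hf : DifferentiableAt ℝ f x) (u : Euc n) :
    fderiv ℝ (fun z => (z, f z)) x u = (u, fderiv ℝ f x u) := by
  have h : HasFDerivAt (fun z => (z, f z)) _ x := (hasFDerivAt_id x).prodMk hf.hasFDerivAt
  rw [h.fderiv]
  rfl

/-- All representatives of the jet have the same slope, so every velocity lies on its graph.
Conversely, some velocity has the same independent components as `ξ`; both lie on the graph, so they
coincide. -/
lemma mem_plane_iff (hθ : θ ∈ Φ.chart.source) {ξ : TangentSpace (𝓡 (n + m)) θ.point} :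
    ξ ∈ θ.plane ↔ (e.smoothChart.deriv θ.point ξ).2 =
      Φ.slope (Φ.chart θ) (e.smoothChart.deriv θ.point ξ).1 := by
  constructor
  · intro h
    refine deriv_mem_of_mem_velocityPlane (e := e)
      (LinearMap.eqLocus (LinearMap.snd ℝ (Euc n) (Euc m))
        ((Φ.slope (Φ.chart θ) : Euc n →ₗ[ℝ] Euc m) ∘ₗ LinearMap.fst ℝ (Euc n) (Euc m))) ?_ h
    rintro s rfl -
    obtain ⟨f, hf⟩ := Φ.exists_graph s hθ
    refine ⟨f, _, isLocalExpr_pt hf, fun u => ?_⟩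
    rw [fderiv_graph (hf.contDiffAt.differentiableAt (by simp)), Φ.slope_jet hf]
    rfl
  · intro h
    obtain ⟨s, f, rfl, hf⟩ := Φ.exists_rep hθ
    obtain ⟨v, hv, hv'⟩ := exists_mem_velocityPlane (P := fun s' => jet r s' = jet r s)
      (isLocalExpr_pt hf) rfl (e.smoothChart.deriv s.pt ξ).1
    rw [fderiv_graph (hf.contDiffAt.differentiableAt (by simp)), ← Φ.slope_jet hf] at hv'
    have h2 : v = ξ := SmoothChart.deriv_injective (c := e.smoothChart) (x := s.pt) hf.2.1
      (hv'.trans (Prod.ext rfl h.symm))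
    exact h2 ▸ hv

end SlopeChart
end SlopeChart

end Velocities

/-! ### The normal component of the covariant derivative, uniformly for jets of order one and two.
-/

section NormalComponents

section Algebra

variable {V W : Type*} [NormedAddCommGroup V] [NormedSpace ℝ V] [NormedAddCommGroup W]
  [NormedSpace ℝ W]

/-- The component transversal to the graph of `A`. -/
def normalPart (A : V →L[ℝ] W) : V × W →L[ℝ] W :=
  ContinuousLinearMap.snd ℝ V W - A ∘L ContinuousLinearMap.fst ℝ V W

@[simp]
lemma normalPart_apply (A : V →L[ℝ] W) (ξ : V × W) : normalPart A ξ = ξ.2 - A ξ.1 := rfl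

/-- The parametrization of the graph of `A`. -/
def graphMap (A : V →L[ℝ] W) : V →L[ℝ] V × W :=
  ContinuousLinearMap.inl ℝ V W + ContinuousLinearMap.inr ℝ V W ∘L A

@[simp]
lemma graphMap_apply (A : V →L[ℝ] W) (h : V) : graphMap A h = (h, A h) := by
  simp [graphMap]

/-- The transversal component of the Christoffel symbols along the graph of `A`. -/
def normalChristoffel (C : V × W →L[ℝ] V × W →L[ℝ] V × W) (A : V →L[ℝ] W) :
    V × W →L[ℝ] V →L[ℝ] W :=
  ContinuousLinearMap.compL ℝ V (V × W) W (normalPart A) ∘L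
    (ContinuousLinearMap.compL ℝ V (V × W) (V × W)).flip (graphMap A) ∘L C

@[simp]
lemma normalChristoffel_apply (C : V × W →L[ℝ] V × W →L[ℝ] V × W) (A : V →L[ℝ] W)
    (w : V × W) (h : V) :
    normalChristoffel C A w h = (C w (h, A h)).2 - A (C w (h, A h)).1 := by
  simp [normalChristoffel]

lemma contDiff_normalPart : ContDiff ℝ ∞ (normalPart : (V →L[ℝ] W) → _) := by
  unfold normalPart
  fun_prop

lemma contDiff_graphMap : ContDiff ℝ ∞ (graphMap : (V →L[ℝ] W) → _) := by
  unfold graphMap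
  fun_prop

lemma contDiff_normalChristoffel :
    ContDiff ℝ ∞ (fun p : (V × W →L[ℝ] V × W →L[ℝ] V × W) × (V →L[ℝ] W) =>
      normalChristoffel p.1 p.2) := by
  unfold normalChristoffel
  have h1 : ContDiff ℝ ∞ (fun p : (V × W →L[ℝ] V × W →L[ℝ] V × W) × (V →L[ℝ] W) =>
      normalPart p.2) := contDiff_normalPart.comp contDiff_snd
  have h2 : ContDiff ℝ ∞ (fun p : (V × W →L[ℝ] V × W →L[ℝ] V × W) × (V →L[ℝ] W) =>
      graphMap p.2) := contDiff_graphMap.comp contDiff_snd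
  exact ((ContinuousLinearMap.contDiff _).comp h1).clm_comp
    (((ContinuousLinearMap.contDiff _).comp h2).clm_comp contDiff_fst)

end Algebra

variable {n m : ℕ} {E : Type*} [TopologicalSpace E] [ChartedSpace (Euc (n + m)) E]

/-- The class modulo `H^{r,0}_θ` of the tangent vector with components `(0, w)`. -/
def DividedChart.toNormal {r : ℕ} (e : DividedChart n m E) (θ : Jet n m E r) :
    Euc m →ₗ[ℝ] TangentSpace (𝓡 (n + m)) θ.point ⧸ θ.plane :=
  θ.plane.mkQ ∘ₗ (e.smoothChart.vector θ.point : Euc n × Euc m →ₗ[ℝ] _) ∘ₗ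
    LinearMap.inr ℝ (Euc n) (Euc m)

namespace SlopeChart

variable {r : ℕ} {F : Type*} [NormedAddCommGroup F] [NormedSpace ℝ F]
  [TopologicalSpace (Jet n m E r)] [ChartedSpace F (Jet n m E r)] {e : DividedChart n m E}
  {Φ : SlopeChart r F e} {θ : Jet n m E r}

/-- A vector (x, y) differs from (0, y - A x) by (x, A x), which lies in the plane. -/
lemma mkQ_eq (hθ : θ ∈ Φ.chart.source) (ξ : TangentSpace (𝓡 (n + m)) θ.point) :
    θ.plane.mkQ ξ = e.toNormal θ
      (normalPart (Φ.slope (Φ.chart θ)) (e.smoothChart.deriv θ.point ξ)) := by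
  change θ.plane.mkQ ξ = θ.plane.mkQ (e.smoothChart.vector θ.point (0, _))
  rw [← sub_eq_zero, ← map_sub, Submodule.mkQ_apply, Submodule.Quotient.mk_eq_zero,
    mem_plane_iff hθ, map_sub, SmoothChart.deriv_vector (point_mem_source hθ)]
  simp

/-- The graph of a linear map meets the vertical subspace only in 0. Equations in the normal bundle
can thus be tested on components in ℝᵐ. -/
lemma toNormal_injective (hθ : θ ∈ Φ.chart.source) : Function.Injective (e.toNormal θ) := by
  rw [← LinearMap.ker_eq_bot, LinearMap.ker_eq_bot']
  intro w hw
  change θ.plane.mkQ (e.smoothChart.vector θ.point (0, w)) = 0 at hw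
  rw [Submodule.mkQ_apply, Submodule.Quotient.mk_eq_zero,
    mem_plane_iff hθ, SmoothChart.deriv_vector (point_mem_source hθ)] at hw
  simpa using hw

variable [IsManifold (𝓡 (n + m)) ∞ E]

/-- Test sections with any prescribed value: constant independent components on the chart, and zero
elsewhere. The zero extension keeps values in the planes everywhere, while differentiability is
asked only at θ. -/
lemma exists_horizontalSection (hθ : θ ∈ Φ.chart.source) (h : Euc n) :
    ∃ s, IsHorizontalSectionAt F s θ ∧
      e.smoothChart.deriv θ.point (s θ) = (h, Φ.slope (Φ.chart θ) h) := by
  classical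
  set s : ∀ θ : Jet n m E r, TangentSpace (𝓡 (n + m)) θ.point := fun θ' =>
    if θ' ∈ Φ.chart.source then
      e.smoothChart.vector θ'.point (h, Φ.slope (Φ.chart θ') h) else 0 with hs
  have hd : ∀ θ' ∈ Φ.chart.source, e.smoothChart.deriv θ'.point (s θ') =
      (h, Φ.slope (Φ.chart θ') h) := by
    intro θ' hθ'
    simp only [hs, if_pos hθ']
    exact SmoothChart.deriv_vector (point_mem_source hθ') _
  refine ⟨s, ⟨fun θ' => ?_, ?_⟩, hd θ hθ⟩
  · by_cases hθ' : θ' ∈ Φ.chart.source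
    · rw [mem_plane_iff hθ', hd θ' hθ']
    · simp only [hs, if_neg hθ']
      exact Submodule.zero_mem _
  · rw [SmoothChart.mdifferentiableAt_iff (c := e.smoothChart) (point_mem_source hθ)]
    refine ⟨(contMDiffAt_point hθ).mdifferentiableAt (by simp), ?_⟩
    have h1 : MDifferentiableAt 𝓘(ℝ, F) 𝓘(ℝ, Euc n × Euc m)
        (fun θ' => ((h, Φ.slope (Φ.chart θ') h) : Euc n × Euc m)) θ := by
      have h2 : DifferentiableAt ℝ (fun b => ((h, Φ.slope b h) : Euc n × Euc m)) (Φ.chart θ) := by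
        fun_prop
      exact h2.mdifferentiableAt.comp θ (SmoothChart.mdifferentiableAt (c := Φ.toSmoothChart) hθ)
    refine h1.congr_of_eventuallyEq ?_
    filter_upwards [Φ.chart.open_source.mem_nhds hθ] with θ' hθ'
    exact hd θ' hθ'

variable {Γ : LinearConnection n m E}

/-- The key computation. Differentiating the constraint g₂ = A g₁ gives dg₂ = dA g₁ + A dg₁, and the
normal part subtracts A dg₁. What remains depends on the section only through its value at θ. -/
lemma normalDeriv_eq (hθ : θ ∈ Φ.chart.source)
    {s : ∀ θ : Jet n m E r, TangentSpace (𝓡 (n + m)) θ.point} (hs : IsHorizontalSectionAt F s θ)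
    (v : TangentSpace 𝓘(ℝ, F) θ) :
    normalDeriv Γ θ v s = e.toNormal θ
      (Φ.slope (Φ.deriv θ v) (e.smoothChart.deriv θ.point (s θ)).1 +
        normalChristoffel (e.smoothChart.christoffel Γ (e.chart θ.point)) (Φ.slope (Φ.chart θ))
          (Φ.base (Φ.deriv θ v)) (e.smoothChart.deriv θ.point (s θ)).1) := by
  have hp := point_mem_source hθ
  rw [normalDeriv, mkQ_eq hθ, deriv_pullbackDeriv hp hs.2, deriv_mfderiv_point hθ, map_add]
  have hg := ((SmoothChart.mdifferentiableAt_iff (c := e.smoothChart) hp).1 hs.2).2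
  set g : Jet n m E r → Euc n × Euc m := fun θ' => e.smoothChart.deriv θ'.point (s θ') with hgdef
  have hgθ : e.smoothChart.deriv θ.point (s θ) = g θ := rfl
  have hplane : ∀ θ' ∈ Φ.chart.source, (g θ').2 = Φ.slope (Φ.chart θ') (g θ').1 :=
    fun θ' hθ' => (mem_plane_iff hθ').1 (hs.1 θ')
  have hΦ := SmoothChart.mdifferentiableAt (c := Φ.toSmoothChart) hθ
  have h1 := mvfderiv_clm_comp (ContinuousLinearMap.fst ℝ (Euc n) (Euc m)) hg v
  have h2 := mvfderiv_clm_comp (ContinuousLinearMap.snd ℝ (Euc n) (Euc m)) hg v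
  have h3 : (fun θ' => ContinuousLinearMap.snd ℝ (Euc n) (Euc m) (g θ')) =ᶠ[𝓝 θ]
      fun θ' => Φ.slope (Φ.chart θ') (ContinuousLinearMap.fst ℝ (Euc n) (Euc m) (g θ')) := by
    filter_upwards [Φ.chart.open_source.mem_nhds hθ] with θ' hθ'
    exact hplane θ' hθ'
  have hA : MDifferentiableAt 𝓘(ℝ, F) 𝓘(ℝ, Euc n →L[ℝ] Euc m)
      (fun θ' => Φ.slope (Φ.chart θ')) θ :=
    Φ.slope.differentiableAt.mdifferentiableAt.comp θ hΦ
  have hu : MDifferentiableAt 𝓘(ℝ, F) 𝓘(ℝ, Euc n)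
      (fun θ' => ContinuousLinearMap.fst ℝ (Euc n) (Euc m) (g θ')) θ :=
    (ContinuousLinearMap.fst ℝ (Euc n) (Euc m)).differentiableAt.mdifferentiableAt.comp θ hg
  have h4 := h2
  -- `h4` becomes the differentiated constraint.
  rw [mvfderiv_congr h3, mvfderiv_clm_apply hA hu, mvfderiv_clm_chart Φ.slope hθ, h1] at h4
  simp only [ContinuousLinearMap.coe_fst', ContinuousLinearMap.coe_snd'] at h4
  rw [normalPart_apply, ← h4, add_sub_cancel_right, normalPart_apply, normalChristoffel_apply, hgθ]
  have h5 : g θ = ((g θ).1, Φ.slope (Φ.chart θ) (g θ).1) := Prod.ext rfl (hplane θ hθ)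
  congr 2
  rw [← h5]
  rfl

end SlopeChart

end NormalComponents

/-! ### Charts of the jet manifolds, R-planes and Cartan planes in coordinates. -/

section JetCharts

set_option synthInstance.maxHeartbeats 400000

variable {n m : ℕ} {E : Type*} [TopologicalSpace E] [ChartedSpace (Euc (n + m)) E]

/-- The chart of `J^r(E, n)` over a divided chart, from a system of jet coordinates. -/
def JetCoordinates.slopeChart {r : ℕ} {M : Type} [NormedAddCommGroup M] [NormedSpace ℝ M]
    (c : JetCoordinates n m E r M) (e : DividedChart n m E) (θ₀ : Jet n m E r)
    (base : M →L[ℝ] Euc n × Euc m) (slope : M →L[ℝ] Euc n →L[ℝ] Euc m)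
    (hb : ∀ s f, base (c.coord e s f) = e.chart s.pt)
    (hs : ∀ s f, slope (c.coord e s f) = fderiv ℝ f (e.chart s.pt).1) :
    letI := c.core.toTopologicalSpace
    letI := c.core.toChartedSpace
    SlopeChart r M e :=
  letI := c.core.toTopologicalSpace
  letI := c.core.toChartedSpace
  haveI := c.isManifold
  { chart := c.core.openPartialHomeomorph (c.chart (e, θ₀)) ⟨_, rfl⟩
    contMDiffOn_chart := contMDiffOn_of_mem_maximalAtlas
      (IsManifold.subset_maximalAtlas (mem_iUnion₂.2 ⟨_, ⟨(e, θ₀), rfl⟩, rfl⟩))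
    contMDiffOn_symm := contMDiffOn_symm_of_mem_maximalAtlas
      (IsManifold.subset_maximalAtlas (mem_iUnion₂.2 ⟨_, ⟨(e, θ₀), rfl⟩, rfl⟩))
    base := base
    slope := slope
    exists_graph := by
      rintro s ⟨s', f, h, hf⟩
      obtain ⟨g, hg, -⟩ := c.exists_of_jet_eq h e hf
      exact ⟨g, hg⟩
    mem_source := fun hf => c.mem_chart_source (e, θ₀) hf
    base_jet := fun hf => (congrArg base (c.chart_jet (e, θ₀) hf)).trans (hb _ _)
    slope_jet := fun hf => (congrArg slope (c.chart_jet (e, θ₀) hf)).trans (hs _ _) }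

lemma JetCoordinates.slopeChart_jet {r : ℕ} {M : Type} [NormedAddCommGroup M] [NormedSpace ℝ M]
    (c : JetCoordinates n m E r M) (e : DividedChart n m E) (θ₀ : Jet n m E r)
    (base : M →L[ℝ] Euc n × Euc m) (slope : M →L[ℝ] Euc n →L[ℝ] Euc m)
    (hb : ∀ s f, base (c.coord e s f) = e.chart s.pt)
    (hs : ∀ s f, slope (c.coord e s f) = fderiv ℝ f (e.chart s.pt).1)
    {s : PointedSubmanifold n m E} {f : Euc n → Euc m} (hf : IsGraphAt e s.L.carrier s.pt f) :
    letI := c.core.toTopologicalSpace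
    letI := c.core.toChartedSpace
    (c.slopeChart e θ₀ base slope hb hs).chart (jet r s) = c.coord e s f :=
  c.chart_jet (e, θ₀) hf

local instance (n m : ℕ) : NormedAddCommGroup (Euc n →L[ℝ] Euc m) :=
  ContinuousLinearMap.toNormedAddCommGroup

local instance (n m : ℕ) : NormedSpace ℝ (Euc n →L[ℝ] Euc m) := ContinuousLinearMap.toNormedSpace

local instance (n m : ℕ) : NormedAddCommGroup (Euc n →L[ℝ] Euc n →L[ℝ] Euc m) :=
  ContinuousLinearMap.toNormedAddCommGroup

local instance (n m : ℕ) : NormedSpace ℝ (Euc n →L[ℝ] Euc n →L[ℝ] Euc m) :=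
  ContinuousLinearMap.toNormedSpace

local instance (n m : ℕ) : NormedAddCommGroup (symBilin (Euc n) (Euc m)) :=
  Submodule.normedAddCommGroup _

local instance (n m : ℕ) : NormedSpace ℝ (symBilin (Euc n) (Euc m)) := Submodule.normedSpace _

local instance (n m : ℕ) : NormedAddCommGroup (Model₂ n m) := Prod.normedAddCommGroup

local instance (n m : ℕ) : SeminormedAddCommGroup (Model₂ n m) :=
  NormedAddCommGroup.toSeminormedAddCommGroup

local instance (n m : ℕ) : NormedSpace ℝ (Model₂ n m) := Prod.normedSpace

/-- The chart of `J¹(E, n)` over a divided chart. -/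
def jetChart₁ (e : DividedChart n m E) (θ₀ : Jet n m E 1) : SlopeChart 1 (Model₁ n m) e :=
  (jetCoordinates₁ n m E).slopeChart e θ₀ (ContinuousLinearMap.fst ℝ _ _)
    (ContinuousLinearMap.snd ℝ _ _) (fun _ _ => rfl) (fun _ _ => rfl)

/-- The chart of `J²(E, n)` over a divided chart. -/
def jetChart₂ (e : DividedChart n m E) (θ₀ : Jet n m E 2) : SlopeChart 2 (Model₂ n m) e :=
  (jetCoordinates₂ n m E).slopeChart e θ₀
    (ContinuousLinearMap.fst ℝ (Euc n × Euc m) (Euc n →L[ℝ] Euc m) ∘L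
      ContinuousLinearMap.fst ℝ (Model₁ n m) (symBilin (Euc n) (Euc m)))
    (ContinuousLinearMap.snd ℝ (Euc n × Euc m) (Euc n →L[ℝ] Euc m) ∘L
      ContinuousLinearMap.fst ℝ (Model₁ n m) (symBilin (Euc n) (Euc m)))
    (fun _ _ => rfl) (fun _ _ => rfl)

section Coordinates

variable {e : DividedChart n m E} {s : PointedSubmanifold n m E} {f : Euc n → Euc m}

lemma jetChart₁_jet (hf : IsGraphAt e s.L.carrier s.pt f) (θ₀ : Jet n m E 1) :
    (jetChart₁ e θ₀).chart (jet 1 s) = (e.chart s.pt, fderiv ℝ f (e.chart s.pt).1) :=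
  (jetCoordinates₁ n m E).slopeChart_jet e θ₀ _ _ _ _ hf

lemma jetChart₂_jet (hf : IsGraphAt e s.L.carrier s.pt f) (θ₀ : Jet n m E 2) :
    (jetChart₂ e θ₀).chart (jet 2 s) = ((e.chart s.pt, fderiv ℝ f (e.chart s.pt).1),
      symmetrize (fderiv ℝ (fderiv ℝ f) (e.chart s.pt).1)) :=
  (jetCoordinates₂ n m E).slopeChart_jet e θ₀ _ _ _ _ hf

/-- At either order, lying in the chart means that a representative is a graph in `e`, a condition
which does not see the order of the jet. -/
lemma proj_mem_source_iff {θ₀ : Jet n m E 1} {θ₁ θ : Jet n m E 2} :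
    Jet.proj one_le_two θ ∈ (jetChart₁ e θ₀).chart.source ↔ θ ∈ (jetChart₂ e θ₁).chart.source := by
  obtain ⟨s, rfl⟩ := Quot.exists_rep θ
  constructor
  · intro h
    obtain ⟨f, hf⟩ := (jetChart₁ e θ₀).exists_graph s h
    exact (jetChart₂ e θ₁).mem_source hf
  · intro h
    obtain ⟨f, hf⟩ := (jetChart₂ e θ₁).exists_graph s h
    exact (jetChart₁ e θ₀).mem_source hf

lemma jetChart₁_proj {θ₀ : Jet n m E 1} {θ₁ θ : Jet n m E 2}
    (hθ : θ ∈ (jetChart₂ e θ₁).chart.source) :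
    (jetChart₁ e θ₀).chart (Jet.proj one_le_two θ) = ((jetChart₂ e θ₁).chart θ).1 := by
  obtain ⟨s, f, rfl, hf⟩ := (jetChart₂ e θ₁).exists_rep hθ
  rw [jetChart₂_jet hf]
  exact jetChart₁_jet hf θ₀

lemma exists_jetChart₂_eq {θ₁ : Jet n m E 2} {b : Model₂ n m} (hb : b.1.1 ∈ e.chart.target) :
    ∃ θ ∈ (jetChart₂ e θ₁).chart.source, (jetChart₂ e θ₁).chart θ = b :=
  ⟨_, (jetChart₂ e θ₁).chart.map_target hb, (jetChart₂ e θ₁).chart.right_inv hb⟩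

lemma differentiableAt_fderiv (hf : IsGraphAt e s.L.carrier s.pt f) :
    DifferentiableAt ℝ (fderiv ℝ f) (e.chart s.pt).1 :=
  (hf.contDiffAt.fderiv_right (m := 1) (n := ∞) (WithTop.coe_le_coe.2 le_top)).differentiableAt
    (by simp)

lemma isLocalExpr_jet₁ (hf : IsGraphAt e s.L.carrier s.pt f) (θ₀ : Jet n m E 1) :
    IsLocalExpr e (jetChart₁ e θ₀).toSmoothChart (jet 1) s f (fun z => ((z, f z), fderiv ℝ f z)) where
  isGraphAt := hf
  differentiableAt := (differentiableAt_id.prodMk (hf.contDiffAt.differentiableAt (by simp))).prodMk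
    (differentiableAt_fderiv hf)
  eventually := by
    filter_upwards [hf.nearby] with q hq hq'
    refine ⟨(jetChart₁ e θ₀).mem_source (s := ⟨s.L, q, hq'⟩) (hq hq'), ?_⟩
    rw [jetChart₁_jet (s := ⟨s.L, q, hq'⟩) (hq hq'), ← (hq hq').chart_eq]

lemma isLocalExpr_jet₂ (hf : IsGraphAt e s.L.carrier s.pt f) (θ₁ : Jet n m E 2) :
    IsLocalExpr e (jetChart₂ e θ₁).toSmoothChart (jet 2) s f
      (fun z => (((z, f z), fderiv ℝ f z), symmetrize (fderiv ℝ (fderiv ℝ f) z))) where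
  isGraphAt := hf
  differentiableAt := by
    refine ((differentiableAt_id.prodMk (hf.contDiffAt.differentiableAt (by simp))).prodMk
      (differentiableAt_fderiv hf)).prodMk ?_
    have h1 : ContDiffAt ℝ ∞ (fderiv ℝ f) (e.chart s.pt).1 :=
      hf.contDiffAt.fderiv_right (by simp)
    have h2 : ContDiffAt ℝ ∞ (fderiv ℝ (fderiv ℝ f)) (e.chart s.pt).1 :=
      h1.fderiv_right (by simp)
    exact symmetrize.differentiableAt.comp _ (h2.differentiableAt (by simp))
  eventually := by
    filter_upwards [hf.nearby] with q hq hq'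
    refine ⟨(jetChart₂ e θ₁).mem_source (s := ⟨s.L, q, hq'⟩) (hq hq'), ?_⟩
    rw [jetChart₂_jet (s := ⟨s.L, q, hq'⟩) (hq hq'), ← (hq hq').chart_eq]

/-- The coordinates of the vectors of the `R`-plane of a `2`-jet with slope `b.1.2` and second
derivatives `b.2`. -/
def rPlaneMap (b : Model₂ n m) : Euc n →L[ℝ] Model₁ n m :=
  (graphMap b.1.2).prod (b.2 : Euc n →L[ℝ] Euc n →L[ℝ] Euc m)

@[simp]
lemma rPlaneMap_apply (b : Model₂ n m) (u : Euc n) :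
    rPlaneMap b u = ((u, b.1.2 u), (b.2 : Euc n →L[ℝ] Euc n →L[ℝ] Euc m) u) := by
  simp [rPlaneMap]

lemma fderiv_jet₁ (hf : IsGraphAt e s.L.carrier s.pt f) (θ₁ : Jet n m E 2) (u : Euc n) :
    fderiv ℝ (fun z => ((z, f z), fderiv ℝ f z)) (e.chart s.pt).1 u =
      rPlaneMap ((jetChart₂ e θ₁).chart (jet 2 s)) u := by
  have h : HasFDerivAt (fun z => ((z, f z), fderiv ℝ f z)) _ (e.chart s.pt).1 :=
    ((hasFDerivAt_id _).prodMk (hf.contDiffAt.differentiableAt (by simp)).hasFDerivAt).prodMk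
      (differentiableAt_fderiv hf).hasFDerivAt
  rw [h.fderiv, rPlaneMap_apply, jetChart₂_jet hf, coe_symmetrize (symmetric_snd hf.contDiffAt)]
  rfl

/-- The prolongation of the graph of f is parametrized by z ↦ (z, f z, Df z), and the derivative of
this map involves only the 2-jet of f. -/
lemma mem_rPlane_iff {θ₀ : Jet n m E 1} {θ₁ θ : Jet n m E 2}
    (hθ : θ ∈ (jetChart₂ e θ₁).chart.source)
    {w : TangentSpace 𝓘(ℝ, Model₁ n m) (Jet.proj one_le_two θ)} :
    w ∈ θ.rPlane ↔ ∃ u, (jetChart₁ e θ₀).deriv _ w = rPlaneMap ((jetChart₂ e θ₁).chart θ) u := by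
  constructor
  · intro h
    have := deriv_mem_of_mem_velocityPlane (e := e) (φ := (jetChart₁ e θ₀).toSmoothChart)
      (LinearMap.range (rPlaneMap ((jetChart₂ e θ₁).chart θ) : Euc n →ₗ[ℝ] Model₁ n m)) ?_ h
    · obtain ⟨u, hu⟩ := this
      exact ⟨u, hu.symm⟩
    · rintro s rfl -
      obtain ⟨f, hf⟩ := (jetChart₂ e θ₁).exists_graph s hθ
      exact ⟨f, _, isLocalExpr_jet₁ hf θ₀, fun u => ⟨u, (fderiv_jet₁ hf θ₁ u).symm⟩⟩
  · rintro ⟨u, hu⟩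
    obtain ⟨s, f, rfl, hf⟩ := (jetChart₂ e θ₁).exists_rep hθ
    obtain ⟨v, hv, hv'⟩ := exists_mem_velocityPlane (P := fun s' => jet 2 s' = jet 2 s)
      (isLocalExpr_jet₁ hf θ₀) rfl u
    rw [fderiv_jet₁ hf θ₁, ← hu] at hv'
    have h2 : v = w := SmoothChart.deriv_injective (c := (jetChart₁ e θ₀).toSmoothChart)
      (x := jet 1 s) ((jetChart₁ e θ₀).mem_source hf) hv'
    exact h2 ▸ hv

lemma fderiv_jet₂_fst (hf : IsGraphAt e s.L.carrier s.pt f) (θ₁ : Jet n m E 2) (u : Euc n) :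
    (fderiv ℝ (fun z => (((z, f z), fderiv ℝ f z), symmetrize (fderiv ℝ (fderiv ℝ f) z)))
      (e.chart s.pt).1 u).1 = rPlaneMap ((jetChart₂ e θ₁).chart (jet 2 s)) u := by
  rw [← fderiv_jet₁ hf]
  have h := (isLocalExpr_jet₂ hf θ₁).differentiableAt.hasFDerivAt.fst
  exact (DFunLike.congr_fun h.fderiv u).symm

/-- The second-order part of a Cartan vector depends on third derivatives of representatives and is
left free. Only the projection to first-order coordinates is controlled, which is all that the
second fundamental form uses. -/
lemma exists_of_mem_cartanPlane {θ₁ θ : Jet n m E 2} (hθ : θ ∈ (jetChart₂ e θ₁).chart.source)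
    {v : TangentSpace 𝓘(ℝ, Model₂ n m) θ} (hv : v ∈ θ.cartanPlane) :
    ∃ u, ((jetChart₂ e θ₁).deriv θ v).1 = rPlaneMap ((jetChart₂ e θ₁).chart θ) u := by
  have := deriv_mem_of_mem_velocityPlane (e := e) (φ := (jetChart₂ e θ₁).toSmoothChart)
    ((LinearMap.range (rPlaneMap ((jetChart₂ e θ₁).chart θ) : Euc n →ₗ[ℝ] Model₁ n m)).comap
      (LinearMap.fst ℝ (Model₁ n m) (symBilin (Euc n) (Euc m)))) ?_ hv
  · obtain ⟨u, hu⟩ := this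
    exact ⟨u, hu.symm⟩
  · rintro s rfl -
    obtain ⟨f, hf⟩ := (jetChart₂ e θ₁).exists_graph s hθ
    exact ⟨f, _, isLocalExpr_jet₂ hf θ₁, fun u => ⟨u, (fderiv_jet₂_fst hf θ₁ u).symm⟩⟩

lemma exists_mem_cartanPlane {θ₁ θ : Jet n m E 2} (hθ : θ ∈ (jetChart₂ e θ₁).chart.source)
    (u : Euc n) : ∃ v ∈ θ.cartanPlane,
      ((jetChart₂ e θ₁).deriv θ v).1 = rPlaneMap ((jetChart₂ e θ₁).chart θ) u := by
  obtain ⟨s, f, rfl, hf⟩ := (jetChart₂ e θ₁).exists_rep hθ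
  obtain ⟨v, hv, hv'⟩ := exists_mem_velocityPlane (P := fun s' => jet 2 s' = jet 2 s)
    (isLocalExpr_jet₂ hf θ₁) rfl u
  exact ⟨v, hv, hv' ▸ fderiv_jet₂_fst hf θ₁ u⟩

end Coordinates

/-! ### The associated connection on the first jet manifold. -/

section AssociatedConnection

lemma contDiffOn_normalChristoffel {V W : Type*} [NormedAddCommGroup V] [NormedSpace ℝ V]
    [NormedAddCommGroup W] [NormedSpace ℝ W] {C : V × W → V × W →L[ℝ] V × W →L[ℝ] V × W}
    {U : Set (V × W)} (hC : ContDiffOn ℝ ∞ C U) :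
    ContDiffOn ℝ ∞ (fun b : (V × W) × (V →L[ℝ] W) => normalChristoffel (C b.1) b.2)
      (Prod.fst ⁻¹' U) := by
  have h1 : ContDiffOn ℝ ∞ (fun b : (V × W) × (V →L[ℝ] W) => C b.1) (Prod.fst ⁻¹' U) :=
    hC.comp contDiff_fst.contDiffOn fun _ h => h
  have h2 : ContDiffOn ℝ ∞ (fun b : (V × W) × (V →L[ℝ] W) => (C b.1, b.2)) (Prod.fst ⁻¹' U) :=
    h1.prodMk contDiff_snd.contDiffOn
  have h3 := contDiff_normalChristoffel (V := V) (W := W)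
  have h4 := h3.comp_contDiffOn h2
  exact h4

lemma exists_mem_source_jetChart₁ (θ : Jet n m E 1) :
    ∃ e : DividedChart n m E, θ ∈ (jetChart₁ e θ).chart.source := by
  obtain ⟨s, rfl⟩ := Quot.exists_rep θ
  obtain ⟨e, f, hf⟩ := s.L.isGraphAt s.pt s.mem
  exact ⟨e, (jetChart₁ e _).mem_source hf⟩

lemma exists_mem_source_jetChart₂ (θ : Jet n m E 2) :
    ∃ e : DividedChart n m E, θ ∈ (jetChart₂ e θ).chart.source := by
  obtain ⟨s, rfl⟩ := Quot.exists_rep θ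
  obtain ⟨e, f, hf⟩ := s.L.isGraphAt s.pt s.mem
  exact ⟨e, (jetChart₂ e _).mem_source hf⟩

lemma jetChart₁_fst {e : DividedChart n m E} {θ₀ θ : Jet n m E 1}
    (hθ : θ ∈ (jetChart₁ e θ₀).chart.source) :
    e.chart θ.point = ((jetChart₁ e θ₀).chart θ).1 :=
  SlopeChart.chart_point hθ

lemma deriv_mfderiv_point₁ {e : DividedChart n m E} {θ₀ θ : Jet n m E 1}
    (hθ : θ ∈ (jetChart₁ e θ₀).chart.source)
    (v : TangentSpace 𝓘(ℝ, Model₁ n m) θ) :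
    e.smoothChart.deriv θ.point
      (mfderiv 𝓘(ℝ, Model₁ n m) (𝓡 (n + m)) (Jet.point : Jet n m E 1 → E) θ v) =
      ((jetChart₁ e θ₀).deriv θ v).1 :=
  SlopeChart.deriv_mfderiv_point hθ v

variable [IsManifold (𝓡 (n + m)) ∞ E]

/-- The transversal component of the Christoffel symbols of `Γ` at the `1`-jet with
coordinates `b`. -/
def normalForm (Γ : LinearConnection n m E) (e : DividedChart n m E) (b : Model₁ n m) :
    Euc n × Euc m →L[ℝ] Euc n →L[ℝ] Euc m :=
  normalChristoffel (e.smoothChart.christoffel Γ b.1) b.2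

/-- Restricted to vectors of the graph, both arguments of the Christoffel symbols have the form (u,
A u), so their symmetry passes to the normal part. -/
lemma normalForm_symm {Γ : LinearConnection n m E} (hΓ : Γ.torsion = 0) {e : DividedChart n m E}
    {b : Model₁ n m} (hb : b.1 ∈ e.chart.target) (u v : Euc n) :
    normalForm Γ e b (graphMap b.2 u) v = normalForm Γ e b (graphMap b.2 v) u := by
  have h := SmoothChart.christoffel_symm (c := e.smoothChart) hΓ hb (u, b.2 u) (v, b.2 v)
  simp only [normalForm, normalChristoffel_apply, graphMap_apply]
  rw [h]

lemma contDiffOn_normalForm [T2Space E] {Γ : LinearConnection n m E}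
    [CovariantDerivative.ContMDiffCovariantDerivative Γ ∞] {e : DividedChart n m E} :
    ContDiffOn ℝ ∞ (normalForm Γ e) (Prod.fst ⁻¹' e.chart.target) :=
  contDiffOn_normalChristoffel (SmoothChart.contDiffOn_christoffel (c := e.smoothChart))

section OrderOne

variable {e : DividedChart n m E} {θ₀ θ : Jet n m E 1} {Γ : LinearConnection n m E}

lemma normalDeriv_jet₁ (hθ : θ ∈ (jetChart₁ e θ₀).chart.source)
    {s : ∀ θ : Jet n m E 1, TangentSpace (𝓡 (n + m)) θ.point}
    (hs : IsHorizontalSectionAt (Model₁ n m) s θ) (v : TangentSpace 𝓘(ℝ, Model₁ n m) θ) :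
    normalDeriv Γ θ v s = e.toNormal θ
      (((jetChart₁ e θ₀).deriv θ v).2 (e.smoothChart.deriv θ.point (s θ)).1 +
        normalForm Γ e ((jetChart₁ e θ₀).chart θ) ((jetChart₁ e θ₀).deriv θ v).1
          (e.smoothChart.deriv θ.point (s θ)).1) := by
  rw [SlopeChart.normalDeriv_eq hθ hs v, jetChart₁_fst hθ]
  rfl

/-- The coordinates of the horizontal vectors of the associated connection. -/
lemma horizontal_iff (hθ : θ ∈ (jetChart₁ e θ₀).chart.source)
    {X : TangentSpace (𝓡 (n + m)) θ.point} {v : TangentSpace 𝓘(ℝ, Model₁ n m) θ} :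
    (mfderiv 𝓘(ℝ, Model₁ n m) (𝓡 (n + m)) (Jet.point : Jet n m E 1 → E) θ v = X ∧
      ∀ s, IsHorizontalSectionAt (Model₁ n m) s θ → normalDeriv Γ θ v s = 0) ↔
    (jetChart₁ e θ₀).deriv θ v = (e.smoothChart.deriv θ.point X,
      -normalForm Γ e ((jetChart₁ e θ₀).chart θ) (e.smoothChart.deriv θ.point X)) := by
  have hpt := deriv_mfderiv_point₁ hθ v
  constructor
  · rintro ⟨hX, h⟩
    rw [hX] at hpt
    refine Prod.ext hpt.symm ?_
    ext1 u
    -- Sections through every `u` determine the whole linear map that is the slope component of `v`.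
    obtain ⟨s, hs, hsu⟩ := SlopeChart.exists_horizontalSection hθ u
    have h1 := h s hs
    rw [normalDeriv_jet₁ hθ hs, map_eq_zero_iff _ (SlopeChart.toNormal_injective hθ), hsu,
      ← hpt] at h1
    exact eq_neg_of_add_eq_zero_left h1
  · intro h
    refine ⟨SmoothChart.deriv_injective (SlopeChart.point_mem_source hθ)
      (hpt.trans (congrArg Prod.fst h)), fun s hs => ?_⟩
    rw [normalDeriv_jet₁ hθ hs, h]
    simp

/-- The horizontal lift of the associated connection. -/
def horizontalLift (Γ : LinearConnection n m E) (θ : Jet n m E 1) :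
    TangentSpace (𝓡 (n + m)) θ.point →L[ℝ] TangentSpace 𝓘(ℝ, Model₁ n m) θ :=
  let e := (exists_mem_source_jetChart₁ θ).choose
  (jetChart₁ e θ).vector θ ∘L ((ContinuousLinearMap.id ℝ (Euc n × Euc m)).prod
    (-normalForm Γ e ((jetChart₁ e θ).chart θ))) ∘L e.smoothChart.deriv θ.point

lemma horizontalLift_spec (Γ : LinearConnection n m E) (θ : Jet n m E 1)
    (X : TangentSpace (𝓡 (n + m)) θ.point) :
    mfderiv 𝓘(ℝ, Model₁ n m) (𝓡 (n + m)) (Jet.point : Jet n m E 1 → E) θ (horizontalLift Γ θ X)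
        = X ∧
      ∀ s, IsHorizontalSectionAt (Model₁ n m) s θ →
        normalDeriv Γ θ (horizontalLift Γ θ X) s = 0 :=
  (horizontal_iff (exists_mem_source_jetChart₁ θ).choose_spec).2
    (SmoothChart.deriv_vector (c := (jetChart₁ _ θ).toSmoothChart)
      (exists_mem_source_jetChart₁ θ).choose_spec _)

/-- The lift was built in a chosen chart but satisfies a chart-free condition; `horizontal_iff`
translates that condition into any chart around θ, so the choice is immaterial. -/
lemma deriv_horizontalLift (hθ : θ ∈ (jetChart₁ e θ₀).chart.source)
    (X : TangentSpace (𝓡 (n + m)) θ.point) :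
    (jetChart₁ e θ₀).deriv θ (horizontalLift Γ θ X) = (e.smoothChart.deriv θ.point X,
      -normalForm Γ e ((jetChart₁ e θ₀).chart θ) (e.smoothChart.deriv θ.point X)) :=
  (horizontal_iff hθ).1 (horizontalLift_spec Γ θ X)

lemma contMDiffAt_normalForm [T2Space E] [CovariantDerivative.ContMDiffCovariantDerivative Γ ∞]
    (hθ : θ ∈ (jetChart₁ e θ₀).chart.source) :
    ContMDiffAt 𝓘(ℝ, Model₁ n m) 𝓘(ℝ, Euc n × Euc m →L[ℝ] Euc n →L[ℝ] Euc m) ∞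
      (fun θ' => normalForm Γ e ((jetChart₁ e θ₀).chart θ')) θ := by
  have h1 : ContDiffAt ℝ ∞ (normalForm Γ e) ((jetChart₁ e θ₀).chart θ) := by
    refine contDiffOn_normalForm.contDiffAt
      ((e.chart.open_target.preimage continuous_fst).mem_nhds ?_)
    rw [mem_preimage, ← jetChart₁_fst hθ]
    exact e.chart.map_source (SlopeChart.point_mem_source hθ)
  exact ContMDiffAt.comp θ h1.contMDiffAt
    (SmoothChart.contMDiffAt (c := (jetChart₁ e θ₀).toSmoothChart) hθ)

/-- The connection on `J¹(E, n)` associated with `Γ`. -/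
def associatedConnection [T2Space E] (Γ : LinearConnection n m E)
    [CovariantDerivative.ContMDiffCovariantDerivative Γ ∞] : JetConnection n m E where
  lift := horizontalLift Γ
  mfderiv_lift θ X := (horizontalLift_spec Γ θ X).1
  contMDiff_lift X hX θ := by
    obtain ⟨e, hθ⟩ := exists_mem_source_jetChart₁ θ
    rw [SmoothChart.contMDiffAt_iff (c := (jetChart₁ e θ).toSmoothChart) hθ]
    refine ⟨contMDiffAt_id, ?_⟩
    have h1 := ((SmoothChart.contMDiffAt_iff (c := e.smoothChart)
      (SlopeChart.point_mem_source hθ)).1 (hX θ.point)).2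
    have h2 := ContMDiffAt.comp θ h1 (SlopeChart.contMDiffAt_point hθ)
    have h3 := h2.prodMk_space ((contMDiffAt_normalForm (Γ := Γ) hθ).clm_apply h2).neg
    refine h3.congr_of_eventuallyEq ?_
    filter_upwards [(jetChart₁ e θ).chart.open_source.mem_nhds hθ] with θ' hθ'
    exact deriv_horizontalLift hθ' _

lemma isAssociatedConnection_iff [T2Space E] (Γ : LinearConnection n m E)
    [CovariantDerivative.ContMDiffCovariantDerivative Γ ∞] (D : JetConnection n m E) :
    IsAssociatedConnection Γ D ↔ D = associatedConnection Γ := by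
  constructor
  · intro h
    ext1
    funext θ
    ext1 X
    obtain ⟨e, hθ⟩ := exists_mem_source_jetChart₁ θ
    refine SmoothChart.deriv_injective (c := (jetChart₁ e θ).toSmoothChart) hθ ?_
    exact ((horizontal_iff hθ).1 ⟨D.mfderiv_lift θ X, h θ X⟩).trans
      (deriv_horizontalLift hθ X).symm
  · rintro rfl θ X
    exact (horizontalLift_spec Γ θ X).2

end OrderOne

end AssociatedConnection

/-! ### Geodesic 2-jets and the section they form. -/

section GeodesicJets

lemma jetChart₁_mem_target {e : DividedChart n m E} {θ₀ θ : Jet n m E 1}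
    (hθ : θ ∈ (jetChart₁ e θ₀).chart.source) :
    ((jetChart₁ e θ₀).chart θ).1 ∈ e.chart.target :=
  (jetChart₁ e θ₀).chart.map_source hθ

variable [IsManifold (𝓡 (n + m)) ∞ E]

/-- The second derivatives of the geodesic `2`-jet over the `1`-jet with coordinates `b`. -/
def geodesicForm (Γ : LinearConnection n m E) (e : DividedChart n m E) (b : Model₁ n m) :
    Euc n →L[ℝ] Euc n →L[ℝ] Euc m :=
  -(normalForm Γ e b ∘L graphMap b.2)

lemma geodesicForm_apply (Γ : LinearConnection n m E) (e : DividedChart n m E) (b : Model₁ n m)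
    (u v : Euc n) : geodesicForm Γ e b u v = -normalForm Γ e b (u, b.2 u) v := by
  simp [geodesicForm]

lemma geodesicForm_mem {Γ : LinearConnection n m E} (hΓ : Γ.torsion = 0) {e : DividedChart n m E}
    {b : Model₁ n m} (hb : b.1 ∈ e.chart.target) :
    geodesicForm Γ e b ∈ symBilin (Euc n) (Euc m) := fun u v =>
  congrArg Neg.neg (normalForm_symm hΓ hb u v)

/-- `R_θ` is the horizontal lift of `H^{1,0}`. -/
def IsGeodesicJet (Γ : LinearConnection n m E) (θ : Jet n m E 2) : Prop :=
  (θ.rPlane : Set (TangentSpace 𝓘(ℝ, Model₁ n m) (Jet.proj one_le_two θ))) =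
    horizontalLift Γ (Jet.proj one_le_two θ) '' (Jet.proj one_le_two θ).plane

/-- `IsContraction` compares subsets of the tangent bundle, since the projection of `G θ` equals θ
only propositionally. Once the base points are identified, injectivity of the fibre inclusion
reduces it to equality of two planes in one tangent space. -/
lemma isContraction_iff [T2Space E] (Γ : LinearConnection n m E)
    [CovariantDerivative.ContMDiffCovariantDerivative Γ ∞] {G : Jet n m E 1 → Jet n m E 2}
    (hG : IsJetSection G) :
    IsContraction (associatedConnection Γ) G ↔ ∀ θ, IsGeodesicJet Γ (G θ) := by
  refine forall_congr' fun θ => ?_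
  have key : ∀ (θ' : Jet n m E 1) (θ₂ : Jet n m E 2), Jet.proj one_le_two θ₂ = θ' →
      ((fun w => (⟨Jet.proj one_le_two θ₂, w⟩ : TangentBundle 𝓘(ℝ, Model₁ n m) (Jet n m E 1))) ''
        (θ₂.rPlane : Set (TangentSpace 𝓘(ℝ, Model₁ n m) (Jet.proj one_le_two θ₂))) =
      (fun X => (⟨θ', horizontalLift Γ θ' X⟩ : TangentBundle 𝓘(ℝ, Model₁ n m) (Jet n m E 1))) ''
        (θ'.plane : Set (TangentSpace (𝓡 (n + m)) θ'.point)) ↔ IsGeodesicJet Γ θ₂) := by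
    rintro _ θ₂ rfl
    rw [IsGeodesicJet, ← (Set.image_injective.2 (TotalSpace.mk_injective
      (F := Model₁ n m) (E := (TangentSpace 𝓘(ℝ, Model₁ n m) : Jet n m E 1 → Type _))
      (Jet.proj one_le_two θ₂))).eq_iff, Set.image_image]
  exact key θ (G θ) (hG θ)

section Coordinates

variable {e : DividedChart n m E} {θ₁ θ : Jet n m E 2} {Γ : LinearConnection n m E}

/-- Both planes are graphs over the same n-plane of vectors (u, A u), with slope components B u and
-N(u, A u). They agree exactly when these two functions of u do. -/
lemma isGeodesicJet_iff (hθ : θ ∈ (jetChart₂ e θ₁).chart.source) :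
    IsGeodesicJet Γ θ ↔ (((jetChart₂ e θ₁).chart θ).2 : Euc n →L[ℝ] Euc n →L[ℝ] Euc m) =
      geodesicForm Γ e ((jetChart₂ e θ₁).chart θ).1 := by
  set θ₀ : Jet n m E 1 := Jet.proj one_le_two θ with hθ₀
  have h₀ : θ₀ ∈ (jetChart₁ e θ₀).chart.source := proj_mem_source_iff.2 hθ
  set b : Model₂ n m := (jetChart₂ e θ₁).chart θ with hb
  have hb₁ : (jetChart₁ e θ₀).chart θ₀ = b.1 := jetChart₁_proj hθ
  have hplane : ∀ X : TangentSpace (𝓡 (n + m)) θ₀.point, X ∈ θ₀.plane →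
      (jetChart₁ e θ₀).deriv θ₀ (horizontalLift Γ θ₀ X) =
        (((e.smoothChart.deriv θ₀.point X).1, b.1.2 (e.smoothChart.deriv θ₀.point X).1),
          geodesicForm Γ e b.1 (e.smoothChart.deriv θ₀.point X).1) := by
    intro X hX
    have h1 : e.smoothChart.deriv θ₀.point X =
        ((e.smoothChart.deriv θ₀.point X).1, b.1.2 (e.smoothChart.deriv θ₀.point X).1) :=
      Prod.ext rfl (((jetChart₁ e θ₀).mem_plane_iff h₀).1 hX |>.trans (by rw [hb₁]; rfl))
    rw [deriv_horizontalLift h₀, hb₁]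
    refine Prod.ext h1 ?_
    ext1 v
    rw [geodesicForm_apply, ← h1]
    rfl
  have hex : ∀ u, ∃ X ∈ θ₀.plane, (e.smoothChart.deriv θ₀.point X).1 = u := by
    intro u
    have h1 : e.smoothChart.deriv θ₀.point (e.smoothChart.vector θ₀.point (u, b.1.2 u)) =
        (u, b.1.2 u) := SmoothChart.deriv_vector (SlopeChart.point_mem_source h₀) _
    refine ⟨e.smoothChart.vector θ₀.point (u, b.1.2 u),
      ((jetChart₁ e θ₀).mem_plane_iff h₀).2 ?_, congrArg Prod.fst h1⟩
    rw [h1, hb₁]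
    rfl
  constructor
  · intro h
    ext1 u
    obtain ⟨X, hX, rfl⟩ := hex u
    have h1 : horizontalLift Γ θ₀ X ∈ θ.rPlane := h.ge ⟨X, hX, rfl⟩
    obtain ⟨u', hu'⟩ := (mem_rPlane_iff (θ₀ := θ₀) hθ).1 h1
    have h2 := (hplane X hX).symm.trans hu'
    rw [rPlaneMap_apply] at h2
    have h3 := congrArg (fun z => z.1.1) h2
    have h4 := congrArg (fun z => z.2) h2
    simp only at h3 h4
    rw [h4, h3]
  · intro h
    ext w
    constructor
    · intro hw
      obtain ⟨u, hu⟩ := (mem_rPlane_iff (θ₀ := θ₀) hθ).1 hw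
      obtain ⟨X, hX, rfl⟩ := hex u
      refine ⟨X, hX, SmoothChart.deriv_injective (c := (jetChart₁ e θ₀).toSmoothChart) h₀ ?_⟩
      rw [rPlaneMap_apply, h] at hu
      exact (hplane X hX).trans hu.symm
    · rintro ⟨X, hX, rfl⟩
      refine (mem_rPlane_iff (θ₀ := θ₀) hθ).2 ⟨(e.smoothChart.deriv θ₀.point X).1,
        (hplane X hX).trans ?_⟩
      rw [rPlaneMap_apply, h]

/-- Over each `1`-jet there is exactly one geodesic `2`-jet. -/
lemma existsUnique_isGeodesicJet (hΓ : Γ.torsion = 0) (θ₀ : Jet n m E 1) :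
    ∃! θ : Jet n m E 2, Jet.proj one_le_two θ = θ₀ ∧ IsGeodesicJet Γ θ := by
  obtain ⟨e, hθ₀⟩ := exists_mem_source_jetChart₁ θ₀
  -- The chart of the second jet manifold needs some jet as its value off the target; any one will
  -- do.
  have θ₁ : Jet n m E 2 := jet 2 θ₀.out
  set b := (jetChart₁ e θ₀).chart θ₀ with hb
  have hbt : b.1 ∈ e.chart.target := jetChart₁_mem_target hθ₀
  -- Vanishing torsion enters here: the required second derivatives are coordinates of a 2-jet only
  -- because they are symmetric.
  obtain ⟨θ, hθ, hθb⟩ := exists_jetChart₂_eq (θ₁ := θ₁)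
    (b := (b, ⟨geodesicForm Γ e b, geodesicForm_mem hΓ hbt⟩)) hbt
  refine ⟨θ, ⟨?_, ?_⟩, ?_⟩
  · refine (jetChart₁ e θ₀).chart.injOn (proj_mem_source_iff.2 hθ) hθ₀ ?_
    rw [jetChart₁_proj hθ, hθb]
  · rw [isGeodesicJet_iff hθ, hθb]
  · rintro θ' ⟨rfl, hg⟩
    have hθ' : θ' ∈ (jetChart₂ e θ₁).chart.source := proj_mem_source_iff.1 hθ₀
    rw [isGeodesicJet_iff hθ'] at hg
    refine (jetChart₂ e θ₁).chart.injOn hθ' hθ (Eq.trans ?_ hθb.symm)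
    have h1 : ((jetChart₂ e θ₁).chart θ').1 = b := (jetChart₁_proj hθ').symm
    refine Prod.ext h1 (Subtype.ext ?_)
    rw [hg, h1]

end Coordinates

/-- The section `Γ̈` of `π_{2,1}`. -/
def geodesicSection (Γ : LinearConnection n m E) (hΓ : Γ.torsion = 0) (θ : Jet n m E 1) :
    Jet n m E 2 :=
  (existsUnique_isGeodesicJet hΓ θ).choose

lemma proj_geodesicSection {Γ : LinearConnection n m E} (hΓ : Γ.torsion = 0) (θ : Jet n m E 1) :
    Jet.proj one_le_two (geodesicSection Γ hΓ θ) = θ :=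
  (existsUnique_isGeodesicJet hΓ θ).choose_spec.1.1

lemma isGeodesicJet_geodesicSection {Γ : LinearConnection n m E} (hΓ : Γ.torsion = 0)
    (θ : Jet n m E 1) : IsGeodesicJet Γ (geodesicSection Γ hΓ θ) :=
  (existsUnique_isGeodesicJet hΓ θ).choose_spec.1.2

lemma eq_geodesicSection {Γ : LinearConnection n m E} (hΓ : Γ.torsion = 0) {θ : Jet n m E 2}
    (h : IsGeodesicJet Γ θ) : θ = geodesicSection Γ hΓ (Jet.proj one_le_two θ) :=
  (existsUnique_isGeodesicJet hΓ _).choose_spec.2 θ ⟨rfl, h⟩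

lemma isJetSection_and_isContraction_iff [T2Space E] {Γ : LinearConnection n m E}
    [CovariantDerivative.ContMDiffCovariantDerivative Γ ∞] (hΓ : Γ.torsion = 0)
    (G : Jet n m E 1 → Jet n m E 2) :
    (IsJetSection G ∧ IsContraction (associatedConnection Γ) G) ↔ G = geodesicSection Γ hΓ := by
  constructor
  · rintro ⟨h1, h2⟩
    funext θ
    exact (eq_geodesicSection hΓ ((isContraction_iff Γ h1).1 h2 θ)).trans (by rw [h1 θ])
  · rintro rfl
    have h : IsJetSection (geodesicSection Γ hΓ) := proj_geodesicSection hΓ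
    exact ⟨h, (isContraction_iff Γ h).2 (isGeodesicJet_geodesicSection hΓ)⟩

/-- In charts the section is b ↦ (b, -N_b(u, A u) v), smooth because the Christoffel symbols are. -/
lemma contMDiff_geodesicSection [T2Space E] {Γ : LinearConnection n m E}
    [CovariantDerivative.ContMDiffCovariantDerivative Γ ∞] (hΓ : Γ.torsion = 0) :
    ContMDiff 𝓘(ℝ, Model₁ n m) 𝓘(ℝ, Model₂ n m) ∞ (geodesicSection Γ hΓ) := by
  intro θ₀
  obtain ⟨e, hθ₀⟩ := exists_mem_source_jetChart₁ θ₀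
  have θ₁ : Jet n m E 2 := jet 2 θ₀.out
  set Φ : Jet n m E 1 → Model₁ n m := fun θ => (jetChart₁ e θ₀).chart θ with hΦ
  -- `symmetrize` fixes symmetric forms; using this linear retraction makes the map into the
  -- subspace smooth by composition.
  have hcoord : ∀ θ ∈ (jetChart₁ e θ₀).chart.source,
      (jetChart₂ e θ₁).chart (geodesicSection Γ hΓ θ) =
        (Φ θ, symmetrize (geodesicForm Γ e (Φ θ))) := by
    intro θ hθ
    have hp := proj_geodesicSection hΓ θ
    have hθ' : geodesicSection Γ hΓ θ ∈ (jetChart₂ e θ₁).chart.source :=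
      (proj_mem_source_iff (θ₀ := θ₀)).1 (hp.symm ▸ hθ)
    have h1 : ((jetChart₂ e θ₁).chart (geodesicSection Γ hΓ θ)).1 = Φ θ := by
      rw [← jetChart₁_proj (θ₀ := θ₀) hθ', hp]
    refine Prod.ext h1 (Subtype.ext ?_)
    rw [(isGeodesicJet_iff hθ').1 (isGeodesicJet_geodesicSection hΓ θ), h1,
      coe_symmetrize (geodesicForm_mem hΓ (jetChart₁_mem_target hθ))]
  have h1 : ContMDiffAt 𝓘(ℝ, Model₁ n m) 𝓘(ℝ, Model₁ n m) ∞ Φ θ₀ :=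
    SmoothChart.contMDiffAt (c := (jetChart₁ e θ₀).toSmoothChart) hθ₀
  have h2 : ContMDiffAt 𝓘(ℝ, Model₁ n m) 𝓘(ℝ, Euc n →L[ℝ] Euc n →L[ℝ] Euc m) ∞
      (fun θ => geodesicForm Γ e (Φ θ)) θ₀ := by
    have hgraph : ContDiff ℝ ∞ (fun b : Model₁ n m => graphMap b.2) :=
      (contDiff_graphMap (V := Euc n) (W := Euc m)).comp contDiff_snd
    have h3 : ContMDiffAt 𝓘(ℝ, Model₁ n m) 𝓘(ℝ, Euc n →L[ℝ] Euc n × Euc m) ∞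
        (fun θ => graphMap (Φ θ).2) θ₀ :=
      hgraph.contMDiff.contMDiffAt.comp (g := fun b : Model₁ n m => graphMap b.2) θ₀ h1
    exact ((contMDiffAt_normalForm (Γ := Γ) hθ₀).clm_comp h3).neg
  have h3 : ContMDiffAt 𝓘(ℝ, Model₁ n m) 𝓘(ℝ, symBilin (Euc n) (Euc m)) ∞
      (fun θ => symmetrize (geodesicForm Γ e (Φ θ))) θ₀ :=
    ContMDiffAt.comp θ₀ contDiff_symmetrize.contMDiff.contMDiffAt h2
  have h4 : ContMDiffAt 𝓘(ℝ, Model₁ n m) 𝓘(ℝ, Model₂ n m) ∞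
      (fun θ => ((Φ θ, symmetrize (geodesicForm Γ e (Φ θ))) : Model₂ n m)) θ₀ :=
    h1.prodMk_space h3
  have hmem : ((Φ θ₀, symmetrize (geodesicForm Γ e (Φ θ₀))) : Model₂ n m) ∈
      (jetChart₂ e θ₁).chart.target := jetChart₁_mem_target hθ₀
  have h5 := ContMDiffAt.comp θ₀
    (SmoothChart.contMDiffAt_symm (c := (jetChart₂ e θ₁).toSmoothChart) hmem) h4
  refine h5.congr_of_eventuallyEq ?_
  filter_upwards [(jetChart₁ e θ₀).chart.open_source.mem_nhds hθ₀] with θ hθ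
  have hθ' : geodesicSection Γ hΓ θ ∈ (jetChart₂ e θ₁).chart.source :=
    (proj_mem_source_iff (θ₀ := θ₀)).1 ((proj_geodesicSection hΓ θ).symm ▸ hθ)
  exact ((congrArg (jetChart₂ e θ₁).chart.symm (hcoord θ hθ)).symm.trans
    ((jetChart₂ e θ₁).chart.left_inv hθ')).symm

end GeodesicJets

/-! ### The universal second fundamental form and its zero set. -/

section SecondFundamentalForm

section Plane

variable {e : DividedChart n m E} {θ₁ θ : Jet n m E 2}

/-- The first `n` components of the vectors of `H^{2,0}_θ`. -/
def planeCoord (e : DividedChart n m E) (θ : Jet n m E 2) : θ.plane →ₗ[ℝ] Euc n :=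
  LinearMap.fst ℝ (Euc n) (Euc m) ∘ₗ
    (e.smoothChart.deriv θ.point : TangentSpace (𝓡 (n + m)) θ.point →ₗ[ℝ] Euc n × Euc m) ∘ₗ
      θ.plane.subtype

lemma planeCoord_apply (X : θ.plane) :
    planeCoord e θ X = (e.smoothChart.deriv θ.point X).1 := rfl

lemma deriv_eq_graphMap (hθ : θ ∈ (jetChart₂ e θ₁).chart.source) (X : θ.plane) :
    e.smoothChart.deriv θ.point X =
      (planeCoord e θ X, ((jetChart₂ e θ₁).chart θ).1.2 (planeCoord e θ X)) :=
  Prod.ext rfl (((jetChart₂ e θ₁).mem_plane_iff hθ).1 X.2)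

lemma planeCoord_injective (hθ : θ ∈ (jetChart₂ e θ₁).chart.source) :
    Function.Injective (planeCoord e θ) := by
  intro X Y h
  refine Subtype.ext (SmoothChart.deriv_injective (SlopeChart.point_mem_source hθ) ?_)
  rw [deriv_eq_graphMap hθ X, deriv_eq_graphMap hθ Y, h]

lemma planeCoord_surjective (hθ : θ ∈ (jetChart₂ e θ₁).chart.source) :
    Function.Surjective (planeCoord e θ) := by
  intro u
  have h1 : e.smoothChart.deriv θ.point
      (e.smoothChart.vector θ.point (u, ((jetChart₂ e θ₁).chart θ).1.2 u)) =
        (u, ((jetChart₂ e θ₁).chart θ).1.2 u) :=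
    SmoothChart.deriv_vector (SlopeChart.point_mem_source hθ) _
  refine ⟨⟨e.smoothChart.vector θ.point (u, ((jetChart₂ e θ₁).chart θ).1.2 u),
    ((jetChart₂ e θ₁).mem_plane_iff hθ).2 ?_⟩, congrArg Prod.fst h1⟩
  rw [h1]
  rfl

end Plane

variable [IsManifold (𝓡 (n + m)) ∞ E] {Γ : LinearConnection n m E}

/-- The coordinates of the second fundamental form at the `2`-jet with coordinates `b`. -/
def secondFormCoord (Γ : LinearConnection n m E) (e : DividedChart n m E) (b : Model₂ n m) :
    Euc n →L[ℝ] Euc n →L[ℝ] Euc m :=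
  (b.2 : Euc n →L[ℝ] Euc n →L[ℝ] Euc m) - geodesicForm Γ e b.1

lemma secondFormCoord_symm (hΓ : Γ.torsion = 0) {e : DividedChart n m E} {b : Model₂ n m}
    (hb : b.1.1 ∈ e.chart.target) (u v : Euc n) :
    secondFormCoord Γ e b u v = secondFormCoord Γ e b v u := by
  have h1 : (b.2 : Euc n →L[ℝ] Euc n →L[ℝ] Euc m) u v =
    (b.2 : Euc n →L[ℝ] Euc n →L[ℝ] Euc m) v u := b.2.2 u v
  exact congrArg₂ (· - ·) h1 (geodesicForm_mem hΓ hb u v)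

section SecondForm

variable {e : DividedChart n m E} {θ₁ θ : Jet n m E 2}

/-- A Cartan vector over X = (u, A u) has slope part B u, so `normalDeriv_eq` yields B u v + N(u, A
u) v. Only the values X and Y θ occur, which is why II is well defined. -/
lemma normalDeriv_jet₂ (hθ : θ ∈ (jetChart₂ e θ₁).chart.source)
    {Y : ∀ θ : Jet n m E 2, TangentSpace (𝓡 (n + m)) θ.point}
    (hY : IsHorizontalSectionAt (Model₂ n m) Y θ) {X : θ.plane}
    {X' : TangentSpace 𝓘(ℝ, Model₂ n m) θ} (hX' : X' ∈ θ.cartanPlane)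
    (hX : mfderiv 𝓘(ℝ, Model₂ n m) (𝓡 (n + m)) (Jet.point : Jet n m E 2 → E) θ X' = X) :
    normalDeriv Γ θ X' Y = e.toNormal θ (secondFormCoord Γ e ((jetChart₂ e θ₁).chart θ)
      (planeCoord e θ X) (planeCoord e θ ⟨Y θ, hY.1 θ⟩)) := by
  obtain ⟨u, hu⟩ := exists_of_mem_cartanPlane hθ hX'
  have h1 := SlopeChart.deriv_mfderiv_point (Φ := jetChart₂ e θ₁) hθ X'
  rw [hX] at h1
  have h2 : (jetChart₂ e θ₁).base ((jetChart₂ e θ₁).deriv θ X') =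
      (u, ((jetChart₂ e θ₁).chart θ).1.2 u) :=
    (congrArg Prod.fst hu).trans (congrArg Prod.fst (rPlaneMap_apply _ u))
  have h3 : (jetChart₂ e θ₁).slope ((jetChart₂ e θ₁).deriv θ X') =
      (((jetChart₂ e θ₁).chart θ).2 : Euc n →L[ℝ] Euc n →L[ℝ] Euc m) u :=
    (congrArg Prod.snd hu).trans (congrArg Prod.snd (rPlaneMap_apply _ u))
  have h4 : planeCoord e θ X = u := congrArg Prod.fst (h1.trans h2)
  rw [SlopeChart.normalDeriv_eq hθ hY X', SlopeChart.chart_point hθ, h2, h3, h4]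
  congr 1
  change _ = (((jetChart₂ e θ₁).chart θ).2 : Euc n →L[ℝ] Euc n →L[ℝ] Euc m) u _ -
    geodesicForm Γ e ((jetChart₂ e θ₁).chart θ).1 u _
  rw [geodesicForm_apply, sub_neg_eq_add]
  rfl

/-- The universal second fundamental form in the divided chart `e`. -/
def secondFormIn (Γ : LinearConnection n m E) (e : DividedChart n m E) (θ : Jet n m E 2) :
    θ.plane →ₗ[ℝ] θ.plane →ₗ[ℝ] (TangentSpace (𝓡 (n + m)) θ.point ⧸ θ.plane) :=
  LinearMap.mk₂ ℝ (fun X Y => e.toNormal θ (secondFormCoord Γ e ((jetChart₂ e θ).chart θ)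
      (planeCoord e θ X) (planeCoord e θ Y)))
    (fun _ _ _ => by simp only [map_add, add_apply])
    (fun _ _ _ => by simp only [map_smul, smul_apply])
    (fun _ _ _ => by simp only [map_add])
    (fun _ _ _ => by simp only [map_smul])

lemma secondFormIn_apply (X Y : θ.plane) :
    secondFormIn Γ e θ X Y = e.toNormal θ (secondFormCoord Γ e ((jetChart₂ e θ).chart θ)
      (planeCoord e θ X) (planeCoord e θ Y)) := rfl

end SecondForm

/-- The universal second fundamental form of `Γ`. -/
def secondForm (Γ : LinearConnection n m E) : JetBilinearForm n m E := fun θ =>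
  secondFormIn Γ (exists_mem_source_jetChart₂ θ).choose θ

lemma secondForm_symm (hΓ : Γ.torsion = 0) (θ : Jet n m E 2) (X Y : θ.plane) :
    secondForm Γ θ X Y = secondForm Γ θ Y X := by
  have hθ := (exists_mem_source_jetChart₂ θ).choose_spec
  rw [secondForm, secondFormIn_apply, secondFormIn_apply, secondFormCoord_symm hΓ]
  exact (jetChart₂ _ θ).chart.map_source hθ

/-- Uniqueness holds because every pair of vectors of the plane is realized by a Cartan vector and a
horizontal section; existence is `normalDeriv_jet₂`. -/
lemma isUniversalSecondFundamentalForm_iff (B : JetBilinearForm n m E) :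
    IsUniversalSecondFundamentalForm Γ B ↔ B = secondForm Γ := by
  constructor
  · intro h
    funext θ
    have hθ := (exists_mem_source_jetChart₂ θ).choose_spec
    set e := (exists_mem_source_jetChart₂ θ).choose with he
    ext X Y
    obtain ⟨Y', hY', hY⟩ := (jetChart₂ e θ).exists_horizontalSection hθ (planeCoord e θ Y)
    obtain ⟨X', hX', hX⟩ := exists_mem_cartanPlane hθ (planeCoord e θ X)
    have hYc : planeCoord e θ ⟨Y' θ, hY'.1 θ⟩ = planeCoord e θ Y := by
      rw [planeCoord_apply, hY]
    have hYθ : (⟨Y' θ, hY'.1 θ⟩ : θ.plane) = Y := planeCoord_injective hθ hYc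
    have hXθ : mfderiv 𝓘(ℝ, Model₂ n m) (𝓡 (n + m)) (Jet.point : Jet n m E 2 → E) θ X' = X := by
      refine SmoothChart.deriv_injective (SlopeChart.point_mem_source hθ) ?_
      refine (SlopeChart.deriv_mfderiv_point hθ X').trans ?_
      rw [deriv_eq_graphMap hθ X]
      exact (congrArg Prod.fst hX).trans (congrArg Prod.fst (rPlaneMap_apply _ _))
    have h1 := h θ X X' Y' hY' hX' hXθ
    rw [normalDeriv_jet₂ hθ hY' hX' hXθ, hYθ] at h1
    exact h1
  · rintro rfl θ X X' Y hY hX' hX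
    exact (normalDeriv_jet₂ (exists_mem_source_jetChart₂ θ).choose_spec hY hX' hX).symm

/-- In coordinates II is B minus the geodesic value of B, read through a surjection from the plane
and an injection into the normal space; neither loses information. -/
lemma secondForm_eq_zero_iff (θ : Jet n m E 2) : secondForm Γ θ = 0 ↔ IsGeodesicJet Γ θ := by
  have hθ := (exists_mem_source_jetChart₂ θ).choose_spec
  rw [isGeodesicJet_iff hθ, secondForm]
  set e := (exists_mem_source_jetChart₂ θ).choose with he
  rw [← sub_eq_zero (a := (((jetChart₂ e θ).chart θ).2 : Euc n →L[ℝ] Euc n →L[ℝ] Euc m))]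
  change _ ↔ secondFormCoord Γ e ((jetChart₂ e θ).chart θ) = 0
  constructor
  · intro h
    ext1 u
    ext1 v
    obtain ⟨X, rfl⟩ := planeCoord_surjective hθ u
    obtain ⟨Y, rfl⟩ := planeCoord_surjective hθ v
    refine SlopeChart.toNormal_injective hθ ?_
    rw [← secondFormIn_apply, h]
    exact (map_zero (e.toNormal θ)).symm
  · intro h
    ext X Y
    rw [secondFormIn_apply, h]
    exact map_zero (e.toNormal θ)

lemma range_geodesicSection (hΓ : Γ.torsion = 0) :
    Set.range (geodesicSection Γ hΓ) = totallyGeodesicEquation (secondForm Γ) := by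
  ext θ
  refine Iff.trans ?_ (secondForm_eq_zero_iff θ).symm
  constructor
  · rintro ⟨θ', rfl⟩
    exact isGeodesicJet_geodesicSection hΓ θ'
  · intro h
    exact ⟨_, (eq_geodesicSection hΓ h).symm⟩

end SecondFundamentalForm

end JetCharts

end

end SubmanifoldJet

/-! ### Assembly of the main theorem. -/

theorem mainTheorem2 (n m : ℕ) {E : Type*} [TopologicalSpace E] [T2Space E]
    [ChartedSpace (EuclideanSpace ℝ (Fin (n + m))) E] [IsManifold (𝓡 (n + m)) ∞ E]
    (Γ : CovariantDerivative (𝓡 (n + m)) (EuclideanSpace ℝ (Fin (n + m)))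
      (TangentSpace (𝓡 (n + m)) : E → Type _))
    [CovariantDerivative.ContMDiffCovariantDerivative Γ ∞] (hΓ : Γ.torsion = 0) :
    ∃ (D : JetConnection n m E) (II : JetBilinearForm n m E) (G : Jet n m E 1 → Jet n m E 2),
      (∀ D', IsAssociatedConnection Γ D' ↔ D' = D) ∧
      (∀ B, IsUniversalSecondFundamentalForm Γ B ↔ B = II) ∧
      (∀ θ X Y, II θ X Y = II θ Y X) ∧
      ContMDiff 𝓘(ℝ, Model₁ n m) 𝓘(ℝ, Model₂ n m) ∞ G ∧
      (∀ G', (IsJetSection G' ∧ IsContraction D G') ↔ G' = G) ∧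
      Set.range G = totallyGeodesicEquation II :=
  ⟨associatedConnection Γ, secondForm Γ, geodesicSection Γ hΓ, isAssociatedConnection_iff Γ,
    isUniversalSecondFundamentalForm_iff, secondForm_symm hΓ, contMDiff_geodesicSection hΓ,
    isJetSection_and_isContraction_iff hΓ, range_geodesicSection hΓ⟩
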